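/- **Setting.** Let $n\ge 1$, let $X_1,\dots,X_n\in\mathbb R^{d\times k}$, let $\lambda,\gamma>0$, and let $\|\cdot\|_P$ be a norm on $\mathbb R^k$ with dual norm $\|\cdot\|_D$. Let $\phi_i:\mathbb R^k\to\mathbb R$ be convex and $(1/\gamma)$-smooth w.r.t. $\|\cdot\|_P$ (differentiable, with $\|\nabla\phi_i(a)-\nabla\phi_i(b)\|_D\le\gamma^{-1}\|a-b\|_P$), and let $g:\mathbb R^d\to(-\infty,\infty]$ be proper, closed (lower semicontinuous) and $1$-strongly convex w.r.t. the Euclidean norm. Let $\|X_i\|_{D\to 2}\le R$ for all $i$, and $R^2/(\lambda\gamma)>10n$. With $f^*(y)=\sup_x[y^\top x-f(x)]$ put $$P(w)=\tfrac1n\sum_i\phi_i(X_i^\top w)+\lambda g(w),\qquad D(\alpha)=\tfrac1n\sum_i-\phi_i^*(-\alpha_i)-\lambda g^*(v(\alpha)),\qquad v(\alpha)=\tfrac1{\lambda n}\sum_iX_i\alpha_i,$$ and $w(\alpha)=\nabla g^*(v(\alpha))$. Assume that $P(0)$ and $D(0)$ are finite. Let $\epsilon>0$. **Prox-SDCA$(P,\epsilon',\alpha^{(0)})$.**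 For $t=1,2,\dots$: let $w^{(t-1)}=w(\alpha^{(t-1)})$, draw $i$ uniformly from $\{1,\dots,n\}$ (independently of the past), and let $\alpha^{(t)}$ be $\alpha^{(t-1)}$ with $\alpha_i$ replaced by $\alpha_i+\Delta\alpha_i$. With $w=w^{(t-1)}$, $\alpha=\alpha^{(t-1)}$, $q=-\nabla\phi_i(X_i^\top w)-\alpha_i$ and $F(\Delta)=-\phi_i^*(-(\alpha_i+\Delta))-w^\top X_i\Delta-\frac1{2\lambda n}\|X_i\Delta\|_2^2$, the vector $\Delta\alpha_i$ is one of: (I) a maximizer of $F$; (II) $sq$ with $s\in[0,1]$ maximizing $F(sq)$; (III) $sq$ with $$s=\min\Big(1,\frac{\phi_i(X_i^\top w)+\phi_i^*(-\alpha_i)+w^\top X_i\alpha_i+\frac\gamma2\|q\|_D^2}{\|q\|_D^2(\gamma+\frac1{\lambda n}\|X_i\|_{D\to2}^2)}\Big)$$ ($s=0$ if $q=0$); (IV) the same with $R^2$ instead of $\|X_i\|_{D\to2}^2$; (V) $sq$ with $s=\frac{\lambda n\gamma}{R^2+\lambda n\gamma}$; or any other vector for which the new dual value is at least the one given by one of (I)–(V).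 The choice may depend on the problem, on $t$, on $\alpha^{(t-1)}$ and on $i$. Let $W=n+\lceil R^2/(\lambda\gamma)\rceil$ and $T_0=t-W$. Once every $m$ iterations (at the multiples $t\ge W$ of a fixed integer $m\ge1$) form the candidate $(\bar w,\bar\alpha)$: either the average of $(w^{(i-1)},\alpha^{(i-1)})$ over $T_0<i\le t$, or $(w^{(i)},\alpha^{(i)})$ for a uniformly random $i$ with $T_0<i\le t$. If $P(\bar w)-D(\bar\alpha)\le\epsilon'$, stop and return $(\bar w,\bar\alpha,P(\bar w)-D(\bar\alpha))$. Running time of a call: $d$ per iteration, $dn$ for the initialization, and $dn$ per evaluation of the duality gap (evaluations being charged once per $m$ iterations). **Accelerated Prox-SDCA.** Put $\kappa=\frac{R^2}{\gamma n}-\lambda$, $\mu=\lambda/2$, $\rho=\mu+\kappa$, $\eta=\sqrt{\mu/\rho}$, $\beta=\frac{1-\eta}{1+\eta}$, $y^{(1)}=w^{(1)}=0$, $\alpha^{(1)}=0$, $\xi_1=(1+\eta^{-2})(P(0)-D(0))$ and $\xi_t=(1-\eta/2)^{t-1}\xi_1$. For $t=2,3,\dots$ call $$(w^{(t)},\alpha^{(t)},\epsilon_t)=\text{Prox-SDCA}\Big(\tilde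 P_t,\tfrac{\eta}{2(1+\eta^{-2})}\xi_{t-1},\alpha^{(t-1)}\Big)$$ for $\tilde P_t(w)=\frac1n\sum_i\phi_i(X_i^\top w)+\tilde\lambda\tilde g_t(w)$, where $\tilde\lambda=\lambda+\kappa$ and $\tilde\lambda\tilde g_t(w)=\lambda g(w)+\frac\kappa2\|w\|_2^2-\kappa w^\top y^{(t-1)}$ (so $\tilde\lambda,\tilde g_t$ take the place of $\lambda,g$ in the call); put $y^{(t)}=w^{(t)}+\beta(w^{(t)}-w^{(t-1)})$; stop and return $w^{(t)}$ if $t\ge1+\frac2\eta\log(\xi_1/\epsilon)$ or if $(1+\frac\rho\mu)\epsilon_t+\frac{\rho\kappa}{2\mu}\|w^{(t)}-y^{(t-1)}\|_2^2\le\epsilon$. **Theorem.** (i) *Correctness.* $P$ has a unique minimizer $w^*$, and for every realization of the random draws on which the algorithm terminates, say at iteration $t$, one has $P(w^{(t)})-P(w^*)\le\epsilon$. (ii) *Runtime.* If $\epsilon\le\xi_1$, then for every realization the number of outer iterations that are executed is at most $$1+\frac2\eta\log\frac{\xi_1}\epsilon\;\le\;1+\sqrt{\frac{8R^2}{\lambda\gamma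 n}}\Big(\log\frac{2R^2}{\lambda\gamma n}+\log\frac{P(0)-D(0)}\epsilon\Big);$$ if $\xi_1<\epsilon$, at most one outer iteration is executed. Moreover, there is an absolute constant $C$ such that for every outer iteration that is executed, conditionally on any realization of the previous ones, its single call of Prox-SDCA performs at most $C\,n\log\frac{R^2}{\lambda\gamma n}$ inner iterations in expectation if $m\le n$, and has expected running time at most $C\,d\,n\log\frac{R^2}{\lambda\gamma n}$ if $m=n$ (the stopping condition is tested once per pass over the data). -/

import Mathlib

open MeasureTheory

open scoped InnerProductSpace ENNReal

namespace ProxSDCA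

noncomputable section

/-- `m`-dimensional Euclidean space. -/
abbrev Vec (m : ℕ) : Type := EuclideanSpace ℝ (Fin m)

/-- Convex conjugate `f*(y) = sup_x [yᵀx - f(x)]` of an extended-real-valued function. -/
def conj {m : ℕ} (f : Vec m → EReal) (y : Vec m) : EReal :=
  ⨆ x : Vec m, ((⟪y, x⟫_ℝ : ℝ) : EReal) - f x

/-- Dual norm `‖y‖_D = sup_{‖x‖_P = 1} yᵀx`. -/
def dualNorm {k : ℕ} (p : Seminorm ℝ (Vec k)) (y : Vec k) : ℝ :=
  sSup {r : ℝ | ∃ x : Vec k, p x = 1 ∧ r = ⟪y, x⟫_ℝ}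

/-- Operator norm `‖X‖_{D → 2} = sup_{‖u‖_D = 1} ‖X u‖₂` of a `d × k` matrix, the latter being
regarded as a linear map. -/
def opNormD {d k : ℕ} (p : Seminorm ℝ (Vec k)) (X : Vec k →L[ℝ] Vec d) : ℝ :=
  sSup {r : ℝ | ∃ u : Vec k, dualNorm p u = 1 ∧ r = ‖X u‖}

/-- `φ` is `(1/γ)`-smooth with respect to `p`: it is differentiable and its gradient is
`(1/γ)`-Lipschitz from `p` to the dual norm of `p`. -/
def IsSmooth {k : ℕ} (p : Seminorm ℝ (Vec k)) (γ : ℝ) (φ : Vec k → ℝ) : Prop :=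
  Differentiable ℝ φ ∧
    ∀ a b : Vec k, dualNorm p (gradient φ a - gradient φ b) ≤ (1 / γ) * p (a - b)

/-- A proper, closed, convex function with values in `(-∞, ∞]` that is `m`-strongly convex with
respect to the Euclidean norm. -/
structure IsClosedStronglyConvex {d : ℕ} (m : ℝ) (g : Vec d → EReal) : Prop where
  ne_bot : ∀ w, g w ≠ ⊥
  proper : ∃ w, g w ≠ ⊤
  closed : LowerSemicontinuous g
  strong : StrongConvexOn {w | g w ≠ ⊤} m (fun w => (g w).toReal)

/-- The data of a regularized loss minimization problem: `n` losses on `ℝᵏ`, a regularizer on `ℝᵈ`,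
`d × k` matrices `X i` (as linear maps), the regularization parameter `λ`, the norm `‖·‖_P` on `ℝᵏ`
and the numbers `γ`, `R`. -/
structure Problem (d k n : ℕ) where
  φ : Fin n → Vec k → ℝ
  g : Vec d → EReal
  X : Fin n → Vec k →L[ℝ] Vec d
  lam : ℝ
  normP : Seminorm ℝ (Vec k)
  gam : ℝ
  R : ℝ

/-- The two ways in which Prox-SDCA forms its candidate output. -/
inductive OutputOption
  | averaging
  | random

namespace Problem

variable {d k n : ℕ} (Q : Problem d k n)

/-- Primal objective `P(w) = (1/n) ∑ φ_i(X_iᵀ w) + λ g(w)`. -/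
def primal (w : Vec d) : EReal :=
  (((1 / (n : ℝ)) * ∑ i, Q.φ i ((Q.X i).adjoint w) : ℝ) : EReal) + (Q.lam : EReal) * Q.g w

/-- The conjugate of the `i`-th loss. -/
def φConj (i : Fin n) (a : Vec k) : EReal := conj (fun x => (Q.φ i x : EReal)) a

/-- `v(α) = (1/(λ n)) ∑ X_i α_i`. -/
def v (α : Fin n → Vec k) : Vec d := (1 / (Q.lam * n)) • ∑ i, Q.X i (α i)

/-- `w(α) = ∇g*(v(α))`. -/
def wOf (α : Fin n → Vec k) : Vec d := gradient (fun θ => (conj Q.g θ).toReal) (Q.v α)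

/-- Dual objective `D(α) = (1/n) ∑ -φ_i*(-α_i) - λ g*(v(α))`. -/
def dual (α : Fin n → Vec k) : EReal :=
  ((1 / (n : ℝ) : ℝ) : EReal) * ∑ i, -Q.φConj i (-α i) - (Q.lam : EReal) * conj Q.g (Q.v α)

/-! ### Update rules of Prox-SDCA -/

/-- The objective that Option I maximizes over `Δα_i`. -/
def proxObj (α : Fin n → Vec k) (i : Fin n) (Δ : Vec k) : EReal :=
  -Q.φConj i (-(α i + Δ)) -
    ((⟪Q.wOf α, Q.X i Δ⟫_ℝ + (1 / (2 * Q.lam * n)) * ‖Q.X i Δ‖ ^ 2 : ℝ) : EReal)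

/-- `q = u - α_i` with `u = -∇φ_i(X_iᵀ w)`, used by Options II to V. -/
def qDir (α : Fin n → Vec k) (i : Fin n) : Vec k :=
  -gradient (Q.φ i) ((Q.X i).adjoint (Q.wOf α)) - α i

/-- The step size of Options III and IV, with `B` in the place of `‖X_i‖_{D → D'}²`. -/
def stepIII (B : ℝ) (α : Fin n → Vec k) (i : Fin n) : ℝ :=
  min 1 ((Q.φ i ((Q.X i).adjoint (Q.wOf α)) + (Q.φConj i (-α i)).toReal
      + ⟪Q.wOf α, Q.X i (α i)⟫_ℝ + Q.gam / 2 * dualNorm Q.normP (Q.qDir α i) ^ 2) /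
    (dualNorm Q.normP (Q.qDir α i) ^ 2 * (Q.gam + 1 / (Q.lam * n) * B)))

def IsOptionI (α : Fin n → Vec k) (i : Fin n) (Δ : Vec k) : Prop :=
  ∀ Δ' : Vec k, Q.proxObj α i Δ' ≤ Q.proxObj α i Δ

def IsOptionII (α : Fin n → Vec k) (i : Fin n) (Δ : Vec k) : Prop :=
  ∃ s ∈ Set.Icc (0 : ℝ) 1, Δ = s • Q.qDir α i ∧
    ∀ s' ∈ Set.Icc (0 : ℝ) 1, Q.proxObj α i (s' • Q.qDir α i) ≤ Q.proxObj α i (s • Q.qDir α i)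

def IsOptionIII (α : Fin n → Vec k) (i : Fin n) (Δ : Vec k) : Prop :=
  Δ = Q.stepIII (opNormD Q.normP (Q.X i) ^ 2) α i • Q.qDir α i

def IsOptionIV (α : Fin n → Vec k) (i : Fin n) (Δ : Vec k) : Prop :=
  Δ = Q.stepIII (Q.R ^ 2) α i • Q.qDir α i

def IsOptionV (α : Fin n → Vec k) (i : Fin n) (Δ : Vec k) : Prop :=
  Δ = (Q.lam * n * Q.gam / (Q.R ^ 2 + Q.lam * n * Q.gam)) • Q.qDir α i

/-- The dual vector with the `i`-th column changed by `Δ`. -/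
def bump (α : Fin n → Vec k) (i : Fin n) (Δ : Vec k) : Fin n → Vec k :=
  Function.update α i (α i + Δ)

/-- `Δ` is an admissible choice of `Δα_i`: it is given by one of the Options I to V, or it is any
other update whose dual objective is at least that of such an option. -/
def IsUpdate (α : Fin n → Vec k) (i : Fin n) (Δ : Vec k) : Prop :=
  ∃ Δ₀ : Vec k, (Q.IsOptionI α i Δ₀ ∨ Q.IsOptionII α i Δ₀ ∨ Q.IsOptionIII α i Δ₀ ∨
      Q.IsOptionIV α i Δ₀ ∨ Q.IsOptionV α i Δ₀) ∧
    Q.dual (bump α i Δ₀) ≤ Q.dual (bump α i Δ)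

/-! ### A call of Prox-SDCA -/

/-- The window length `t - T₀ = n + ⌈R² / (λ γ)⌉`. -/
def window : ℕ := n + ⌈Q.R ^ 2 / (Q.lam * Q.gam)⌉₊

instance [NeZero n] : NeZero Q.window :=
  ⟨fun h => NeZero.ne n (Nat.eq_zero_of_add_eq_zero_right h)⟩

/-- What is drawn at one inner iteration: the coordinate to update, and the position within the
window that the random output option picks. -/
abbrev Draw : Type := Fin n × Fin Q.window

/-- The law of the draws of one call: independent and uniform. -/
def drawMeasure [NeZero n] : Measure (ℕ → Q.Draw) :=
  Measure.infinitePi fun _ => (PMF.uniformOfFintype Q.Draw).toMeasure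

/-- The dual iterates `α⁽⁰⁾, α⁽¹⁾, …` of a call that starts at `α₀`; `U t α i` is the `Δα_i` used
at iteration `t` if the iterate is `α` and `i` is drawn. -/
def iter (U : ℕ → (Fin n → Vec k) → Fin n → Vec k) (α₀ : Fin n → Vec k) (ω : ℕ → Q.Draw) :
    ℕ → Fin n → Vec k
  | 0 => α₀
  | t + 1 => bump (iter U α₀ ω t) (ω (t + 1)).1 (U (t + 1) (iter U α₀ ω t) (ω (t + 1)).1)

/-- The candidate output `(w̄, ᾱ)` at iteration `t`, with `T₀ = t - window`: the average over
`T₀ + 1 ≤ i ≤ t` of `(w⁽ⁱ⁻¹⁾, α⁽ⁱ⁻¹⁾)`, or `(w⁽ⁱ⁾, α⁽ⁱ⁾)` for a random `i` in this range. -/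
def candidate (U : ℕ → (Fin n → Vec k) → Fin n → Vec k) (o : OutputOption)
    (α₀ : Fin n → Vec k) (ω : ℕ → Q.Draw) (t : ℕ) : Vec d × (Fin n → Vec k) :=
  match o with
  | .averaging =>
    ((1 / (Q.window : ℝ)) • ∑ i ∈ Finset.Icc (t - Q.window + 1) t, Q.wOf (Q.iter U α₀ ω (i - 1)),
      (1 / (Q.window : ℝ)) • ∑ i ∈ Finset.Icc (t - Q.window + 1) t, Q.iter U α₀ ω (i - 1))
  | .random =>
    (Q.wOf (Q.iter U α₀ ω (t - Q.window + 1 + (ω t).2)),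
      Q.iter U α₀ ω (t - Q.window + 1 + (ω t).2))

/-- The duality gap `P(w̄) - D(ᾱ)` of a candidate. -/
def gap (c : Vec d × (Fin n → Vec k)) : EReal := Q.primal c.1 - Q.dual c.2

/-- The call may stop at iteration `t`: the window fits (`0 ≤ T₀`), the stopping condition is tested
(once every `m` iterations), and the duality gap of the candidate is at most `acc`. -/
def StopsAt (U : ℕ → (Fin n → Vec k) → Fin n → Vec k) (o : OutputOption) (m : ℕ) (acc : ℝ)
    (α₀ : Fin n → Vec k) (ω : ℕ → Q.Draw) (t : ℕ) : Prop :=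
  Q.window ≤ t ∧ m ∣ t ∧ Q.gap (Q.candidate U o α₀ ω t) ≤ (acc : EReal)

/-- On the draws `ω` the call terminates and returns `(w̄, ᾱ, P(w̄) - D(ᾱ))`. -/
def Returns (U : ℕ → (Fin n → Vec k) → Fin n → Vec k) (o : OutputOption) (m : ℕ) (acc : ℝ)
    (α₀ : Fin n → Vec k) (ω : ℕ → Q.Draw) (w : Vec d) (α : Fin n → Vec k) (e : ℝ) : Prop :=
  ∃ t, IsLeast {t | Q.StopsAt U o m acc α₀ ω t} t ∧
    (w, α) = Q.candidate U o α₀ ω t ∧ e = (Q.gap (Q.candidate U o α₀ ω t)).toReal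

/-- The number of inner iterations of the call (`⊤` if it does not terminate). -/
def numIter (U : ℕ → (Fin n → Vec k) → Fin n → Vec k) (o : OutputOption) (m : ℕ) (acc : ℝ)
    (α₀ : Fin n → Vec k) (ω : ℕ → Q.Draw) : ℝ≥0∞ :=
  ⨅ t ∈ {t : ℕ | Q.StopsAt U o m acc α₀ ω t}, (t : ℝ≥0∞)

/-- The running time of the call: `d n` for the initialization, `d` for every inner iteration and
`d n` for every test of the stopping condition (evaluation of a duality gap). -/
def runtime (U : ℕ → (Fin n → Vec k) → Fin n → Vec k) (o : OutputOption) (m : ℕ) (acc : ℝ)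
    (α₀ : Fin n → Vec k) (ω : ℕ → Q.Draw) : ℝ≥0∞ :=
  d * n + d * Q.numIter U o m acc α₀ ω + d * n * (Q.numIter U o m acc α₀ ω / m)

/-! ### Accelerated Prox-SDCA -/

/-- The assumptions of Accelerated Prox-SDCA, together with `P(0) - D(0) < ∞`, which its
initialization needs. -/
structure Assumptions : Prop where
  n_pos : 0 < n
  lam_pos : 0 < Q.lam
  gam_pos : 0 < Q.gam
  norm_def : ∀ x, Q.normP x = 0 → x = 0
  φ_convex : ∀ i, ConvexOn ℝ Set.univ (Q.φ i)
  φ_smooth : ∀ i, IsSmooth Q.normP Q.gam (Q.φ i)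
  g_strong : IsClosedStronglyConvex 1 Q.g
  X_bound : ∀ i, opNormD Q.normP (Q.X i) ≤ Q.R
  cond : 10 * (n : ℝ) < Q.R ^ 2 / (Q.lam * Q.gam)
  primal_zero : Q.primal 0 ≠ ⊤
  dual_zero : Q.dual 0 ≠ ⊥

def kappa : ℝ := Q.R ^ 2 / (Q.gam * n) - Q.lam

def mu : ℝ := Q.lam / 2

def rho : ℝ := Q.mu + Q.kappa

def eta : ℝ := √(Q.mu / Q.rho)

def beta : ℝ := (1 - Q.eta) / (1 + Q.eta)

/-- `P(0) - D(0)`. -/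
def gapZero : ℝ := (Q.primal 0 - Q.dual 0).toReal

/-- `ξ_1 = (1 + η⁻²)(P(0) - D(0))`. -/
def xiOne : ℝ := (1 + (Q.eta ^ 2)⁻¹) * Q.gapZero

/-- `ξ_t = (1 - η/2)^(t-1) ξ_1`, for `t ≥ 1`. -/
def xi (t : ℕ) : ℝ := (1 - Q.eta / 2) ^ (t - 1) * Q.xiOne

/-- The accuracy that iteration `t + 1` asks of its Prox-SDCA call. -/
def innerAcc (t : ℕ) : ℝ := Q.eta / (2 * (1 + (Q.eta ^ 2)⁻¹)) * Q.xi t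

/-- The problem with objective `(1/n) ∑ φ_i(X_iᵀ w) + λ' g'(w)`, where `λ' = λ + κ` and
`λ' g'(w) = λ g(w) + (κ/2) ‖w‖² - κ wᵀ y`. -/
def regularized (y : Vec d) : Problem d k n :=
  { Q with
    lam := Q.lam + Q.kappa
    g := fun w => ((Q.lam / (Q.lam + Q.kappa) : ℝ) : EReal) * Q.g w +
      ((Q.kappa / (Q.lam + Q.kappa) * (‖w‖ ^ 2 / 2 - ⟪w, y⟫_ℝ) : ℝ) : EReal) }

/-- The extrapolated points: `y⁽¹⁾ = 0` and `y⁽ᵗ⁾ = w⁽ᵗ⁾ + β (w⁽ᵗ⁾ - w⁽ᵗ⁻¹⁾)` for `t ≥ 2`. -/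
def yOf (w : ℕ → Vec d) (t : ℕ) : Vec d :=
  if t ≤ 1 then 0 else w t + Q.beta • (w t - w (t - 1))

/-- One of the two stopping conditions of Accelerated Prox-SDCA holds at iteration `t ≥ 2`. -/
def AccStops (ε : ℝ) (w : ℕ → Vec d) (e : ℕ → ℝ) (t : ℕ) : Prop :=
  1 + 2 / Q.eta * Real.log (Q.xiOne / ε) ≤ (t : ℝ) ∨
    (1 + Q.rho / Q.mu) * e t + Q.rho * Q.kappa / (2 * Q.mu) * ‖w t - Q.yOf w (t - 1)‖ ^ 2 ≤ ε

/-- `(w⁽ᵗ⁾, α⁽ᵗ⁾, ε_t)`, `t ≤ T`, are produced by the outer iterations `2, …, T` of Accelerated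
Prox-SDCA for some realization of the draws, and no stopping condition holds before `T`. The rule
`U` may depend on the problem that the inner call solves. -/
structure IsRun (U : Problem d k n → ℕ → (Fin n → Vec k) → Fin n → Vec k) (o : OutputOption)
    (m : ℕ) (ε : ℝ) (T : ℕ) (w : ℕ → Vec d) (α : ℕ → Fin n → Vec k) (e : ℕ → ℝ) : Prop where
  one_le : 1 ≤ T
  w_init : w 1 = 0
  α_init : α 1 = 0
  call : ∀ t, 1 ≤ t → t < T → ∃ ω : ℕ → (Q.regularized (Q.yOf w t)).Draw,
    (Q.regularized (Q.yOf w t)).Returns (U (Q.regularized (Q.yOf w t))) o m (Q.innerAcc t) (α t) ω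
      (w (t + 1)) (α (t + 1)) (e (t + 1))
  continues : ∀ t, 2 ≤ t → t < T → ¬ Q.AccStops ε w e t

/-- The run terminates at outer iteration `T` and outputs `w⁽ᵀ⁾`. -/
def TerminatesAt (U : Problem d k n → ℕ → (Fin n → Vec k) → Fin n → Vec k) (o : OutputOption)
    (m : ℕ) (ε : ℝ) (T : ℕ) (w : ℕ → Vec d) (α : ℕ → Fin n → Vec k) (e : ℕ → ℝ) : Prop :=
  Q.IsRun U o m ε T w α e ∧ 2 ≤ T ∧ Q.AccStops ε w e T

/-- After the results up to `T`, the run goes on to outer iteration `T + 1`, which is the `T`-th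
outer iteration that is executed, because they are numbered from `2`. -/
def GoesOn (U : Problem d k n → ℕ → (Fin n → Vec k) → Fin n → Vec k) (o : OutputOption)
    (m : ℕ) (ε : ℝ) (T : ℕ) (w : ℕ → Vec d) (α : ℕ → Fin n → Vec k) (e : ℕ → ℝ) : Prop :=
  Q.IsRun U o m ε T w α e ∧ (2 ≤ T → ¬ Q.AccStops ε w e T)

end Problem

end

end ProxSDCA

namespace ProxSDCA

/-! ### Closed strongly convex functions -/

section StronglyConvex

variable {d : ℕ}

/-! The method is an inexact accelerated proximal point method whose subproblems are solved by
randomized dual coordinate ascent. The proof has an inner and an outer half, joined by a warm-start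
estimate.

Inner half. The duality gap is a sum of Fenchel–Young gaps, and at w = w(α) only those of the losses
survive (`Regular.gapR_wOf`). Since φ_i* is strongly convex and g* is 1-smooth, the step of Option V
raises the dual by at least `stepV`/n times the i-th loss gap, and every admissible update does at
least as well (`Regular.dual_increase`). On average over i the dual suboptimality drops by gap/r,
where r = n + R²/(λγ). The gap dominates the suboptimality, so the latter decays like (1 - 1/r)^t;
telescoping over a window of length at least r then bounds the expected gap of the candidate
(`Regular.lintegral_candidate_le`). By Markov's inequality the probabilities of rejection decay
geometrically, and their sum bounds the expected length of a call by O(r + m + r log K), where K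
bounds the ratio of initial suboptimality to requested accuracy (`Regular.lintegral_numIter_le`).

Outer half. A point whose duality gap in the regularized problem is e yields a quadratic minorant of
P with curvature μ = λ/2 and error (1 + ρ/μ)e (`primalR_add_le`). Averaging these minorants with
weight η (`estimate_step`) keeps P(w⁽ᵗ⁾) within ξ_t of the minimum of a quadratic minorant, which
justifies the first stopping condition; minimizing the latest minorant alone justifies the second.
Only certified gaps enter here, so the conclusion holds for every realization.

Joining them. The choice of κ gives r = 2n for every regularized problem. The estimate sequence also
keeps the centers y⁽ᵗ⁾ close to w*, so consecutive subproblems differ little, and a call starts with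
a gap of at most 68 η⁻⁵ times its target (`Assumptions.warm_start`). The logarithm of this ratio is
O(log(R²/(λγn))). -/

theorem IsClosedStronglyConvex.mul_add {m m' c : ℝ} {f : Vec d → EReal} {h : Vec d → ℝ}
    (hf : IsClosedStronglyConvex m f) (hc : 0 < c) (hcont : Continuous h)
    (hh : StrongConvexOn Set.univ m' h) :
    IsClosedStronglyConvex (c * m + m') fun w => (c : EReal) * f w + (h w : EReal) := by
  have htop : ∀ w, (c : EReal) * f w + (h w : EReal) ≠ ⊤ ↔ f w ≠ ⊤ := by
    intro w
    by_cases hw : f w = ⊤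
    · simp [hw, EReal.coe_mul_top_of_pos hc]
    · lift f w to ℝ using ⟨hw, hf.ne_bot w⟩ with r hr
      simp [← EReal.coe_mul, ← EReal.coe_add]
  refine ⟨fun w => ?_, ?_, ?_, ?_⟩
  · by_cases hw : f w = ⊤
    · simp [hw, EReal.coe_mul_top_of_pos hc]
    · lift f w to ℝ using ⟨hw, hf.ne_bot w⟩ with r hr
      rw [← EReal.coe_mul, ← EReal.coe_add]
      exact EReal.coe_ne_bot _
  · obtain ⟨w, hw⟩ := hf.proper
    exact ⟨w, (htop w).2 hw⟩
  · refine LowerSemicontinuous.add' ?_ ?_ fun x => ?_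
    · have hcm : Continuous fun x : EReal => (c : EReal) * x := by
        refine continuous_iff_continuousAt.2 fun x => ?_
        have h := EReal.continuousAt_mul (p := ((c : EReal), x))
          (Or.inl (EReal.coe_ne_zero.2 hc.ne')) (Or.inl (EReal.coe_ne_zero.2 hc.ne'))
          (Or.inl (EReal.coe_ne_bot c)) (Or.inl (EReal.coe_ne_top c))
        exact ContinuousAt.comp (f := fun x : EReal => ((c : EReal), x)) h (by fun_prop)
      exact hcm.comp_lowerSemicontinuous hf.closed fun a b hab =>
        mul_le_mul_of_nonneg_left hab (by exact_mod_cast hc.le)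
    · exact (continuous_coe_real_ereal.comp hcont).lowerSemicontinuous
    · exact EReal.continuousAt_add (Or.inr (EReal.coe_ne_bot _)) (Or.inr (EReal.coe_ne_top _))
  · have hset : {w | (c : EReal) * f w + (h w : EReal) ≠ ⊤} = {w | f w ≠ ⊤} := by
      ext w; exact htop w
    rw [hset]
    have hreal : ∀ w, f w ≠ ⊤ →
        ((c : EReal) * f w + (h w : EReal)).toReal = c * (f w).toReal + h w := by
      intro w hw
      lift f w to ℝ using ⟨hw, hf.ne_bot w⟩ with r hr
      rw [← EReal.coe_mul, ← EReal.coe_add, EReal.toReal_coe, EReal.toReal_coe]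
    refine ⟨hf.strong.1, fun x hx y hy a b ha hb hab => ?_⟩
    have hz := hf.strong.1 hx hy ha hb hab
    have h1 := hf.strong.2 hx hy ha hb hab
    have h2 := hh.2 (Set.mem_univ x) (Set.mem_univ y) ha hb hab
    simp only [smul_eq_mul] at h1 h2 ⊢
    rw [hreal _ hz, hreal _ hx, hreal _ hy]
    nlinarith [mul_le_mul_of_nonneg_left h1 hc.le]

/-- On the segment from `x₀` to `x`, minimality bounds the values from below and strong convexity
from above. Dividing by the weight of `x` and letting it tend to 0 gives the full constant m/2. -/
theorem IsClosedStronglyConvex.le_of_isMin {m : ℝ} {f : Vec d → EReal}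
    (hf : IsClosedStronglyConvex m f) {x₀ : Vec d} (h₀ : f x₀ ≠ ⊤) (hmin : ∀ x, f x₀ ≤ f x)
    (x : Vec d) : f x₀ + ((m / 2 * ‖x - x₀‖ ^ 2 : ℝ) : EReal) ≤ f x := by
  by_cases hx : f x = ⊤
  · simp [hx]
  have key : (f x₀).toReal + m / 2 * ‖x - x₀‖ ^ 2 ≤ (f x).toReal := by
    have hlim : Filter.Tendsto (fun a : ℝ => (f x₀).toReal + a * (m / 2 * ‖x - x₀‖ ^ 2))
        (nhdsWithin 1 (Set.Iio 1)) (nhds ((f x₀).toReal + 1 * (m / 2 * ‖x - x₀‖ ^ 2))) :=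
      Continuous.tendsto' (by fun_prop) _ _ rfl |>.mono_left nhdsWithin_le_nhds
    rw [one_mul] at hlim
    refine le_of_tendsto hlim ?_
    filter_upwards [Ioo_mem_nhdsLT (show (0 : ℝ) < 1 by norm_num)] with a ha
    have hb : 0 < 1 - a := by linarith [ha.2]
    have hz := hf.strong.1 h₀ hx ha.1.le hb.le (by ring)
    have h1 := hf.strong.2 h₀ hx ha.1.le hb.le (by ring)
    have h2 := EReal.toReal_le_toReal (hmin (a • x₀ + (1 - a) • x)) (hf.ne_bot _) hz
    simp only [smul_eq_mul] at h1
    rw [norm_sub_rev x₀ x] at h1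
    have h3 : (1 - a) * ((f x₀).toReal + a * (m / 2 * ‖x - x₀‖ ^ 2)) ≤ (1 - a) * (f x).toReal := by
      linarith
    exact le_of_mul_le_mul_left h3 hb
  rw [← EReal.coe_toReal h₀ (hf.ne_bot _), ← EReal.coe_toReal hx (hf.ne_bot _), ← EReal.coe_add]
  exact_mod_cast key

/-- By compactness f is bounded below on the unit ball about a point z of its domain, and strong
convexity turns this into quadratic growth along the rays from z. So f is at least f z outside a
large ball, and the minimum over that ball is global. -/
theorem IsClosedStronglyConvex.exists_isMin {m : ℝ} {f : Vec d → EReal}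
    (hf : IsClosedStronglyConvex m f) (hm : 0 < m) : ∃ x₀, f x₀ ≠ ⊤ ∧ ∀ x, f x₀ ≤ f x := by
  obtain ⟨z, hz⟩ := hf.proper
  obtain ⟨c, -, hc⟩ := LowerSemicontinuousOn.exists_isMinOn
    ⟨z, Metric.mem_closedBall_self zero_le_one⟩
    (isCompact_closedBall z 1) (hf.closed.lowerSemicontinuousOn (Metric.closedBall z 1))
  rw [isMinOn_iff] at hc
  have hcz := hc z (Metric.mem_closedBall_self zero_le_one)
  have hc_top : f c ≠ ⊤ := fun h => hz (by rw [h] at hcz; exact top_le_iff.1 hcz)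
  set δ := (f z).toReal - (f c).toReal with hδ
  -- Beyond radius `r + 1` the quadratic growth m/2 · s(s - 1) outweighs the possible linear
  -- decrease s|δ|.
  set r := 1 + 2 * |δ| / m with hr
  have hr1 : 1 ≤ r := by
    have : 0 ≤ 2 * |δ| / m := by positivity
    linarith
  obtain ⟨x₀, -, hx₀⟩ := LowerSemicontinuousOn.exists_isMinOn
    ⟨z, Metric.mem_closedBall_self (show (0 : ℝ) ≤ r + 1 by linarith)⟩
    (isCompact_closedBall z (r + 1)) (hf.closed.lowerSemicontinuousOn _)
  rw [isMinOn_iff] at hx₀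
  have hx₀z := hx₀ z (Metric.mem_closedBall_self (by linarith))
  refine ⟨x₀, fun h => hz (by rw [h] at hx₀z; exact top_le_iff.1 hx₀z), fun x => ?_⟩
  by_cases hx : x ∈ Metric.closedBall z (r + 1)
  · exact hx₀ x hx
  refine hx₀z.trans ?_
  by_cases hxt : f x = ⊤
  · simp [hxt]
  set s := ‖x - z‖ with hs
  have hsr : r + 1 < s := by simpa [dist_eq_norm] using hx
  have hs0 : 0 < s := by linarith
  have hsum : (1 - s⁻¹) + s⁻¹ = 1 := by ring
  have hs1 : s⁻¹ ≤ 1 := inv_le_one_of_one_le₀ (by linarith)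
  have hy := hf.strong.1 hz hxt (by linarith) (by positivity) hsum
  have h1 := hf.strong.2 hz hxt (by linarith) (by positivity) hsum
  -- The segment from z to x is tested where it leaves the unit ball, because `f c` is a lower bound
  -- there.
  have hmem : (1 - s⁻¹) • z + s⁻¹ • x ∈ Metric.closedBall z 1 := by
    have : (1 - s⁻¹) • z + s⁻¹ • x - z = s⁻¹ • (x - z) := by module
    rw [Metric.mem_closedBall, dist_eq_norm, this, norm_smul, ← hs, Real.norm_eq_abs,
      abs_of_pos (by positivity), inv_mul_cancel₀ hs0.ne']
  have h2 := EReal.toReal_le_toReal (hc _ hmem) (hf.ne_bot _) hy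
  simp only [smul_eq_mul] at h1
  rw [norm_sub_rev z x, ← hs] at h1
  have h3 : (f c).toReal ≤ (1 - s⁻¹) * (f z).toReal + s⁻¹ * (f x).toReal
      - (1 - s⁻¹) * s⁻¹ * (m / 2 * s ^ 2) := h2.trans h1
  have h4 : s * (f c).toReal ≤ (s - 1) * (f z).toReal + (f x).toReal - (s - 1) * (m / 2 * s) := by
    have := mul_le_mul_of_nonneg_left h3 hs0.le
    have e : s * ((1 - s⁻¹) * (f z).toReal + s⁻¹ * (f x).toReal
      - (1 - s⁻¹) * s⁻¹ * (m / 2 * s ^ 2)) =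
        (s - 1) * (f z).toReal + (f x).toReal - (s - 1) * (m / 2 * s) := by
      field_simp
    linarith
  have h5 : |δ| ≤ m / 2 * (s - 1) := by
    have : 2 * |δ| / m ≤ s - 1 := by linarith
    rw [div_le_iff₀ hm] at this
    linarith
  have h6 : s * δ ≤ s * |δ| := mul_le_mul_of_nonneg_left (le_abs_self _) hs0.le
  have h7 : s * |δ| ≤ s * (m / 2 * (s - 1)) := mul_le_mul_of_nonneg_left h5 hs0.le
  have key : (f z).toReal ≤ (f x).toReal := by nlinarith
  rw [← EReal.coe_toReal hz (hf.ne_bot _), ← EReal.coe_toReal hxt (hf.ne_bot _)]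
  exact_mod_cast key

theorem strongConvexOn_inner (θ : Vec d) : StrongConvexOn Set.univ 0 fun x : Vec d => ⟪θ, x⟫_ℝ :=
  strongConvexOn_zero.2 ((innerₛₗ ℝ θ).convexOn convex_univ)

theorem strongConvexOn_norm_sq (c : ℝ) :
    StrongConvexOn Set.univ c fun x : Vec d => c / 2 * ‖x‖ ^ 2 := by
  rw [strongConvexOn_iff_convex]
  simpa using convexOn_const (0 : ℝ) convex_univ

/-- The supremum that defines the conjugate of a closed strongly convex function is attained. -/
theorem IsClosedStronglyConvex.conj_attained {g : Vec d → EReal} (hg : IsClosedStronglyConvex 1 g)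
    (θ : Vec d) : ∃ w, g w ≠ ⊤ ∧ conj g θ = ((⟪θ, w⟫_ℝ - (g w).toReal : ℝ) : EReal) ∧
      ∀ x, g x ≠ ⊤ → (g w).toReal + ⟪θ, x - w⟫_ℝ + 1 / 2 * ‖x - w‖ ^ 2 ≤ (g x).toReal := by
  -- The maximizer in the conjugate at θ is the minimizer of g tilted by -θ.
  have hf := hg.mul_add one_pos (by fun_prop) (strongConvexOn_inner (-θ))
  obtain ⟨w, hw, hmin⟩ := hf.exists_isMin (by norm_num)
  have hle := hf.le_of_isMin hw hmin
  have hwt : g w ≠ ⊤ := by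
    rintro h; simp [h] at hw
  have key : ∀ x, g x ≠ ⊤ →
      (g w).toReal + ⟪θ, x - w⟫_ℝ + 1 / 2 * ‖x - w‖ ^ 2 ≤ (g x).toReal := by
    intro x hx
    have h := hle x
    rw [← EReal.coe_toReal hwt (hg.ne_bot _), ← EReal.coe_toReal hx (hg.ne_bot _)] at h
    have h' : 1 * (g w).toReal + ⟪-θ, w⟫_ℝ + (1 * 1 + 0) / 2 * ‖x - w‖ ^ 2 ≤
      1 * (g x).toReal + ⟪-θ, x⟫_ℝ := by exact_mod_cast h
    rw [inner_neg_left, inner_neg_left] at h'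
    rw [inner_sub_right]
    linarith
  refine ⟨w, hwt, le_antisymm (iSup_le fun x => ?_) ?_, key⟩
  · by_cases hx : g x = ⊤
    · simp [hx]
    have h := key x hx
    rw [← EReal.coe_toReal hx (hg.ne_bot _), ← EReal.coe_sub, EReal.coe_le_coe_iff]
    rw [inner_sub_right] at h
    nlinarith [sq_nonneg ‖x - w‖]
  · refine le_trans ?_ (le_iSup _ w)
    rw [EReal.coe_sub, EReal.coe_toReal hwt (hg.ne_bot _)]

theorem hasGradientAt_of_le_sq {G : Vec d → ℝ} {θ w : Vec d} {c : ℝ}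
    (h₁ : ∀ δ, G θ + ⟪w, δ⟫_ℝ ≤ G (θ + δ)) (h₂ : ∀ δ, G (θ + δ) ≤ G θ + ⟪w, δ⟫_ℝ + c * ‖δ‖ ^ 2) :
    HasGradientAt G w θ := by
  rw [hasGradientAt_iff_isLittleO_nhds_zero]
  have hO : (fun δ : Vec d => G (θ + δ) - G θ - ⟪w, δ⟫_ℝ) =O[nhds 0] fun δ => ‖δ‖ ^ 2 := by
    refine Asymptotics.IsBigO.of_bound c (Filter.Eventually.of_forall fun δ => ?_)
    rw [Real.norm_eq_abs, abs_of_nonneg (by linarith [h₁ δ]), norm_pow, norm_norm]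
    linarith [h₂ δ]
  exact hO.trans_isLittleO (Asymptotics.isLittleO_norm_pow_id one_lt_two)

/-- The gradient of the conjugate of a `1`-strongly convex function is the maximizer in the
definition of the conjugate, and the conjugate is `1`-smooth. -/
theorem IsClosedStronglyConvex.conj_gradient {g : Vec d → EReal} (hg : IsClosedStronglyConvex 1 g)
    (θ : Vec d) :
    g (gradient (fun θ => (conj g θ).toReal) θ) ≠ ⊤ ∧
    (∀ x, g x ≠ ⊤ → (g (gradient (fun θ => (conj g θ).toReal) θ)).toReal +
      ⟪θ, x - gradient (fun θ => (conj g θ).toReal) θ⟫_ℝ +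
      1 / 2 * ‖x - gradient (fun θ => (conj g θ).toReal) θ‖ ^ 2 ≤ (g x).toReal) ∧
    (conj g θ).toReal = ⟪θ, gradient (fun θ => (conj g θ).toReal) θ⟫_ℝ -
      (g (gradient (fun θ => (conj g θ).toReal) θ)).toReal ∧
    ∀ δ, (conj g (θ + δ)).toReal ≤ (conj g θ).toReal +
      ⟪gradient (fun θ => (conj g θ).toReal) θ, δ⟫_ℝ + 1 / 2 * ‖δ‖ ^ 2 := by
  obtain ⟨w, hw, hc, hmin⟩ := hg.conj_attained θ
  have hcr : (conj g θ).toReal = ⟪θ, w⟫_ℝ - (g w).toReal := by rw [hc, EReal.toReal_coe]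
  -- Strong convexity at the maximizer for θ is tested at the maximizer `w'` for θ + δ; Young's
  -- inequality handles ⟪w' - w, δ⟫.
  have hup : ∀ δ, (conj g (θ + δ)).toReal ≤ (conj g θ).toReal + ⟪w, δ⟫_ℝ + 1 / 2 * ‖δ‖ ^ 2 := by
    intro δ
    obtain ⟨w', hw', hc', -⟩ := hg.conj_attained (θ + δ)
    rw [hcr, hc', EReal.toReal_coe]
    have h := hmin w' hw'
    have h2 := sq_nonneg ‖(w' - w) - δ‖
    rw [norm_sub_sq_real] at h2
    simp only [inner_add_left, inner_sub_right, inner_sub_left] at h h2 ⊢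
    rw [real_inner_comm δ w', real_inner_comm δ w] at *
    linarith
  have hgrad : gradient (fun θ => (conj g θ).toReal) θ = w := by
    refine (hasGradientAt_of_le_sq (fun δ => ?_) hup).gradient
    obtain ⟨w', hw', hc', hmin'⟩ := hg.conj_attained (θ + δ)
    have h := hmin' w hw
    rw [hcr, hc', EReal.toReal_coe]
    have h2 := sq_nonneg ‖w - w'‖
    simp only [inner_add_left, inner_sub_right] at h ⊢
    rw [real_inner_comm δ w]
    linarith
  rw [hgrad]
  exact ⟨hw, hmin, hcr, hup⟩

theorem IsClosedStronglyConvex.conj_ne_top {g : Vec d → EReal} (hg : IsClosedStronglyConvex 1 g)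
    (θ : Vec d) : conj g θ ≠ ⊤ := by
  obtain ⟨w, -, hc, -⟩ := hg.conj_attained θ
  rw [hc]; exact EReal.coe_ne_top _

theorem IsClosedStronglyConvex.conj_ne_bot {g : Vec d → EReal} (hg : IsClosedStronglyConvex 1 g)
    (θ : Vec d) : conj g θ ≠ ⊥ := by
  obtain ⟨w, -, hc, -⟩ := hg.conj_attained θ
  rw [hc]; exact EReal.coe_ne_bot _

end StronglyConvex

/-! ### Dual norms and operator norms -/

section DualNorm

variable {d k : ℕ} {p : Seminorm ℝ (Vec k)}

theorem continuous_seminorm (p : Seminorm ℝ (Vec k)) : Continuous p :=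
  p.convexOn.locallyLipschitz.continuous

theorem exists_seminorm_le_norm (p : Seminorm ℝ (Vec k)) : ∃ C, 0 < C ∧ ∀ x, p x ≤ C * ‖x‖ :=
  p.bound_of_continuous_normedSpace (continuous_seminorm p)

/-- The seminorm attains a positive minimum on the Euclidean unit sphere, which is empty only in
dimension 0. This makes the suprema in `dualNorm` bounded, so that `sSup` does not take its default
value 0. -/
theorem exists_norm_le_seminorm (hp : ∀ x, p x = 0 → x = 0) :
    ∃ C, 0 < C ∧ ∀ x, ‖x‖ ≤ C * p x := by
  rcases (Metric.sphere (0 : Vec k) 1).eq_empty_or_nonempty with hS | hS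
  · refine ⟨1, one_pos, fun x => ?_⟩
    have hx : x = 0 := by
      by_contra hx
      have : ‖x‖⁻¹ • x ∈ Metric.sphere (0 : Vec k) 1 := by
        simp [norm_smul, inv_mul_cancel₀ (norm_ne_zero_iff.2 hx)]
      rw [hS] at this
      exact this
    simp [hx]
  · obtain ⟨x₀, hx₀, hmin⟩ := (isCompact_sphere (0 : Vec k) 1).exists_isMinOn hS
      (continuous_seminorm p).continuousOn
    rw [isMinOn_iff] at hmin
    have hpos : 0 < p x₀ := by
      refine lt_of_le_of_ne (apply_nonneg p x₀) fun h => ?_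
      have := hp x₀ h.symm
      simp [this] at hx₀
    refine ⟨(p x₀)⁻¹, by positivity, fun x => ?_⟩
    by_cases hx : x = 0
    · simp [hx]
    have hxn : 0 < ‖x‖ := norm_pos_iff.2 hx
    have h := hmin (‖x‖⁻¹ • x) (by simp [norm_smul, inv_mul_cancel₀ hxn.ne'])
    rw [map_smul_eq_mul, norm_inv, norm_norm] at h
    rw [inv_mul_eq_div, le_div_iff₀ hpos]
    rw [inv_mul_eq_div, le_div_iff₀ hxn] at h
    linarith

theorem dualNorm_bddAbove (hp : ∀ x, p x = 0 → x = 0) (y : Vec k) :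
    BddAbove {r : ℝ | ∃ x : Vec k, p x = 1 ∧ r = ⟪y, x⟫_ℝ} := by
  obtain ⟨C, hC, h⟩ := exists_norm_le_seminorm hp
  refine ⟨‖y‖ * C, ?_⟩
  rintro r ⟨x, hx, rfl⟩
  have := h x
  rw [hx, mul_one] at this
  exact (real_inner_le_norm y x).trans (by gcongr)

theorem inner_le_dualNorm_mul (hp : ∀ x, p x = 0 → x = 0) (y x : Vec k) :
    ⟪y, x⟫_ℝ ≤ dualNorm p y * p x := by
  rcases (apply_nonneg p x).eq_or_lt with h | h
  · rw [hp x h.symm]; simp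
  · have := le_csSup (dualNorm_bddAbove hp y) ⟨(p x)⁻¹ • x, by
      rw [map_smul_eq_mul, norm_inv, Real.norm_eq_abs, abs_of_pos h, inv_mul_cancel₀ h.ne'], rfl⟩
    rw [inner_smul_right, inv_mul_eq_div, div_le_iff₀ h] at this
    exact this

theorem dualNorm_nonneg (hp : ∀ x, p x = 0 → x = 0) (y : Vec k) : 0 ≤ dualNorm p y := by
  by_cases hy : y = 0
  · refine Real.sSup_nonneg ?_
    rintro r ⟨x, -, rfl⟩
    simp [hy]
  · have h := inner_le_dualNorm_mul hp y y
    rw [real_inner_self_eq_norm_sq] at h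
    by_contra hneg
    have : 0 < ‖y‖ ^ 2 := by have := norm_pos_iff.2 hy; positivity
    nlinarith [apply_nonneg p y]

theorem exists_norm_le_dualNorm (hp : ∀ x, p x = 0 → x = 0) :
    ∃ C, 0 < C ∧ ∀ y, ‖y‖ ≤ C * dualNorm p y := by
  obtain ⟨C, hC, h⟩ := exists_seminorm_le_norm p
  refine ⟨C, hC, fun y => ?_⟩
  by_cases hy : y = 0
  · simpa [hy] using mul_nonneg hC.le (dualNorm_nonneg hp 0)
  have hy0 : 0 < ‖y‖ := norm_pos_iff.2 hy
  have h1 := inner_le_dualNorm_mul hp y y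
  rw [real_inner_self_eq_norm_sq] at h1
  have h2 := mul_le_mul_of_nonneg_left (h y) (dualNorm_nonneg hp y)
  refine le_of_mul_le_mul_right ?_ hy0
  nlinarith

open scoped Pointwise in
theorem dualNorm_smul (p : Seminorm ℝ (Vec k)) {c : ℝ} (hc : 0 ≤ c) (y : Vec k) :
    dualNorm p (c • y) = c * dualNorm p y := by
  have : {r : ℝ | ∃ x : Vec k, p x = 1 ∧ r = ⟪c • y, x⟫_ℝ} =
      c • {r : ℝ | ∃ x : Vec k, p x = 1 ∧ r = ⟪y, x⟫_ℝ} := by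
    ext r
    simp only [Set.mem_ofPred_eq, Set.mem_smul_set, inner_smul_left]
    constructor
    · rintro ⟨x, hx, rfl⟩
      exact ⟨_, ⟨x, hx, rfl⟩, by simp⟩
    · rintro ⟨_, ⟨x, hx, rfl⟩, rfl⟩
      exact ⟨x, hx, by simp⟩
  rw [dualNorm, this, Real.sSup_smul_of_nonneg hc, smul_eq_mul, dualNorm]

theorem opNormD_nonneg (p : Seminorm ℝ (Vec k)) (X : Vec k →L[ℝ] Vec d) : 0 ≤ opNormD p X := by
  refine Real.sSup_nonneg ?_
  rintro r ⟨x, -, rfl⟩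
  exact norm_nonneg _

theorem norm_le_opNormD_mul (hp : ∀ x, p x = 0 → x = 0) (X : Vec k →L[ℝ] Vec d) (u : Vec k) :
    ‖X u‖ ≤ opNormD p X * dualNorm p u := by
  obtain ⟨C, hC, h⟩ := exists_norm_le_dualNorm hp
  have hbdd : BddAbove {r : ℝ | ∃ u : Vec k, dualNorm p u = 1 ∧ r = ‖X u‖} := by
    refine ⟨‖X‖ * C, ?_⟩
    rintro r ⟨x, hx, rfl⟩
    have h1 := h x
    rw [hx, mul_one] at h1
    exact (X.le_opNorm x).trans (by gcongr)
  rcases (dualNorm_nonneg hp u).eq_or_lt with h0 | h0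
  · have h1 := h u
    rw [← h0, mul_zero] at h1
    have : u = 0 := norm_le_zero_iff.1 h1
    rw [← h0]
    simp [this]
  · have := le_csSup hbdd ⟨(dualNorm p u)⁻¹ • u, by
      rw [dualNorm_smul p (by positivity), inv_mul_cancel₀ h0.ne'], rfl⟩
    rw [map_smul, norm_smul, norm_inv, Real.norm_eq_abs, abs_of_pos h0, inv_mul_eq_div,
      div_le_iff₀ h0] at this
    exact this

/-- (γ/2)‖·‖_D² is the conjugate of p²/(2γ): the bound comes from testing at the optimal multiple of
each p-unit vector. -/
theorem dualNorm_sq_le (hp : ∀ x, p x = 0 → x = 0) {γ M : ℝ} (hγ : 0 < γ) {y : Vec k}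
    (h : ∀ x, ⟪y, x⟫_ℝ - p x ^ 2 / (2 * γ) ≤ M) : γ / 2 * dualNorm p y ^ 2 ≤ M := by
  have hM : 0 ≤ M := by simpa using h 0
  have h1 : dualNorm p y ≤ √(2 * M / γ) := by
    refine Real.sSup_le ?_ (Real.sqrt_nonneg _)
    rintro r ⟨x, hx, rfl⟩
    refine Real.le_sqrt_of_sq_le ?_
    have h2 := h ((γ * ⟪y, x⟫_ℝ) • x)
    rw [inner_smul_right, map_smul_eq_mul, hx, mul_one, Real.norm_eq_abs, sq_abs] at h2
    rw [le_div_iff₀ hγ]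
    have h3 : (γ * ⟪y, x⟫_ℝ) ^ 2 / (2 * γ) = γ * ⟪y, x⟫_ℝ ^ 2 / 2 := by field_simp
    rw [h3] at h2
    linarith
  have h2 := pow_le_pow_left₀ (dualNorm_nonneg hp y) h1 2
  rw [Real.sq_sqrt (by positivity), le_div_iff₀ hγ] at h2
  linarith

end DualNorm

/-! ### Conjugates of smooth convex functions -/

section Smooth

variable {k : ℕ} {p : Seminorm ℝ (Vec k)} {φ : Vec k → ℝ}

theorem conj_coe_le_iff {a : Vec k} {r : ℝ} :
    conj (fun x => (φ x : EReal)) a ≤ r ↔ ∀ x, ⟪a, x⟫_ℝ - φ x ≤ r := by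
  simp only [conj, iSup_le_iff, ← EReal.coe_sub, EReal.coe_le_coe_iff]

theorem conj_coe_ne_bot (φ : Vec k → ℝ) (a : Vec k) : conj (fun x => (φ x : EReal)) a ≠ ⊥ := by
  refine ne_bot_of_le_ne_bot (EReal.coe_ne_bot (⟪a, 0⟫_ℝ - φ 0)) ?_
  rw [EReal.coe_sub]
  exact le_iSup (fun x : Vec k => ((⟪a, x⟫_ℝ : ℝ) : EReal) - (φ x : EReal)) 0

theorem inner_sub_le_conj {a : Vec k} (ha : conj (fun x => (φ x : EReal)) a ≠ ⊤) (x : Vec k) :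
    ⟪a, x⟫_ℝ - φ x ≤ (conj (fun x => (φ x : EReal)) a).toReal :=
  conj_coe_le_iff.1 (EReal.le_coe_toReal ha) x

theorem hasDerivAt_line (hφ : Differentiable ℝ φ) (x h : Vec k) (t : ℝ) :
    HasDerivAt (fun t : ℝ => φ (x + t • h)) ⟪gradient φ (x + t • h), h⟫_ℝ t := by
  have h1 : HasDerivAt (fun t : ℝ => x + t • h) h t := by
    simpa using ((hasDerivAt_id t).smul_const h).const_add x
  have h2 := (hφ (x + t • h)).hasGradientAt.hasFDerivAt.comp_hasDerivAt t h1
  simpa [Function.comp_def] using h2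

theorem add_inner_gradient_le (hc : ConvexOn ℝ Set.univ φ) (hφ : Differentiable ℝ φ)
    (a x : Vec k) : φ a + ⟪gradient φ a, x - a⟫_ℝ ≤ φ x := by
  have hconv : ConvexOn ℝ Set.univ fun t : ℝ => φ (a + t • (x - a)) := by
    have := hc.comp_affineMap (AffineMap.lineMap a x : ℝ →ᵃ[ℝ] Vec k)
    have he : (φ ∘ (AffineMap.lineMap a x : ℝ →ᵃ[ℝ] Vec k)) = fun t : ℝ => φ (a + t • (x - a)) := by
      ext t
      simp [AffineMap.lineMap_apply, add_comm]
    rwa [he] at this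
  have hd := hasDerivAt_line hφ a (x - a) 0
  have := hconv.le_slope_of_hasDerivAt (Set.mem_univ 0) (Set.mem_univ 1) zero_lt_one hd
  simp only [slope_def_field, zero_smul, add_zero, one_smul, add_sub_cancel, sub_zero, div_one]
    at this
  linarith

/-- Descent lemma: along the segment the derivative of φ exceeds its initial value by at most t ·
p(h)²/γ, so `ψ` decreases. -/
theorem IsSmooth.le_add (hp : ∀ x, p x = 0 → x = 0) {γ : ℝ} (hφ : IsSmooth p γ φ)
    (x h : Vec k) : φ (x + h) ≤ φ x + ⟪gradient φ x, h⟫_ℝ + p h ^ 2 / (2 * γ) := by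
  set ψ : ℝ → ℝ := fun t => φ (x + t • h) - t * ⟪gradient φ x, h⟫_ℝ - t ^ 2 * (p h ^ 2 / (2 * γ))
    with hψ
  have hd : ∀ t, HasDerivAt ψ (⟪gradient φ (x + t • h), h⟫_ℝ - ⟪gradient φ x, h⟫_ℝ
      - 2 * t * (p h ^ 2 / (2 * γ))) t := by
    intro t
    have h1 := (hasDerivAt_line hφ.1 x h t).sub ((hasDerivAt_id t).mul_const ⟪gradient φ x, h⟫_ℝ)
    have h2 := h1.sub ((hasDerivAt_pow 2 t).mul_const (p h ^ 2 / (2 * γ)))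
    exact HasDerivAt.congr_deriv (f := ψ) h2 (by simp)
  have hanti : AntitoneOn ψ (Set.Icc 0 1) := by
    refine antitoneOn_of_deriv_nonpos (convex_Icc 0 1)
      (fun t _ => (hd t).continuousAt.continuousWithinAt)
      (fun t _ => (hd t).differentiableAt.differentiableWithinAt) fun t ht => ?_
    rw [interior_Icc] at ht
    rw [(hd t).deriv]
    have h1 := inner_le_dualNorm_mul hp (gradient φ (x + t • h) - gradient φ x) h
    have h2 := hφ.2 (x + t • h) x
    rw [add_sub_cancel_left, map_smul_eq_mul, Real.norm_eq_abs, abs_of_pos ht.1] at h2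
    have h3 := mul_le_mul_of_nonneg_right h2 (apply_nonneg p h)
    rw [inner_sub_left] at h1
    have h4 : 1 / γ * (t * p h) * p h = 2 * t * (p h ^ 2 / (2 * γ)) := by
      by_cases hγ : γ = 0
      · simp [hγ]
      · field_simp
    linarith
  have := hanti (Set.left_mem_Icc.2 zero_le_one) (Set.right_mem_Icc.2 zero_le_one) zero_le_one
  simp only [hψ, one_smul, zero_smul, add_zero] at this
  linarith

theorem conj_gradient_eq (hc : ConvexOn ℝ Set.univ φ) (hφ : Differentiable ℝ φ) (a : Vec k) :
    conj (fun x => (φ x : EReal)) (gradient φ a) = ((⟪gradient φ a, a⟫_ℝ - φ a : ℝ) : EReal) := by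
  refine le_antisymm (conj_coe_le_iff.2 fun x => ?_) ?_
  · have := add_inner_gradient_le hc hφ a x
    rw [inner_sub_right] at this
    linarith
  · rw [EReal.coe_sub]
    exact le_iSup (fun x : Vec k => ((⟪gradient φ a, x⟫_ℝ : ℝ) : EReal) - (φ x : EReal)) a

/-- The conjugate of a `(1/γ)`-smooth function is `γ`-strongly convex with respect to the dual
norm. -/
theorem IsSmooth.conj_strong (hp : ∀ x, p x = 0 → x = 0) {γ : ℝ} (hγ : 0 < γ)
    (hφ : IsSmooth p γ φ) {a b : Vec k} {A B s : ℝ} (hs : s ∈ Set.Icc (0 : ℝ) 1)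
    (ha : conj (fun x => (φ x : EReal)) a ≤ A) (hb : conj (fun x => (φ x : EReal)) b ≤ B) :
    conj (fun x => (φ x : EReal)) (s • a + (1 - s) • b) ≤
      ((s * A + (1 - s) * B - γ / 2 * (s * (1 - s)) * dualNorm p (a - b) ^ 2 : ℝ) : EReal) := by
  rw [conj_coe_le_iff] at *
  intro x
  have hs1 : 0 ≤ 1 - s := by linarith [hs.2]
  have main : ∀ h, s * (1 - s) * (⟪a - b, h⟫_ℝ - p h ^ 2 / (2 * γ)) ≤
      s * A + (1 - s) * B - (⟪s • a + (1 - s) • b, x⟫_ℝ - φ x) := by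
    intro h
    -- The two test points have weighted mean `x`, so the gradient terms cancel and the quadratic
    -- terms add up to s(1 - s) p(h)²/(2γ). Optimizing over `h` produces the dual norm.
    have h1 := ha (x + (1 - s) • h)
    have h2 := hb (x + (-s) • h)
    have h3 := hφ.le_add hp x ((1 - s) • h)
    have h4 := hφ.le_add hp x ((-s) • h)
    rw [map_smul_eq_mul, Real.norm_eq_abs, mul_pow, sq_abs, inner_smul_right] at h3 h4
    simp only [inner_add_left, inner_add_right, inner_smul_left, inner_smul_right, inner_sub_left,
      conj_trivial] at *
    have h5 := mul_le_mul_of_nonneg_left h1 hs.1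
    have h6 := mul_le_mul_of_nonneg_left h2 hs1
    have h7 := mul_le_mul_of_nonneg_left h3 hs.1
    have h8 := mul_le_mul_of_nonneg_left h4 hs1
    have h9 : s * ((1 - s) ^ 2 * p h ^ 2 / (2 * γ)) + (1 - s) * ((-s) ^ 2 * p h ^ 2 / (2 * γ)) =
      s * (1 - s) * (p h ^ 2 / (2 * γ)) := by ring
    nlinarith
  rcases (mul_nonneg hs.1 hs1).eq_or_lt with h0 | h0
  · have := main 0
    rw [← h0] at this ⊢
    linarith
  · have := dualNorm_sq_le hp hγ (y := a - b)
      (M := (s * A + (1 - s) * B - (⟪s • a + (1 - s) • b, x⟫_ℝ - φ x)) / (s * (1 - s))) fun h => by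
        rw [le_div_iff₀ h0]
        linarith [main h]
    rw [le_div_iff₀ h0] at this
    linarith

/-- Jensen's inequality for the conjugate. -/
theorem conj_sum_le {ι : Type*} (S : Finset ι) (c : ι → ℝ) (hc : ∀ j ∈ S, 0 ≤ c j)
    (hc1 : ∑ j ∈ S, c j = 1) (a : ι → Vec k) (r : ι → ℝ)
    (h : ∀ j ∈ S, conj (fun x => (φ x : EReal)) (a j) ≤ r j) :
    conj (fun x => (φ x : EReal)) (∑ j ∈ S, c j • a j) ≤ ((∑ j ∈ S, c j * r j : ℝ) : EReal) := by
  rw [conj_coe_le_iff]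
  intro x
  have h1 : ⟪∑ j ∈ S, c j • a j, x⟫_ℝ - φ x = ∑ j ∈ S, c j * (⟪a j, x⟫_ℝ - φ x) := by
    simp only [sum_inner, inner_smul_left, conj_trivial, mul_sub, Finset.sum_sub_distrib,
      ← Finset.sum_mul, hc1, one_mul]
  rw [h1]
  exact Finset.sum_le_sum fun j hj =>
    mul_le_mul_of_nonneg_left (conj_coe_le_iff.1 (h j hj) x) (hc j hj)

end Smooth

namespace Problem

/-! ### Finite values of the primal and the dual objective -/

section Values

variable {d k n : ℕ} (Q : Problem d k n)

/-- The assumptions on a problem that do not involve its condition number. -/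
structure Regular : Prop where
  lam_pos : 0 < Q.lam
  gam_pos : 0 < Q.gam
  norm_def : ∀ x, Q.normP x = 0 → x = 0
  φ_convex : ∀ i, ConvexOn ℝ Set.univ (Q.φ i)
  φ_smooth : ∀ i, IsSmooth Q.normP Q.gam (Q.φ i)
  g_strong : IsClosedStronglyConvex 1 Q.g
  X_bound : ∀ i, opNormD Q.normP (Q.X i) ≤ Q.R

/-- `φ_i*(-α_i)` is finite for all `i`. -/
def Feasible (α : Fin n → Vec k) : Prop := ∀ i, Q.φConj i (-α i) ≠ ⊤

/-- The primal objective as a real number. -/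
noncomputable def primalR (w : Vec d) : ℝ :=
  (1 / (n : ℝ)) * ∑ i, Q.φ i ((Q.X i).adjoint w) + Q.lam * (Q.g w).toReal

/-- The dual objective as a real number. -/
noncomputable def dualR (α : Fin n → Vec k) : ℝ :=
  (1 / (n : ℝ)) * ∑ i, -(Q.φConj i (-α i)).toReal - Q.lam * (conj Q.g (Q.v α)).toReal

/-- The duality gap as a real number. -/
noncomputable def gapR (w : Vec d) (α : Fin n → Vec k) : ℝ := Q.primalR w - Q.dualR α

/-- The contribution of the `i`-th loss to the duality gap. -/
noncomputable def lossGap (w : Vec d) (α : Fin n → Vec k) (i : Fin n) : ℝ :=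
  Q.φ i ((Q.X i).adjoint w) + (Q.φConj i (-α i)).toReal + ⟪w, Q.X i (α i)⟫_ℝ

variable {Q}

theorem φConj_ne_bot (i : Fin n) (a : Vec k) : Q.φConj i a ≠ ⊥ := conj_coe_ne_bot _ _

theorem Regular.primal_eq (hQ : Q.Regular) {w : Vec d} (hw : Q.g w ≠ ⊤) :
    Q.primal w = Q.primalR w := by
  rw [primal, primalR, EReal.coe_add, EReal.coe_mul Q.lam,
    EReal.coe_toReal hw (hQ.g_strong.ne_bot w)]

theorem Regular.primal_eq_top (hQ : Q.Regular) {w : Vec d} (hw : Q.g w = ⊤) :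
    Q.primal w = ⊤ := by
  rw [primal, hw, EReal.coe_mul_top_of_pos hQ.lam_pos, EReal.coe_add_top]

theorem Regular.primal_ne_top_iff (hQ : Q.Regular) {w : Vec d} : Q.primal w ≠ ⊤ ↔ Q.g w ≠ ⊤ :=
  ⟨fun h hw => h (hQ.primal_eq_top hw), fun h => by rw [hQ.primal_eq h]; exact EReal.coe_ne_top _⟩

theorem Regular.primal_ne_bot (hQ : Q.Regular) (w : Vec d) : Q.primal w ≠ ⊥ := by
  by_cases hw : Q.g w = ⊤
  · rw [hQ.primal_eq_top hw]; exact top_ne_bot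
  · rw [hQ.primal_eq hw]; exact EReal.coe_ne_bot _

theorem coe_finset_sum {ι : Type*} (s : Finset ι) (f : ι → ℝ) :
    ((∑ i ∈ s, f i : ℝ) : EReal) = ∑ i ∈ s, (f i : EReal) := by
  classical
  induction s using Finset.induction_on with
  | empty => simp
  | insert a s ha ih => rw [Finset.sum_insert ha, Finset.sum_insert ha, EReal.coe_add, ih]

theorem Regular.dual_eq (hQ : Q.Regular) {α : Fin n → Vec k} (hα : Q.Feasible α) :
    Q.dual α = Q.dualR α := by
  rw [dual, dualR, EReal.coe_sub, EReal.coe_mul, EReal.coe_mul Q.lam, coe_finset_sum,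
    EReal.coe_toReal (hQ.g_strong.conj_ne_top _) (hQ.g_strong.conj_ne_bot _)]
  congr 3 with i
  rw [EReal.coe_neg, EReal.coe_toReal (hα i) (φConj_ne_bot i _)]

theorem dual_eq_bot [NeZero n] {α : Fin n → Vec k} (hα : ¬ Q.Feasible α) : Q.dual α = ⊥ := by
  obtain ⟨i, hi⟩ := not_forall.1 hα
  have hn : (0 : ℝ) < 1 / n := by
    have := NeZero.pos n
    positivity
  rw [dual, ← Finset.add_sum_erase _ _ (Finset.mem_univ i), not_not.1 hi, EReal.neg_top,
    EReal.bot_add, EReal.coe_mul_bot_of_pos hn, EReal.bot_sub]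

theorem Regular.dual_ne_bot_iff [NeZero n] (hQ : Q.Regular) {α : Fin n → Vec k} :
    Q.dual α ≠ ⊥ ↔ Q.Feasible α :=
  ⟨fun h => by_contra fun hα => h (dual_eq_bot hα),
    fun h => by rw [hQ.dual_eq h]; exact EReal.coe_ne_bot _⟩

theorem Regular.gap_eq (hQ : Q.Regular) {w : Vec d} {α : Fin n → Vec k} (hw : Q.g w ≠ ⊤)
    (hα : Q.Feasible α) : Q.gap (w, α) = Q.gapR w α := by
  rw [gap, hQ.primal_eq hw, hQ.dual_eq hα, gapR, EReal.coe_sub]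

theorem Regular.of_gap_ne_top [NeZero n] (hQ : Q.Regular) {w : Vec d} {α : Fin n → Vec k}
    (h : Q.gap (w, α) ≠ ⊤) : Q.g w ≠ ⊤ ∧ Q.Feasible α := by
  have hα : Q.Feasible α := by
    by_contra hα
    refine h ?_
    rw [gap, dual_eq_bot hα, EReal.sub_bot (hQ.primal_ne_bot w)]
  refine ⟨fun hw => h ?_, hα⟩
  rw [gap, hQ.primal_eq_top hw, hQ.dual_eq hα, EReal.top_sub_coe]

theorem lam_mul_inner_v [NeZero n] (hQ : Q.Regular) (w : Vec d) (α : Fin n → Vec k) :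
    Q.lam * ⟪w, Q.v α⟫_ℝ = (1 / (n : ℝ)) * ∑ i, ⟪w, Q.X i (α i)⟫_ℝ := by
  have hn : (n : ℝ) ≠ 0 := by exact_mod_cast NeZero.ne n
  have := hQ.lam_pos.ne'
  rw [v, inner_smul_right, inner_sum]
  field_simp

/-- λ⟪w, v(α)⟫ is the mean of the ⟪w, X_i α_i⟫, so cross terms can be inserted that split the gap
into Fenchel–Young gaps, one for each loss and one for g. -/
theorem Regular.gapR_eq [NeZero n] (hQ : Q.Regular) (w : Vec d) (α : Fin n → Vec k) :
    Q.gapR w α = (1 / (n : ℝ)) * ∑ i, Q.lossGap w α i +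
      Q.lam * ((Q.g w).toReal + (conj Q.g (Q.v α)).toReal - ⟪w, Q.v α⟫_ℝ) := by
  have h := lam_mul_inner_v hQ w α
  simp only [gapR, primalR, dualR, lossGap, Finset.sum_add_distrib, Finset.sum_neg_distrib]
  linarith

theorem Feasible.lossGap_nonneg {α : Fin n → Vec k} (hα : Q.Feasible α) (w : Vec d) (i : Fin n) :
    0 ≤ Q.lossGap w α i := by
  have := inner_sub_le_conj (hα i) ((Q.X i).adjoint w)
  rw [inner_neg_left, real_inner_comm, ContinuousLinearMap.adjoint_inner_left] at this
  rw [lossGap, φConj]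
  linarith

theorem Regular.g_wOf_ne_top (hQ : Q.Regular) (α : Fin n → Vec k) : Q.g (Q.wOf α) ≠ ⊤ :=
  (hQ.g_strong.conj_gradient (Q.v α)).1

/-- Fenchel–Young is an equality for g at ∇g*(v(α)). -/
theorem Regular.gapR_wOf [NeZero n] (hQ : Q.Regular) (α : Fin n → Vec k) :
    Q.gapR (Q.wOf α) α = (1 / (n : ℝ)) * ∑ i, Q.lossGap (Q.wOf α) α i := by
  have h := (hQ.g_strong.conj_gradient (Q.v α)).2.2.1
  rw [hQ.gapR_eq, wOf, h, real_inner_comm]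
  ring

/-- The loss gaps are nonnegative, and the Fenchel–Young gap of g grows quadratically around its
maximizer w(α). This is needed when the center of the regularizer moves. -/
theorem Regular.le_gapR [NeZero n] (hQ : Q.Regular) {w : Vec d} (hw : Q.g w ≠ ⊤)
    {α : Fin n → Vec k} (hα : Q.Feasible α) :
    Q.lam / 2 * ‖w - Q.wOf α‖ ^ 2 ≤ Q.gapR w α := by
  obtain ⟨-, h1, h2, -⟩ := hQ.g_strong.conj_gradient (Q.v α)
  have h3 := h1 w hw
  rw [hQ.gapR_eq, h2]
  rw [inner_sub_right, real_inner_comm] at h3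
  have h4 : 0 ≤ (1 / (n : ℝ)) * ∑ i, Q.lossGap w α i :=
    mul_nonneg (by positivity) (Finset.sum_nonneg fun i _ => hα.lossGap_nonneg w i)
  have h5 := mul_le_mul_of_nonneg_left h3 hQ.lam_pos.le
  rw [← wOf] at *
  linarith

theorem Regular.gapR_nonneg [NeZero n] (hQ : Q.Regular) {w : Vec d} (hw : Q.g w ≠ ⊤)
    {α : Fin n → Vec k} (hα : Q.Feasible α) : 0 ≤ Q.gapR w α :=
  le_trans (by have := hQ.lam_pos; positivity) (hQ.le_gapR hw hα)

end Values

/-! ### Increase of the dual objective -/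

section DualIncrease

variable {d k n : ℕ} {Q : Problem d k n}

/-- The step size of Option V. -/
noncomputable def stepV (Q : Problem d k n) : ℝ :=
  Q.lam * n * Q.gam / (Q.R ^ 2 + Q.lam * n * Q.gam)

theorem Regular.stepV_mem [NeZero n] (hQ : Q.Regular) : Q.stepV ∈ Set.Icc (0 : ℝ) 1 := by
  have hn : (0 : ℝ) < n := by exact_mod_cast NeZero.pos n
  have := hQ.lam_pos
  have := hQ.gam_pos
  refine ⟨by unfold stepV; positivity, ?_⟩
  unfold stepV
  rw [div_le_one (by positivity)]
  nlinarith [sq_nonneg Q.R]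

/-- At the step of Option V the gain from strong convexity of φ_i* balances the loss from smoothness
of g*: the quadratic term of `Regular.le_proxObj` vanishes for B = R². -/
theorem Regular.gam_mul_one_sub_stepV [NeZero n] (hQ : Q.Regular) :
    Q.gam * (1 - Q.stepV) = Q.stepV * (1 / (Q.lam * n) * Q.R ^ 2) := by
  have hn : (0 : ℝ) < n := by exact_mod_cast NeZero.pos n
  have := hQ.lam_pos
  have := hQ.gam_pos
  have : Q.R ^ 2 + Q.lam * n * Q.gam ≠ 0 := by positivity
  unfold stepV
  field_simp
  ring

theorem proxObj_eq {α : Fin n → Vec k} {i : Fin n} {Δ : Vec k}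
    (h : Q.φConj i (-(α i + Δ)) ≠ ⊤) : Q.proxObj α i Δ =
      ((-(Q.φConj i (-(α i + Δ))).toReal -
        (⟪Q.wOf α, Q.X i Δ⟫_ℝ + (1 / (2 * Q.lam * n)) * ‖Q.X i Δ‖ ^ 2) : ℝ) : EReal) := by
  rw [proxObj, EReal.coe_sub, EReal.coe_neg, EReal.coe_toReal h (φConj_ne_bot i _)]

theorem φConj_ne_top_of_le_proxObj {α : Fin n → Vec k} {i : Fin n} {Δ : Vec k} {r : ℝ}
    (h : (r : EReal) ≤ Q.proxObj α i Δ) : Q.φConj i (-(α i + Δ)) ≠ ⊤ := by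
  intro ht
  rw [proxObj, ht, EReal.neg_top, EReal.bot_sub] at h
  exact EReal.coe_ne_bot r (le_bot_iff.1 h)

theorem Feasible.bump {α : Fin n → Vec k} (hα : Q.Feasible α) {i : Fin n} {Δ : Vec k}
    (h : Q.φConj i (-(α i + Δ)) ≠ ⊤) : Q.Feasible (bump α i Δ) := by
  intro j
  by_cases hj : j = i
  · subst hj; simpa [Problem.bump] using h
  · simpa [Problem.bump, hj] using hα j

theorem v_bump (α : Fin n → Vec k) (i : Fin n) (Δ : Vec k) :
    Q.v (bump α i Δ) = Q.v α + (1 / (Q.lam * n)) • Q.X i Δ := by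
  have : ∑ j, Q.X j (bump α i Δ j) = ∑ j, Q.X j (α j) + Q.X i Δ := by
    rw [← Finset.add_sum_erase _ _ (Finset.mem_univ i),
      ← Finset.add_sum_erase _ (fun j => Q.X j (α j)) (Finset.mem_univ i)]
    have : ∑ j ∈ Finset.univ.erase i, Q.X j (bump α i Δ j) =
        ∑ j ∈ Finset.univ.erase i, Q.X j (α j) :=
      Finset.sum_congr rfl fun j hj => by simp [bump, Finset.ne_of_mem_erase hj]
    rw [this]
    simp only [bump, Function.update_self, map_add]
    abel
  rw [v, this, smul_add, v]

/-- The proximal objective of Option I is a lower bound on the increase of the dual objective. -/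
theorem Regular.dualR_bump [NeZero n] (hQ : Q.Regular) {α : Fin n → Vec k} {i : Fin n} {Δ : Vec k}
    {r : ℝ} (h : ((-(Q.φConj i (-α i)).toReal + r : ℝ) : EReal) ≤ Q.proxObj α i Δ) :
    Q.dualR α + r / n ≤ Q.dualR (bump α i Δ) := by
  have hn : (0 : ℝ) < n := by exact_mod_cast NeZero.pos n
  have hl := hQ.lam_pos
  rw [proxObj_eq (φConj_ne_top_of_le_proxObj h), EReal.coe_le_coe_iff] at h
  have hsm := (hQ.g_strong.conj_gradient (Q.v α)).2.2.2 ((1 / (Q.lam * n)) • Q.X i Δ)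
  rw [← v_bump, inner_smul_right, norm_smul, mul_pow, Real.norm_eq_abs, sq_abs, ← wOf] at hsm
  have hsum : ∑ j, -(Q.φConj j (-bump α i Δ j)).toReal = ∑ j, -(Q.φConj j (-α j)).toReal +
      ((Q.φConj i (-α i)).toReal - (Q.φConj i (-(α i + Δ))).toReal) := by
    rw [← Finset.add_sum_erase _ _ (Finset.mem_univ i),
      ← Finset.add_sum_erase _ (fun j => -(Q.φConj j (-α j)).toReal) (Finset.mem_univ i)]
    have : ∑ j ∈ Finset.univ.erase i, -(Q.φConj j (-bump α i Δ j)).toReal =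
        ∑ j ∈ Finset.univ.erase i, -(Q.φConj j (-α j)).toReal :=
      Finset.sum_congr rfl fun j hj => by simp [bump, Finset.ne_of_mem_erase hj]
    rw [this]
    simp only [bump, Function.update_self]
    ring
  rw [dualR, dualR, hsum]
  have h1 := mul_le_mul_of_nonneg_left hsm hl.le
  have h2 := mul_le_mul_of_nonneg_left h (one_div_nonneg.2 hn.le)
  have e1 : Q.lam * ((conj Q.g (Q.v α)).toReal + 1 / (Q.lam * n) * ⟪Q.wOf α, Q.X i Δ⟫_ℝ +
      1 / 2 * ((1 / (Q.lam * n)) ^ 2 * ‖Q.X i Δ‖ ^ 2)) = Q.lam * (conj Q.g (Q.v α)).toReal +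
      1 / n * (⟪Q.wOf α, Q.X i Δ⟫_ℝ + (1 / (2 * Q.lam * n)) * ‖Q.X i Δ‖ ^ 2) := by
    field_simp
    ring
  rw [e1] at h1
  have e2 : r / n = 1 / (n : ℝ) * r := by ring
  rw [e2]
  linarith

/-- Lower bound on the proximal objective along the direction of Options II to V. -/
theorem Regular.le_proxObj [NeZero n] (hQ : Q.Regular) {α : Fin n → Vec k} (hα : Q.Feasible α)
    (i : Fin n) {s B : ℝ} (hs : s ∈ Set.Icc (0 : ℝ) 1)
    (hB : opNormD Q.normP (Q.X i) ^ 2 ≤ B) :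
    ((-(Q.φConj i (-α i)).toReal + (s * Q.lossGap (Q.wOf α) α i +
      s / 2 * dualNorm Q.normP (Q.qDir α i) ^ 2 *
        (Q.gam * (1 - s) - s * (1 / (Q.lam * n) * B))) : ℝ) : EReal) ≤
      Q.proxObj α i (s • Q.qDir α i) := by
  have hn : (0 : ℝ) < n := by exact_mod_cast NeZero.pos n
  have hl := hQ.lam_pos
  set w := Q.wOf α with hw
  set a := (Q.X i).adjoint w with ha
  set q := Q.qDir α i with hq
  have hqd : q = -gradient (Q.φ i) a - α i := rfl
  have hgrad := conj_gradient_eq (hQ.φ_convex i) (hQ.φ_smooth i).1 a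
  -- The negated new column interpolates between ∇φ_i, where Fenchel–Young is tight, and the present
  -- -α_i.
  have hstrong := (hQ.φ_smooth i).conj_strong hQ.norm_def hQ.gam_pos hs hgrad.le
    (EReal.le_coe_toReal (hα i))
  have hpt : s • gradient (Q.φ i) a + (1 - s) • -α i = -(α i + s • q) := by
    rw [hqd]; module
  have hdiff : gradient (Q.φ i) a - -α i = -q := by rw [hqd]; module
  have hneg : dualNorm Q.normP (-q) = dualNorm Q.normP q := by
    rw [dualNorm, dualNorm]
    congr 1
    ext r
    constructor <;> rintro ⟨x, hx, rfl⟩ <;>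
      exact ⟨-x, by rwa [map_neg_eq_map], by simp⟩
  rw [hpt, hdiff, hneg] at hstrong
  have hfin : Q.φConj i (-(α i + s • q)) ≠ ⊤ := ne_top_of_le_ne_top (EReal.coe_ne_top _) hstrong
  have hX := norm_le_opNormD_mul hQ.norm_def (Q.X i) q
  have hX2 : ‖Q.X i q‖ ^ 2 ≤ B * dualNorm Q.normP q ^ 2 := by
    calc ‖Q.X i q‖ ^ 2 ≤ (opNormD Q.normP (Q.X i) * dualNorm Q.normP q) ^ 2 := by gcongr
      _ = opNormD Q.normP (Q.X i) ^ 2 * dualNorm Q.normP q ^ 2 := mul_pow _ _ _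
      _ ≤ _ := by gcongr
  rw [proxObj_eq hfin, EReal.coe_le_coe_iff]
  have hc := EReal.toReal_le_toReal hstrong (φConj_ne_bot i _) (EReal.coe_ne_top _)
  rw [EReal.toReal_coe] at hc
  change (Q.φConj i (-(α i + s • q))).toReal ≤ _ at hc
  rw [map_smul, inner_smul_right, norm_smul, mul_pow, Real.norm_eq_abs, sq_abs, ← hw, lossGap,
    ← ha]
  have hin : ⟪w, Q.X i q⟫_ℝ = -⟪gradient (Q.φ i) a, a⟫_ℝ - ⟪w, Q.X i (α i)⟫_ℝ := by
    have hadj : ∀ u, ⟪w, Q.X i u⟫_ℝ = ⟪a, u⟫_ℝ := fun u =>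
      ((Q.X i).adjoint_inner_left u w).symm
    rw [hadj, hadj, hqd, inner_sub_right, inner_neg_right, real_inner_comm a]
  rw [hin]
  have h3 : 1 / (2 * Q.lam * n) * (s ^ 2 * ‖Q.X i q‖ ^ 2) ≤
      1 / (2 * Q.lam * n) * (s ^ 2 * (B * dualNorm Q.normP q ^ 2)) := by gcongr
  have e3 : 1 / (2 * Q.lam * n) * (s ^ 2 * (B * dualNorm Q.normP q ^ 2)) =
      s / 2 * dualNorm Q.normP q ^ 2 * (s * (1 / (Q.lam * n) * B)) := by field_simp
  rw [e3] at h3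
  have hdef : (conj (fun x => (Q.φ i x : EReal)) (-α i)).toReal = (Q.φConj i (-α i)).toReal := rfl
  rw [hdef] at hc
  linarith

theorem Regular.le_proxObj_stepV [NeZero n] (hQ : Q.Regular) {α : Fin n → Vec k}
    (hα : Q.Feasible α) (i : Fin n) :
    ((-(Q.φConj i (-α i)).toReal + Q.stepV * Q.lossGap (Q.wOf α) α i : ℝ) : EReal) ≤
      Q.proxObj α i (Q.stepV • Q.qDir α i) := by
  have h := hQ.le_proxObj hα i hQ.stepV_mem
    (pow_le_pow_left₀ (opNormD_nonneg Q.normP _) (hQ.X_bound i) 2)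
  rwa [hQ.gam_mul_one_sub_stepV, sub_self, mul_zero, add_zero] at h

/-- A concave quadratic on s ≤ 1 is maximal at its vertex, truncated at 1. -/
theorem quadratic_le_of_min {A c G s : ℝ} (hA : 0 < A) (hc : 0 < c) (hs1 : s ≤ 1) :
    s * G - s ^ 2 / 2 * (A * c) ≤
      min 1 (G / (A * c)) * G - min 1 (G / (A * c)) ^ 2 / 2 * (A * c) := by
  have hAc : 0 < A * c := by positivity
  have hG : G = G / (A * c) * (A * c) := by field_simp
  set t := G / (A * c)
  rw [hG]
  have key : s * t - s ^ 2 / 2 ≤ min 1 t * t - min 1 t ^ 2 / 2 := by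
    rcases le_total t 1 with h | h
    · rw [min_eq_right h]; nlinarith [sq_nonneg (t - s)]
    · rw [min_eq_left h]; nlinarith
  nlinarith [mul_le_mul_of_nonneg_right key hAc.le]

/-- The step of Options III and IV maximizes over [0, 1] the very lower bound of
`Regular.le_proxObj`, in which Option V is one competitor. -/
theorem Regular.le_proxObj_stepIII [NeZero n] (hQ : Q.Regular) {α : Fin n → Vec k}
    (hα : Q.Feasible α) (i : Fin n) {B : ℝ} (hB : opNormD Q.normP (Q.X i) ^ 2 ≤ B)
    (hBR : B ≤ Q.R ^ 2) :
    ((-(Q.φConj i (-α i)).toReal + Q.stepV * Q.lossGap (Q.wOf α) α i : ℝ) : EReal) ≤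
      Q.proxObj α i (Q.stepIII B α i • Q.qDir α i) := by
  have hn : (0 : ℝ) < n := by exact_mod_cast NeZero.pos n
  have hl := hQ.lam_pos
  have hγ := hQ.gam_pos
  have hB0 : 0 ≤ B := (sq_nonneg _).trans hB
  have hG := hα.lossGap_nonneg (Q.wOf α) i
  rcases (dualNorm_nonneg hQ.norm_def (Q.qDir α i)).eq_or_lt with h0 | h0
  -- If q = 0, the formula for the step divides by zero, but all multiples of q are the same update.
  · obtain ⟨C, hC, h⟩ := exists_norm_le_dualNorm hQ.norm_def
    have hq : Q.qDir α i = 0 := by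
      have := h (Q.qDir α i)
      rw [← h0, mul_zero] at this
      exact norm_le_zero_iff.1 this
    have := hQ.le_proxObj_stepV hα i
    rw [hq, smul_zero] at this ⊢
    exact this
  · set A := dualNorm Q.normP (Q.qDir α i) ^ 2 with hA
    have hA0 : 0 < A := by positivity
    have hc : 0 < Q.gam + 1 / (Q.lam * n) * B := by positivity
    set G := Q.lossGap (Q.wOf α) α i with hGdef
    have hstep : Q.stepIII B α i =
        min 1 ((G + Q.gam / 2 * A) / (A * (Q.gam + 1 / (Q.lam * n) * B))) := rfl
    have hmem : Q.stepIII B α i ∈ Set.Icc (0 : ℝ) 1 := by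
      rw [hstep]
      exact ⟨le_min zero_le_one (by positivity), min_le_left _ _⟩
    refine le_trans (EReal.coe_le_coe_iff.2 ?_) (hQ.le_proxObj hα i hmem hB)
    rw [← hA, ← hGdef]
    have hq := quadratic_le_of_min (A := A) (c := Q.gam + 1 / (Q.lam * n) * B)
      (G := G + Q.gam / 2 * A) hA0 hc hQ.stepV_mem.2
    rw [← hstep] at hq
    have hV := hQ.gam_mul_one_sub_stepV
    have hBR' : Q.stepV * (1 / (Q.lam * n) * B) ≤ Q.stepV * (1 / (Q.lam * n) * Q.R ^ 2) := by
      have := hQ.stepV_mem.1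
      gcongr
    have h5 : 0 ≤ Q.stepV / 2 * A *
        (Q.gam * (1 - Q.stepV) - Q.stepV * (1 / (Q.lam * n) * B)) :=
      mul_nonneg (mul_nonneg (by linarith [hQ.stepV_mem.1]) hA0.le) (by linarith)
    linarith

/-- Every admissible update increases the dual objective at least as much as is guaranteed for
Option V. -/
theorem Regular.dual_increase [NeZero n] (hQ : Q.Regular) {α : Fin n → Vec k} (hα : Q.Feasible α)
    {i : Fin n} {Δ : Vec k} (hΔ : Q.IsUpdate α i Δ) :
    Q.Feasible (bump α i Δ) ∧
      Q.dualR α + Q.stepV * Q.lossGap (Q.wOf α) α i / n ≤ Q.dualR (bump α i Δ) := by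
  obtain ⟨Δ₀, hopt, hle⟩ := hΔ
  have hX0 := opNormD_nonneg Q.normP (Q.X i)
  have hX := pow_le_pow_left₀ hX0 (hQ.X_bound i) 2
  have key : ((-(Q.φConj i (-α i)).toReal + Q.stepV * Q.lossGap (Q.wOf α) α i : ℝ) : EReal) ≤
      Q.proxObj α i Δ₀ := by
    rcases hopt with h | ⟨s, hs, rfl, h⟩ | h | h | h
    · exact (hQ.le_proxObj_stepV hα i).trans (h _)
    · exact (hQ.le_proxObj_stepV hα i).trans (h _ hQ.stepV_mem)
    · rw [h]; exact hQ.le_proxObj_stepIII hα i le_rfl hX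
    · rw [h]; exact hQ.le_proxObj_stepIII hα i hX le_rfl
    · rw [h]; exact hQ.le_proxObj_stepV hα i
  have hf₀ := hα.bump (φConj_ne_top_of_le_proxObj key)
  have hinc := hQ.dualR_bump key
  rw [hQ.dual_eq hf₀] at hle
  -- An infeasible update would have dual value ⊥, below that of the option it has to match.
  have hf : Q.Feasible (bump α i Δ) :=
    hQ.dual_ne_bot_iff.1 (ne_bot_of_le_ne_bot (EReal.coe_ne_bot _) hle)
  rw [hQ.dual_eq hf, EReal.coe_le_coe_iff] at hle
  exact ⟨hf, hinc.trans hle⟩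

end DualIncrease

/-! ### The primal minimizer -/

section Primal

variable {d k n : ℕ} {Q : Problem d k n}

theorem Regular.convexOn_loss (hQ : Q.Regular) :
    ConvexOn ℝ Set.univ fun w => (1 / (n : ℝ)) * ∑ i, Q.φ i ((Q.X i).adjoint w) := by
  have h : ∀ i, ConvexOn ℝ Set.univ fun w => Q.φ i ((Q.X i).adjoint w) := fun i =>
    (hQ.φ_convex i).comp_linearMap ((Q.X i).adjoint : Vec d →ₗ[ℝ] Vec k)
  refine ⟨convex_univ, fun x hx y hy a b ha hb hab => ?_⟩
  simp only [smul_eq_mul]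
  have h1 := Finset.sum_le_sum fun i (_ : i ∈ Finset.univ) => (h i).2 hx hy ha hb hab
  simp only [smul_eq_mul, Finset.sum_add_distrib, ← Finset.mul_sum] at h1
  have h2 := mul_le_mul_of_nonneg_left h1 (show (0 : ℝ) ≤ 1 / n by positivity)
  linarith

theorem Regular.exists_primal_min (hQ : Q.Regular) :
    ∃ w₀, Q.g w₀ ≠ ⊤ ∧
      ∀ w, Q.g w ≠ ⊤ → Q.primalR w₀ + Q.lam / 2 * ‖w - w₀‖ ^ 2 ≤ Q.primalR w := by
  have hcont : Continuous fun w => (1 / (n : ℝ)) * ∑ i, Q.φ i ((Q.X i).adjoint w) := by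
    have h : ∀ i, Continuous (Q.φ i) := fun i => (hQ.φ_smooth i).1.continuous
    fun_prop
  have hf := hQ.g_strong.mul_add hQ.lam_pos hcont (strongConvexOn_zero.2 hQ.convexOn_loss)
  have hP : (fun w => (Q.lam : EReal) * Q.g w +
      (((1 / (n : ℝ)) * ∑ i, Q.φ i ((Q.X i).adjoint w) : ℝ) : EReal)) = Q.primal := by
    ext w
    rw [primal, add_comm]
  rw [hP, mul_one, add_zero] at hf
  obtain ⟨w₀, hw₀, hmin⟩ := hf.exists_isMin hQ.lam_pos
  refine ⟨w₀, hQ.primal_ne_top_iff.1 hw₀, fun w hw => ?_⟩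
  have := hf.le_of_isMin hw₀ hmin w
  rw [hQ.primal_eq hw, hQ.primal_eq (hQ.primal_ne_top_iff.1 hw₀)] at this
  exact_mod_cast this

theorem Regular.primalR_sum_le (hQ : Q.Regular) {ι : Type*} (S : Finset ι) {c : ι → ℝ}
    (hc : ∀ j ∈ S, 0 ≤ c j) (hc1 : ∑ j ∈ S, c j = 1) {w : ι → Vec d}
    (hw : ∀ j ∈ S, Q.g (w j) ≠ ⊤) :
    Q.g (∑ j ∈ S, c j • w j) ≠ ⊤ ∧
      Q.primalR (∑ j ∈ S, c j • w j) ≤ ∑ j ∈ S, c j * Q.primalR (w j) := by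
  have hg : ConvexOn ℝ {w | Q.g w ≠ ⊤} fun w => (Q.g w).toReal :=
    hQ.g_strong.strong.convexOn fun r => by simp only [Pi.zero_apply]; positivity
  refine ⟨hg.1.sum_mem hc hc1 hw, ?_⟩
  have h1 := hg.map_sum_le hc hc1 hw
  have h2 := hQ.convexOn_loss.map_sum_le hc hc1 fun j _ => Set.mem_univ (w j)
  simp only [smul_eq_mul] at h1 h2
  have h3 := mul_le_mul_of_nonneg_left h1 hQ.lam_pos.le
  rw [Finset.mul_sum] at h3
  simp only [primalR, mul_add, Finset.sum_add_distrib]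
  refine add_le_add h2 (h3.trans_eq (Finset.sum_congr rfl fun j _ => by ring))

theorem v_sum {ι : Type*} (S : Finset ι) (c : ι → ℝ) (α : ι → Fin n → Vec k) :
    Q.v (∑ j ∈ S, c j • α j) = ∑ j ∈ S, c j • Q.v (α j) := by
  simp only [v, Finset.sum_apply, Pi.smul_apply, map_sum, map_smul]
  rw [Finset.sum_comm, Finset.smul_sum]
  refine Finset.sum_congr rfl fun j _ => ?_
  rw [← Finset.smul_sum, smul_comm]

/-- Conjugates are suprema of affine functions, hence convex. For g* the maximizer at the averaged v
is tested at each single v. -/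
theorem Regular.dualR_sum_le (hQ : Q.Regular) {ι : Type*} (S : Finset ι) {c : ι → ℝ}
    (hc : ∀ j ∈ S, 0 ≤ c j) (hc1 : ∑ j ∈ S, c j = 1) {α : ι → Fin n → Vec k}
    (hα : ∀ j ∈ S, Q.Feasible (α j)) :
    Q.Feasible (∑ j ∈ S, c j • α j) ∧
      ∑ j ∈ S, c j * Q.dualR (α j) ≤ Q.dualR (∑ j ∈ S, c j • α j) := by
  have h1 : ∀ i, Q.φConj i (-(∑ j ∈ S, c j • α j) i) ≤
      ((∑ j ∈ S, c j * (Q.φConj i (-α j i)).toReal : ℝ) : EReal) := by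
    intro i
    have := conj_sum_le (φ := Q.φ i) S c hc hc1 (fun j => -α j i)
      (fun j => (Q.φConj i (-α j i)).toReal) fun j hj => EReal.le_coe_toReal (hα j hj i)
    have he : ∑ j ∈ S, c j • -α j i = -(∑ j ∈ S, c j • α j) i := by
      simp [Finset.sum_apply, Finset.sum_neg_distrib]
    rwa [he] at this
  have h2 : (conj Q.g (Q.v (∑ j ∈ S, c j • α j))).toReal ≤
      ∑ j ∈ S, c j * (conj Q.g (Q.v (α j))).toReal := by
    obtain ⟨w, hw, hcw, -⟩ := hQ.g_strong.conj_attained (Q.v (∑ j ∈ S, c j • α j))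
    have h3 : ⟪Q.v (∑ j ∈ S, c j • α j), w⟫_ℝ - (Q.g w).toReal =
        ∑ j ∈ S, c j * (⟪Q.v (α j), w⟫_ℝ - (Q.g w).toReal) := by
      simp only [v_sum, sum_inner, inner_smul_left, conj_trivial, mul_sub,
        Finset.sum_sub_distrib, ← Finset.sum_mul, hc1, one_mul]
    rw [hcw, EReal.toReal_coe, h3]
    refine Finset.sum_le_sum fun j hj => mul_le_mul_of_nonneg_left ?_ (hc j hj)
    obtain ⟨w', hw', hcw', hmin⟩ := hQ.g_strong.conj_attained (Q.v (α j))
    rw [hcw', EReal.toReal_coe]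
    have := hmin w hw
    rw [inner_sub_right] at this
    nlinarith [sq_nonneg ‖w - w'‖]
  refine ⟨fun i => ne_top_of_le_ne_top (EReal.coe_ne_top _) (h1 i), ?_⟩
  have h3 : ∑ i, (Q.φConj i (-(∑ j ∈ S, c j • α j) i)).toReal ≤
      ∑ j ∈ S, c j * ∑ i, (Q.φConj i (-α j i)).toReal := by
    simp only [Finset.mul_sum]
    rw [Finset.sum_comm]
    exact Finset.sum_le_sum fun i _ => by
      have := EReal.toReal_le_toReal (h1 i) (φConj_ne_bot i _) (EReal.coe_ne_top _)
      rwa [EReal.toReal_coe] at this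
  have h4 := mul_le_mul_of_nonneg_left h3 (show (0 : ℝ) ≤ 1 / n by positivity)
  have h5 := mul_le_mul_of_nonneg_left h2 hQ.lam_pos.le
  have h6 : ∑ j ∈ S, c j * Q.dualR (α j) =
      -(1 / (n : ℝ) * ∑ j ∈ S, c j * ∑ i, (Q.φConj i (-α j i)).toReal) -
        Q.lam * ∑ j ∈ S, c j * (conj Q.g (Q.v (α j))).toReal := by
    rw [Finset.mul_sum, Finset.mul_sum, ← Finset.sum_neg_distrib, ← Finset.sum_sub_distrib]
    refine Finset.sum_congr rfl fun j _ => ?_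
    rw [dualR, Finset.sum_neg_distrib]
    ring
  rw [h6, dualR, Finset.sum_neg_distrib]
  linarith

/-- The duality gap is jointly convex. -/
theorem Regular.gapR_sum_le (hQ : Q.Regular) {ι : Type*} (S : Finset ι) {c : ι → ℝ}
    (hc : ∀ j ∈ S, 0 ≤ c j) (hc1 : ∑ j ∈ S, c j = 1) {w : ι → Vec d}
    (hw : ∀ j ∈ S, Q.g (w j) ≠ ⊤) {α : ι → Fin n → Vec k} (hα : ∀ j ∈ S, Q.Feasible (α j)) :
    Q.gapR (∑ j ∈ S, c j • w j) (∑ j ∈ S, c j • α j) ≤ ∑ j ∈ S, c j * Q.gapR (w j) (α j) := by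
  have h1 := (hQ.primalR_sum_le S hc hc1 hw).2
  have h2 := (hQ.dualR_sum_le S hc hc1 hα).2
  simp only [gapR, mul_sub, Finset.sum_sub_distrib]
  linarith

end Primal

/-! ### The regularized problems -/

section Regularized

variable {d k n : ℕ} {Q : Problem d k n}

theorem regularized_g (y w : Vec d) : (Q.regularized y).g w =
    ((Q.lam / (Q.lam + Q.kappa) : ℝ) : EReal) * Q.g w +
      ((Q.kappa / (Q.lam + Q.kappa) * (‖w‖ ^ 2 / 2 - ⟪w, y⟫_ℝ) : ℝ) : EReal) := rfl

theorem regularized_g_ne_top_iff (hQ : Q.Regular) (hκ : 0 ≤ Q.kappa) (y w : Vec d) :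
    (Q.regularized y).g w ≠ ⊤ ↔ Q.g w ≠ ⊤ := by
  have hl := hQ.lam_pos
  have hc : 0 < Q.lam / (Q.lam + Q.kappa) := by positivity
  by_cases hw : Q.g w = ⊤
  · simp only [regularized_g, hw, EReal.coe_mul_top_of_pos hc, EReal.top_add_coe]
  · rw [regularized_g, ← EReal.coe_toReal hw (hQ.g_strong.ne_bot w), ← EReal.coe_mul,
      ← EReal.coe_add]
    simp only [ne_eq, EReal.coe_ne_top, not_false_eq_true]

theorem regularized_g_toReal (hQ : Q.Regular) (y : Vec d) {w : Vec d}
    (hw : Q.g w ≠ ⊤) : ((Q.regularized y).g w).toReal = Q.lam / (Q.lam + Q.kappa) * (Q.g w).toReal +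
      Q.kappa / (Q.lam + Q.kappa) * (‖w‖ ^ 2 / 2 - ⟪w, y⟫_ℝ) := by
  rw [regularized_g, ← EReal.coe_toReal hw (hQ.g_strong.ne_bot w), ← EReal.coe_mul,
      ← EReal.coe_add, EReal.toReal_coe, EReal.toReal_coe]

/-- The weights λ/(λ+κ) and κ/(λ+κ) add up to 1, so the new regularizer is again 1-strongly convex
and the inner analysis applies as it stands. -/
theorem Regular.regularized (hQ : Q.Regular) (hκ : 0 ≤ Q.kappa) (y : Vec d) :
    (Q.regularized y).Regular := by
  have hl := hQ.lam_pos
  have hc : 0 < Q.lam / (Q.lam + Q.kappa) := by positivity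
  refine ⟨by change 0 < Q.lam + Q.kappa; positivity, hQ.gam_pos, hQ.norm_def, hQ.φ_convex,
    hQ.φ_smooth, ?_, hQ.X_bound⟩
  have hh : StrongConvexOn Set.univ (Q.kappa / (Q.lam + Q.kappa))
      fun w : Vec d => Q.kappa / (Q.lam + Q.kappa) * (‖w‖ ^ 2 / 2 - ⟪w, y⟫_ℝ) := by
    have h1 := UniformConvexOn.add (strongConvexOn_norm_sq (d := d) (Q.kappa / (Q.lam + Q.kappa)))
      (strongConvexOn_inner (-(Q.kappa / (Q.lam + Q.kappa)) • y))
    have e : ((fun r : ℝ => Q.kappa / (Q.lam + Q.kappa) / 2 * r ^ 2) + fun r : ℝ => 0 / 2 * r ^ 2) =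
      fun r : ℝ => Q.kappa / (Q.lam + Q.kappa) / 2 * r ^ 2 := by ext r; simp
    rw [e] at h1
    unfold StrongConvexOn
    convert h1 using 1
    ext w
    simp only [Pi.add_apply, inner_smul_left, real_inner_comm w y, conj_trivial]
    ring
  have := hQ.g_strong.mul_add hc (by fun_prop) hh
  have e : Q.lam / (Q.lam + Q.kappa) * 1 + Q.kappa / (Q.lam + Q.kappa) = 1 := by
    field_simp
  rwa [e] at this

theorem regularized_primalR (hQ : Q.Regular) (hκ : 0 ≤ Q.kappa) (y : Vec d) {w : Vec d}
    (hw : Q.g w ≠ ⊤) : (Q.regularized y).primalR w =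
      Q.primalR w + Q.kappa / 2 * ‖w‖ ^ 2 - Q.kappa * ⟪w, y⟫_ℝ := by
  have hl := hQ.lam_pos
  rw [primalR, regularized_g_toReal hQ y hw, primalR]
  have e : (Q.lam + Q.kappa) * (Q.lam / (Q.lam + Q.kappa) * (Q.g w).toReal +
      Q.kappa / (Q.lam + Q.kappa) * (‖w‖ ^ 2 / 2 - ⟪w, y⟫_ℝ)) =
      Q.lam * (Q.g w).toReal + (Q.kappa / 2 * ‖w‖ ^ 2 - Q.kappa * ⟪w, y⟫_ℝ) := by
    field_simp
  change 1 / (n : ℝ) * ∑ i, Q.φ i ((Q.X i).adjoint w) + (Q.lam + Q.kappa) * _ = _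
  rw [e]
  ring

end Regularized

end Problem

/-! ### Resampling one coordinate of a sequence of independent draws -/

section Resampling

variable {A : Type*} [MeasurableSpace A]

/-- Replacing one coordinate by an independent copy preserves the product law. This takes the place
of conditional expectations: one draw is integrated out while the others are fixed. -/
theorem map_update_infinitePi (μ : Measure A) [IsProbabilityMeasure μ] (t : ℕ) :
    ((Measure.infinitePi fun _ : ℕ => μ).prod μ).map (fun z => Function.update z.1 t z.2) =
      Measure.infinitePi fun _ : ℕ => μ := by
  refine Measure.eq_infinitePi _ fun s B hB => ?_
  rw [Measure.map_apply measurable_update' (MeasurableSet.pi s.countable_toSet fun i _ => hB i)]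
  by_cases ht : t ∈ s
  · have : (fun z : (ℕ → A) × A => Function.update z.1 t z.2) ⁻¹' Set.pi s B =
        Set.pi (s.erase t : Finset ℕ) B ×ˢ B t := by
      ext z
      simp only [Set.mem_preimage, Set.mem_pi, Finset.mem_coe, Set.mem_prod, Finset.mem_erase]
      constructor
      · intro h
        refine ⟨fun i hi => ?_, by simpa using h t ht⟩
        simpa [hi.1] using h i hi.2
      · rintro ⟨h1, h2⟩ i hi
        by_cases hit : i = t
        · subst hit; simpa using h2
        · simpa [hit] using h1 i ⟨hit, hi⟩
    rw [this, Measure.prod_prod, Measure.infinitePi_pi _ fun i _ => hB i, mul_comm,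
      Finset.mul_prod_erase s (fun i => μ (B i)) ht]
  · have : (fun z : (ℕ → A) × A => Function.update z.1 t z.2) ⁻¹' Set.pi s B =
        Set.pi s B ×ˢ Set.univ := by
      ext z
      simp only [Set.mem_preimage, Set.mem_pi, Finset.mem_coe, Set.mem_prod, Set.mem_univ, and_true]
      refine forall₂_congr fun i hi => ?_
      have : i ≠ t := fun h => ht (h ▸ hi)
      simp [this]
    rw [this, Measure.prod_prod, Measure.infinitePi_pi _ fun i _ => hB i, measure_univ, mul_one]

theorem lintegral_infinitePi_update (μ : Measure A) [IsProbabilityMeasure μ] (t : ℕ)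
    {F : (ℕ → A) → ℝ≥0∞} (hF : Measurable F) :
    ∫⁻ ω, F ω ∂(Measure.infinitePi fun _ : ℕ => μ) =
      ∫⁻ ω, ∫⁻ x, F (Function.update ω t x) ∂μ ∂(Measure.infinitePi fun _ : ℕ => μ) := by
  conv_lhs => rw [← map_update_infinitePi μ t]
  rw [lintegral_map hF measurable_update',
    lintegral_prod (fun z => F (Function.update z.1 t z.2))
      (hF.comp measurable_update').aemeasurable]

theorem lintegral_uniformOfFintype [Fintype A] [Nonempty A] [MeasurableSingletonClass A]
    (f : A → ℝ≥0∞) :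
    ∫⁻ x, f x ∂(PMF.uniformOfFintype A).toMeasure = (Fintype.card A : ℝ≥0∞)⁻¹ * ∑ x, f x := by
  rw [lintegral_fintype, Finset.mul_sum]
  refine Finset.sum_congr rfl fun x _ => ?_
  rw [PMF.toMeasure_apply_singleton _ _ (measurableSet_singleton x), PMF.uniformOfFintype_apply,
    mul_comm]

/-- Finitely many draws from a finite set take finitely many values, so everything computed from
them is measurable, however irregular the update rule is. -/
theorem measurable_of_dependsOn_Iic [Finite A] [Nonempty A] [MeasurableSingletonClass A]
    {F : (ℕ → A) → ℝ≥0∞} {t : ℕ} (hF : DependsOn F (Set.Iic t)) : Measurable F := by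
  classical
  let e : (Finset.Iic t → A) → ℕ → A := fun x i =>
    if h : i ∈ Finset.Iic t then x ⟨i, h⟩ else Classical.arbitrary A
  have h : F = (fun x => F (e x)) ∘ (Finset.Iic t).restrict := by
    ext ω
    refine hF fun i hi => ?_
    have : i ∈ Finset.Iic t := Finset.mem_Iic.2 hi
    simp [e, Finset.mem_Iic.1 this]
  rw [h]
  exact (measurable_of_finite _).comp (Finset.measurable_restrict _)

end Resampling

namespace Problem

/-! ### Expected decrease of the dual suboptimality -/

section Iterates

variable {d k n : ℕ} {Q : Problem d k n}
  {U : ℕ → (Fin n → Vec k) → Fin n → Vec k} {α₀ : Fin n → Vec k}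

theorem iter_congr {ω ω' : ℕ → Q.Draw} {t : ℕ} (h : ∀ i ≤ t, (ω i).1 = (ω' i).1) :
    Q.iter U α₀ ω t = Q.iter U α₀ ω' t := by
  induction t with
  | zero => rfl
  | succ t ih =>
    rw [iter, iter, ih fun i hi => h i (hi.trans t.le_succ), h (t + 1) le_rfl]

theorem iter_update {ω : ℕ → Q.Draw} {s t : ℕ} (h : s < t) (x : Q.Draw) :
    Q.iter U α₀ (Function.update ω t x) s = Q.iter U α₀ ω s :=
  iter_congr fun i hi => by rw [Function.update_of_ne (by omega)]

/-- The number of iterations within which the dual suboptimality decreases by a constant factor. -/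
noncomputable def rate (Q : Problem d k n) : ℝ := n + Q.R ^ 2 / (Q.lam * Q.gam)

theorem rate_le_window (Q : Problem d k n) : Q.rate ≤ Q.window := by
  rw [rate, window, Nat.cast_add]
  have := Nat.le_ceil (Q.R ^ 2 / (Q.lam * Q.gam))
  linarith

theorem Regular.window_le (hQ : Q.Regular) : (Q.window : ℝ) ≤ Q.rate + 1 := by
  have h1 := hQ.lam_pos
  have h2 := hQ.gam_pos
  rw [rate, window, Nat.cast_add]
  have := Nat.ceil_lt_add_one (show 0 ≤ Q.R ^ 2 / (Q.lam * Q.gam) by positivity)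
  linarith

end Iterates

section Expectation

variable {d k n : ℕ} [NeZero n] {Q : Problem d k n}
  {U : ℕ → (Fin n → Vec k) → Fin n → Vec k} {α₀ : Fin n → Vec k}

instance : IsProbabilityMeasure Q.drawMeasure := by
  unfold drawMeasure; infer_instance

theorem lintegral_drawMeasure (t : ℕ) {F : (ℕ → Q.Draw) → ℝ≥0∞} (hF : Measurable F) :
    ∫⁻ ω, F ω ∂Q.drawMeasure = ∫⁻ ω, ((n : ℝ≥0∞)⁻¹ * (Q.window : ℝ≥0∞)⁻¹) *
      ∑ i, ∑ j, F (Function.update ω t (i, j)) ∂Q.drawMeasure := by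
  rw [drawMeasure, lintegral_infinitePi_update _ t hF]
  simp only [lintegral_uniformOfFintype, Fintype.card_prod, Fintype.card_fin, Nat.cast_mul,
    Fintype.sum_prod_type]
  rw [ENNReal.mul_inv (Or.inr (ENNReal.natCast_ne_top _)) (Or.inl (ENNReal.natCast_ne_top _))]

theorem inv_mul_sum_const (m : ℕ) [NeZero m] (c : ℝ≥0∞) :
    (m : ℝ≥0∞)⁻¹ * ∑ _j : Fin m, c = c := by
  rw [Finset.sum_const, Finset.card_univ, Fintype.card_fin, nsmul_eq_mul, ← mul_assoc,
    ENNReal.inv_mul_cancel (by exact_mod_cast NeZero.ne m) (ENNReal.natCast_ne_top m), one_mul]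

theorem measurable_comp_iter (f : (Fin n → Vec k) → ℝ≥0∞) (t : ℕ) :
    Measurable fun ω => f (Q.iter U α₀ ω t) :=
  measurable_of_dependsOn_Iic (t := t) fun ω ω' h => by
    rw [iter_congr fun i hi => by rw [h i hi]]

theorem lintegral_iter_succ (f : (Fin n → Vec k) → ℝ≥0∞) (t : ℕ) :
    ∫⁻ ω, f (Q.iter U α₀ ω (t + 1)) ∂Q.drawMeasure =
      ∫⁻ ω, (n : ℝ≥0∞)⁻¹ * ∑ i, f (bump (Q.iter U α₀ ω t) i (U (t + 1) (Q.iter U α₀ ω t) i))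
        ∂Q.drawMeasure := by
  rw [lintegral_drawMeasure (t + 1) (measurable_comp_iter f (t + 1))]
  refine lintegral_congr fun ω => ?_
  simp only [iter, iter_update (Nat.lt_succ_self t), Function.update_self]
  rw [mul_assoc, Finset.mul_sum]
  simp only [inv_mul_sum_const]

theorem lintegral_iter_window (f : (Fin n → Vec k) → ℝ≥0∞) {t : ℕ} (ht : Q.window ≤ t) :
    ∫⁻ ω, f (Q.iter U α₀ ω (t - Q.window + 1 + (ω t).2)) ∂Q.drawMeasure =
      (Q.window : ℝ≥0∞)⁻¹ * ∑ j : Fin Q.window,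
        ∫⁻ ω, f (Q.iter U α₀ ω (t - Q.window + 1 + j)) ∂Q.drawMeasure := by
  have hmeas : Measurable fun ω : ℕ → Q.Draw =>
      f (Q.iter U α₀ ω (t - Q.window + 1 + (ω t).2)) :=
    measurable_of_dependsOn_Iic (t := t) fun ω ω' h => by
      have h2 : ω t = ω' t := h t (Set.mem_Iic.2 le_rfl)
      have h3 := (ω' t).2.2
      rw [h2, iter_congr fun i hi => by rw [h i (Set.mem_Iic.2 (by omega))]]
  -- The last index of the window is `t` itself, whose iterate does depend on draw `t`, but only on
  -- its first component; the random position is the second one.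
  have hupd : ∀ (ω : ℕ → Q.Draw) i (j j' : Fin Q.window),
      Q.iter U α₀ (Function.update ω t (i, j')) (t - Q.window + 1 + j) =
        Q.iter U α₀ (Function.update ω t (i, j)) (t - Q.window + 1 + j) := by
    intro ω i j j'
    refine iter_congr fun l _ => ?_
    by_cases hl : l = t
    · subst hl; simp
    · simp [hl]
  have hterm : ∀ j : Fin Q.window,
      ∫⁻ ω, f (Q.iter U α₀ ω (t - Q.window + 1 + j)) ∂Q.drawMeasure =
        ∫⁻ ω, (n : ℝ≥0∞)⁻¹ *
          ∑ i, f (Q.iter U α₀ (Function.update ω t (i, j)) (t - Q.window + 1 + j))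
            ∂Q.drawMeasure := by
    intro j
    rw [lintegral_drawMeasure t (measurable_comp_iter f _)]
    refine lintegral_congr fun ω => ?_
    simp only [hupd ω _ j]
    rw [mul_assoc, Finset.mul_sum]
    simp only [inv_mul_sum_const]
  simp only [hterm]
  rw [lintegral_drawMeasure t hmeas, ← lintegral_finsetSum, ← lintegral_const_mul]
  · refine lintegral_congr fun ω => ?_
    simp only [Function.update_self]
    rw [← Finset.mul_sum, Finset.sum_comm, ← mul_assoc, mul_comm (n : ℝ≥0∞)⁻¹]
  · refine Finset.measurable_sum _ fun j _ => Measurable.const_mul ?_ _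
    refine Finset.measurable_sum _ fun i _ => ?_
    exact (measurable_comp_iter f _).comp measurable_update_left
  · intro j _
    refine Measurable.const_mul ?_ _
    refine Finset.measurable_sum _ fun i _ => ?_
    exact (measurable_comp_iter f _).comp measurable_update_left

theorem Regular.feasible_iter (hQ : Q.Regular) (hU : ∀ t α i, Q.IsUpdate α i (U t α i))
    (h₀ : Q.Feasible α₀) (ω : ℕ → Q.Draw) (t : ℕ) : Q.Feasible (Q.iter U α₀ ω t) := by
  induction t with
  | zero => exact h₀
  | succ t ih => exact (hQ.dual_increase ih (hU _ _ _)).1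

theorem Regular.one_le_rate (hQ : Q.Regular) : 1 ≤ Q.rate := by
  have hn : (1 : ℝ) ≤ n := by exact_mod_cast NeZero.one_le
  have h1 := hQ.lam_pos
  have h2 := hQ.gam_pos
  have : 0 ≤ Q.R ^ 2 / (Q.lam * Q.gam) := by positivity
  unfold rate
  linarith

theorem Regular.stepV_div (hQ : Q.Regular) : Q.stepV / n = 1 / Q.rate := by
  have hn : (0 : ℝ) < n := by exact_mod_cast NeZero.pos n
  have h1 := hQ.lam_pos
  have h2 := hQ.gam_pos
  have h3 : Q.R ^ 2 + Q.lam * n * Q.gam ≠ 0 := by positivity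
  have h4 : n * (Q.lam * Q.gam) + Q.R ^ 2 ≠ 0 := by positivity
  unfold stepV rate
  field_simp
  ring

/-- The guaranteed increases have mean `stepV`/n times the gap at w(α), and `stepV`/n is 1/`rate`.
-/
theorem Regular.sum_dualR_bump_le (hQ : Q.Regular) {α : Fin n → Vec k} (hα : Q.Feasible α)
    {Δ : Fin n → Vec k} (hΔ : ∀ i, Q.IsUpdate α i (Δ i)) (c : ℝ) :
    1 / (n : ℝ) * ∑ i, (c - Q.dualR (bump α i (Δ i))) + 1 / Q.rate * Q.gapR (Q.wOf α) α ≤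
      c - Q.dualR α := by
  have hn : (0 : ℝ) < n := by exact_mod_cast NeZero.pos n
  have h := Finset.sum_le_sum fun i (_ : i ∈ Finset.univ) => (hQ.dual_increase hα (hΔ i)).2
  rw [Finset.sum_add_distrib, Finset.sum_const, Finset.card_univ, Fintype.card_fin,
    nsmul_eq_mul] at h
  rw [Finset.sum_sub_distrib, Finset.sum_const, Finset.card_univ, Fintype.card_fin, nsmul_eq_mul,
    ← hQ.stepV_div, hQ.gapR_wOf]
  have h2 : ∑ i, Q.stepV * Q.lossGap (Q.wOf α) α i / n =
      Q.stepV / n * ∑ i, Q.lossGap (Q.wOf α) α i := by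
    rw [Finset.mul_sum]
    exact Finset.sum_congr rfl fun i _ => by ring
  rw [h2] at h
  have h3 := mul_le_mul_of_nonneg_left h (show (0 : ℝ) ≤ 1 / n by positivity)
  have e : 1 / (n : ℝ) * (n * c - ∑ i, Q.dualR (bump α i (Δ i))) =
      c - 1 / n * ∑ i, Q.dualR (bump α i (Δ i)) := by field_simp
  have e2 : 1 / (n : ℝ) * (n * Q.dualR α + Q.stepV / n * ∑ i, Q.lossGap (Q.wOf α) α i) =
      Q.dualR α + 1 / n * (Q.stepV / n * ∑ i, Q.lossGap (Q.wOf α) α i) := by field_simp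
  rw [e]
  rw [e2] at h3
  linarith

/-- Expected dual suboptimality, relative to a lower bound `c` of the primal objective. -/
noncomputable def expSubopt (Q : Problem d k n) (U : ℕ → (Fin n → Vec k) → Fin n → Vec k)
    (α₀ : Fin n → Vec k) (c : ℝ) (t : ℕ) : ℝ≥0∞ :=
  ∫⁻ ω, ENNReal.ofReal (c - Q.dualR (Q.iter U α₀ ω t)) ∂Q.drawMeasure

/-- Expected duality gap of `(w⁽ᵗ⁾, α⁽ᵗ⁾)`. -/
noncomputable def expGap (Q : Problem d k n) (U : ℕ → (Fin n → Vec k) → Fin n → Vec k)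
    (α₀ : Fin n → Vec k) (t : ℕ) : ℝ≥0∞ :=
  ∫⁻ ω, ENNReal.ofReal (Q.gapR (Q.wOf (Q.iter U α₀ ω t)) (Q.iter U α₀ ω t)) ∂Q.drawMeasure

variable {c : ℝ}

theorem Regular.dualR_le (hQ : Q.Regular) {c : ℝ} (hc : IsLeast (Q.primalR '' {w | Q.g w ≠ ⊤}) c)
    {α : Fin n → Vec k} (hα : Q.Feasible α) : Q.dualR α ≤ c := by
  obtain ⟨w, hw, rfl⟩ := hc.1
  have := hQ.gapR_nonneg hw hα
  rw [gapR] at this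
  linarith

/-- One draw is averaged out. As `c` is the minimum of the primal objective, all quantities are
nonnegative and `ENNReal.ofReal` loses nothing. -/
theorem Regular.expSubopt_succ_add_le (hQ : Q.Regular) (hU : ∀ t α i, Q.IsUpdate α i (U t α i))
    (h₀ : Q.Feasible α₀) (hc : IsLeast (Q.primalR '' {w | Q.g w ≠ ⊤}) c) (t : ℕ) :
    Q.expSubopt U α₀ c (t + 1) + ENNReal.ofReal (1 / Q.rate) * Q.expGap U α₀ t ≤
      Q.expSubopt U α₀ c t := by
  have hr : 0 ≤ 1 / Q.rate := by have := hQ.one_le_rate; positivity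
  rw [expSubopt, expGap, expSubopt, lintegral_iter_succ fun α => ENNReal.ofReal (c - Q.dualR α),
    ← lintegral_const_mul _ (measurable_comp_iter
      (fun α => ENNReal.ofReal (Q.gapR (Q.wOf α) α)) t),
    ← lintegral_add_right _ (Measurable.const_mul (measurable_comp_iter
      (fun α => ENNReal.ofReal (Q.gapR (Q.wOf α) α)) t) _)]
  refine lintegral_mono fun ω => ?_
  have hf := hQ.feasible_iter hU h₀ ω t
  set α := Q.iter U α₀ ω t
  have hnext : ∀ i, 0 ≤ c - Q.dualR (bump α i (U (t + 1) α i)) := fun i =>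
    sub_nonneg.2 (hQ.dualR_le hc (hQ.dual_increase hf (hU _ _ i)).1)
  have hn : (n : ℝ≥0∞)⁻¹ = ENNReal.ofReal (1 / n) := by
    have hn : (0 : ℝ) < n := by exact_mod_cast NeZero.pos n
    rw [one_div, ENNReal.ofReal_inv_of_pos hn, ENNReal.ofReal_natCast]
  rw [hn, ← ENNReal.ofReal_sum_of_nonneg fun i _ => hnext i,
    ← ENNReal.ofReal_mul (by positivity), ← ENNReal.ofReal_mul hr,
    ← ENNReal.ofReal_add (mul_nonneg (by positivity) (Finset.sum_nonneg fun i _ => hnext i))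
      (mul_nonneg hr (hQ.gapR_nonneg (hQ.g_wOf_ne_top _) hf))]
  exact ENNReal.ofReal_le_ofReal (hQ.sum_dualR_bump_le hf (hU (t + 1) α) c)

theorem Regular.expSubopt_le_expGap (hQ : Q.Regular)
    (hc : IsLeast (Q.primalR '' {w | Q.g w ≠ ⊤}) c) (t : ℕ) :
    Q.expSubopt U α₀ c t ≤ Q.expGap U α₀ t := by
  refine lintegral_mono fun ω => ENNReal.ofReal_le_ofReal ?_
  rw [gapR]
  have := hc.2 ⟨_, hQ.g_wOf_ne_top (Q.iter U α₀ ω t), rfl⟩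
  linarith

/-- The decrease gap/`rate` is at least the fraction 1/`rate` of the suboptimality itself. -/
theorem Regular.expSubopt_le (hQ : Q.Regular) (hU : ∀ t α i, Q.IsUpdate α i (U t α i))
    (h₀ : Q.Feasible α₀) (hc : IsLeast (Q.primalR '' {w | Q.g w ≠ ⊤}) c) (t : ℕ) :
    Q.expSubopt U α₀ c t ≤ ENNReal.ofReal ((1 - 1 / Q.rate) ^ t * (c - Q.dualR α₀)) := by
  have hr := hQ.one_le_rate
  have hr1 : 1 / Q.rate ≤ 1 := by rw [div_le_one (by linarith)]; exact hr
  have hr0 : 0 ≤ 1 / Q.rate := by positivity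
  induction t with
  | zero =>
    simp [expSubopt, iter]
  | succ t ih =>
    have h := (add_le_add_right (mul_le_mul_right (hQ.expSubopt_le_expGap (U := U) (α₀ := α₀) hc t)
      (ENNReal.ofReal (1 / Q.rate))) _).trans (hQ.expSubopt_succ_add_le hU h₀ hc t)
    have hfin : Q.expSubopt U α₀ c t ≠ ∞ := ne_top_of_le_ne_top ENNReal.ofReal_ne_top ih
    have h2 : Q.expSubopt U α₀ c (t + 1) ≤
        ENNReal.ofReal (1 - 1 / Q.rate) * Q.expSubopt U α₀ c t := by
      rw [ENNReal.ofReal_sub _ hr0, ENNReal.ofReal_one, ENNReal.sub_mul fun _ _ => hfin, one_mul]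
      exact ENNReal.le_sub_of_add_le_right (ENNReal.mul_ne_top ENNReal.ofReal_ne_top hfin) h
    refine h2.trans ((mul_le_mul_right ih _).trans_eq ?_)
    rw [← ENNReal.ofReal_mul (by linarith), pow_succ']
    ring_nf

theorem Regular.sum_expGap_le (hQ : Q.Regular) (hU : ∀ t α i, Q.IsUpdate α i (U t α i))
    (h₀ : Q.Feasible α₀) (hc : IsLeast (Q.primalR '' {w | Q.g w ≠ ⊤}) c) (s L : ℕ) :
    Q.expSubopt U α₀ c (s + L) +
      ENNReal.ofReal (1 / Q.rate) * ∑ j ∈ Finset.range L, Q.expGap U α₀ (s + j) ≤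
        Q.expSubopt U α₀ c s := by
  induction L with
  | zero => simp
  | succ L ih =>
    refine le_trans ?_ ih
    rw [Finset.sum_range_succ, mul_add, ← add_assoc s L 1]
    have := hQ.expSubopt_succ_add_le hU h₀ hc (s + L)
    calc _ = (Q.expSubopt U α₀ c (s + L + 1) + ENNReal.ofReal (1 / Q.rate) *
          Q.expGap U α₀ (s + L)) + ENNReal.ofReal (1 / Q.rate) *
          ∑ j ∈ Finset.range L, Q.expGap U α₀ (s + j) := by ring
      _ ≤ _ := by gcongr

/-- The suboptimality at the start of the window pays for the sum of all gaps divided by `rate`, and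
the window is at least as long as `rate`. -/
theorem Regular.window_sum_expGap_le (hQ : Q.Regular) (hU : ∀ t α i, Q.IsUpdate α i (U t α i))
    (h₀ : Q.Feasible α₀) (hc : IsLeast (Q.primalR '' {w | Q.g w ≠ ⊤}) c) (s : ℕ) :
    (Q.window : ℝ≥0∞)⁻¹ * ∑ j ∈ Finset.range Q.window, Q.expGap U α₀ (s + j) ≤
      ENNReal.ofReal ((1 - 1 / Q.rate) ^ s * (c - Q.dualR α₀)) := by
  refine le_trans ?_ ((le_add_self.trans (hQ.sum_expGap_le hU h₀ hc s Q.window)).trans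
    (hQ.expSubopt_le hU h₀ hc s))
  have hr := hQ.one_le_rate
  have hW := Q.rate_le_window
  gcongr
  rw [← ENNReal.ofReal_natCast, ← ENNReal.ofReal_inv_of_pos (by linarith), one_div]
  exact ENNReal.ofReal_le_ofReal (inv_anti₀ (by linarith) hW)

end Expectation

/-! ### The expected number of iterations of a call -/

section Stopping

variable {d k n : ℕ} {Q : Problem d k n}
  {U : ℕ → (Fin n → Vec k) → Fin n → Vec k} {α₀ : Fin n → Vec k} {c : ℝ}

theorem sum_Icc_window {M : Type*} [AddCommMonoid M] (f : ℕ → M) {t : ℕ} (ht : Q.window ≤ t) :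
    ∑ i ∈ Finset.Icc (t - Q.window + 1) t, f (i - 1) =
      ∑ j ∈ Finset.range Q.window, f (t - Q.window + j) := by
  have h : Finset.Icc (t - Q.window + 1) t = Finset.Ico (t - Q.window + 1) (t + 1) := by
    ext i; simp only [Finset.mem_Icc, Finset.mem_Ico]; omega
  rw [h, Finset.sum_Ico_eq_sum_range]
  refine Finset.sum_congr (by congr 1; omega) fun j _ => ?_
  congr 1
  omega

theorem candidate_averaging (ω : ℕ → Q.Draw) {t : ℕ} (ht : Q.window ≤ t) :
    Q.candidate U .averaging α₀ ω t =
      (∑ j ∈ Finset.range Q.window,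
          (1 / (Q.window : ℝ)) • Q.wOf (Q.iter U α₀ ω (t - Q.window + j)),
        ∑ j ∈ Finset.range Q.window, (1 / (Q.window : ℝ)) • Q.iter U α₀ ω (t - Q.window + j)) := by
  rw [candidate, sum_Icc_window (fun i => Q.wOf (Q.iter U α₀ ω i)) ht,
    sum_Icc_window (fun i => Q.iter U α₀ ω i) ht, Finset.smul_sum, Finset.smul_sum]

open scoped Classical in
/-- The indicator of the event that the candidate at iteration `t` is not accurate enough. -/
noncomputable def rejected (Q : Problem d k n) (U : ℕ → (Fin n → Vec k) → Fin n → Vec k)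
    (o : OutputOption) (acc : ℝ) (α₀ : Fin n → Vec k) (t : ℕ) (ω : ℕ → Q.Draw) : ℝ≥0∞ :=
  if Q.gap (Q.candidate U o α₀ ω t) ≤ (acc : EReal) then 0 else 1

/-- Each failed test from `t₀` on costs m further iterations; if none succeeds, the sum is infinite.
-/
theorem numIter_le_add_tsum {o : OutputOption} {m : ℕ} {acc : ℝ} (ω : ℕ → Q.Draw) {t₀ : ℕ}
    (hm : 0 < m) (hmt : m ∣ t₀) (ht₀ : Q.window ≤ t₀) :
    Q.numIter U o m acc α₀ ω ≤ t₀ + m * ∑' j : ℕ, Q.rejected U o acc α₀ (t₀ + j * m) ω := by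
  classical
  by_cases h : ∃ j : ℕ, Q.gap (Q.candidate U o α₀ ω (t₀ + j * m)) ≤ (acc : EReal)
  · have hterm : Q.StopsAt U o m acc α₀ ω (t₀ + Nat.find h * m) :=
      ⟨ht₀.trans (Nat.le_add_right _ _), hmt.add (Dvd.intro_left _ rfl), Nat.find_spec h⟩
    refine (iInf₂_le _ hterm).trans ?_
    have hsum : (Nat.find h : ℝ≥0∞) ≤ ∑' j : ℕ, Q.rejected U o acc α₀ (t₀ + j * m) ω := by
      refine le_trans (le_of_eq ?_) (ENNReal.sum_le_tsum (Finset.range (Nat.find h)))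
      have h1 : ∀ j ∈ Finset.range (Nat.find h), Q.rejected U o acc α₀ (t₀ + j * m) ω = 1 :=
        fun j hj => if_neg (Nat.find_min h (Finset.mem_range.1 hj))
      simp [Finset.sum_congr rfl h1]
    push_cast
    rw [mul_comm (Nat.find h : ℝ≥0∞)]
    gcongr
  · push Not at h
    have : ∀ j : ℕ, Q.rejected U o acc α₀ (t₀ + j * m) ω = 1 := fun j => if_neg (not_le.2 (h j))
    simp only [this]
    rw [ENNReal.tsum_const_eq_top_of_ne_zero one_ne_zero,
      ENNReal.mul_top (by exact_mod_cast hm.ne'), add_top]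
    exact le_top

variable [NeZero n]

theorem candidate_congr {o : OutputOption} {ω ω' : ℕ → Q.Draw} {t : ℕ} (ht : Q.window ≤ t)
    (h : ∀ i ≤ t, ω i = ω' i) : Q.candidate U o α₀ ω t = Q.candidate U o α₀ ω' t := by
  have hW := NeZero.pos Q.window
  cases o with
  | averaging =>
    have : ∀ j ∈ Finset.range Q.window,
        Q.iter U α₀ ω (t - Q.window + j) = Q.iter U α₀ ω' (t - Q.window + j) := fun j hj => by
      have := Finset.mem_range.1 hj
      exact iter_congr fun i hi => by rw [h i (by omega)]
    rw [candidate_averaging ω ht, candidate_averaging ω' ht]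
    congr 1 <;> refine Finset.sum_congr rfl fun j hj => ?_ <;> rw [this j hj]
  | random =>
    have h3 := (ω' t).2.2
    simp only [candidate]
    rw [h t le_rfl, iter_congr fun i hi => by rw [h i (by omega)]]

theorem sum_window_weights (Q : Problem d k n) :
    ∑ _j ∈ Finset.range Q.window, 1 / (Q.window : ℝ) = 1 := by
  have : (Q.window : ℝ) ≠ 0 := by exact_mod_cast NeZero.ne Q.window
  rw [Finset.sum_const, Finset.card_range, nsmul_eq_mul]
  field_simp

theorem Regular.feasible_candidate (hQ : Q.Regular) (hU : ∀ t α i, Q.IsUpdate α i (U t α i))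
    (h₀ : Q.Feasible α₀) (o : OutputOption) (ω : ℕ → Q.Draw) {t : ℕ} (ht : Q.window ≤ t) :
    Q.g (Q.candidate U o α₀ ω t).1 ≠ ⊤ ∧ Q.Feasible (Q.candidate U o α₀ ω t).2 := by
  cases o with
  | averaging =>
    rw [candidate_averaging ω ht]
    exact ⟨(hQ.primalR_sum_le _ (fun _ _ => by positivity) Q.sum_window_weights
        fun j _ => hQ.g_wOf_ne_top _).1,
      (hQ.dualR_sum_le _ (fun _ _ => by positivity) Q.sum_window_weights
        fun j _ => hQ.feasible_iter hU h₀ ω _).1⟩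
  | random => exact ⟨hQ.g_wOf_ne_top _, hQ.feasible_iter hU h₀ ω _⟩

/-- The expected duality gap of the candidate output. -/
theorem Regular.lintegral_candidate_le (hQ : Q.Regular)
    (hU : ∀ t α i, Q.IsUpdate α i (U t α i)) (h₀ : Q.Feasible α₀)
    (hc : IsLeast (Q.primalR '' {w | Q.g w ≠ ⊤}) c) (o : OutputOption) {t : ℕ}
    (ht : Q.window ≤ t) :
    ∫⁻ ω, ENNReal.ofReal (Q.gapR (Q.candidate U o α₀ ω t).1 (Q.candidate U o α₀ ω t).2)
      ∂Q.drawMeasure ≤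
        ENNReal.ofReal ((1 - 1 / Q.rate) ^ (t - Q.window) * (c - Q.dualR α₀)) := by
  have hWpos : (0 : ℝ) < Q.window := by exact_mod_cast NeZero.pos Q.window
  have hr := hQ.one_le_rate
  have hr1 : 1 / Q.rate ≤ 1 := by rw [div_le_one (by linarith)]; exact hr
  have hr0 : 0 ≤ 1 / Q.rate := by positivity
  cases o with
  | averaging =>
    refine le_trans ?_ (hQ.window_sum_expGap_le hU h₀ hc (t - Q.window))
    have hmeas : ∀ j ∈ Finset.range Q.window, Measurable fun ω =>
        ENNReal.ofReal (Q.gapR (Q.wOf (Q.iter U α₀ ω (t - Q.window + j)))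
          (Q.iter U α₀ ω (t - Q.window + j))) := fun j _ =>
      measurable_comp_iter (fun α => ENNReal.ofReal (Q.gapR (Q.wOf α) α)) _
    simp only [expGap]
    rw [← lintegral_finsetSum _ hmeas, ← lintegral_const_mul _ (Finset.measurable_sum _ hmeas)]
    refine lintegral_mono fun ω => ?_
    have hgap : ∀ j, 0 ≤ Q.gapR (Q.wOf (Q.iter U α₀ ω (t - Q.window + j)))
        (Q.iter U α₀ ω (t - Q.window + j)) := fun j =>
      hQ.gapR_nonneg (hQ.g_wOf_ne_top _) (hQ.feasible_iter hU h₀ ω _)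
    rw [candidate_averaging ω ht, ← ENNReal.ofReal_natCast, ← ENNReal.ofReal_inv_of_pos hWpos,
      ← ENNReal.ofReal_sum_of_nonneg fun j _ => hgap j,
      ← ENNReal.ofReal_mul (by positivity), Finset.mul_sum, ← one_div]
    exact ENNReal.ofReal_le_ofReal (hQ.gapR_sum_le _ (fun _ _ => by positivity)
      Q.sum_window_weights (fun j _ => hQ.g_wOf_ne_top _) fun j _ => hQ.feasible_iter hU h₀ ω _)
  | random =>
    -- The random option returns iterate i rather than i - 1, so its window is shifted by one; the
    -- extra factor 1 - 1/`rate` is discarded.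
    have h := hQ.window_sum_expGap_le hU h₀ hc (t - Q.window + 1)
    simp only [candidate]
    rw [lintegral_iter_window (fun α => ENNReal.ofReal (Q.gapR (Q.wOf α) α)) ht]
    rw [← Fin.sum_univ_eq_sum_range fun j => Q.expGap U α₀ (t - Q.window + 1 + j)] at h
    refine h.trans (ENNReal.ofReal_le_ofReal ?_)
    exact mul_le_mul_of_nonneg_right (pow_le_pow_of_le_one (by linarith) (by linarith)
      (Nat.le_succ _)) (sub_nonneg.2 (hQ.dualR_le hc h₀))

theorem measurable_rejected {o : OutputOption} {acc : ℝ} {t : ℕ} (ht : Q.window ≤ t) :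
    Measurable (Q.rejected U o acc α₀ t) :=
  measurable_of_dependsOn_Iic (t := t) fun ω ω' h => by
    rw [rejected, rejected, candidate_congr ht fun i hi => h i hi]

/-- Markov's inequality for the gap of the candidate. -/
theorem Regular.lintegral_rejected_le (hQ : Q.Regular)
    (hU : ∀ t α i, Q.IsUpdate α i (U t α i)) (h₀ : Q.Feasible α₀)
    (hc : IsLeast (Q.primalR '' {w | Q.g w ≠ ⊤}) c) (o : OutputOption) {acc K : ℝ}
    (hacc : 0 ≤ acc) (hK : 0 ≤ K) (hδ : c - Q.dualR α₀ ≤ K * acc) {t : ℕ} (ht : Q.window ≤ t) :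
    ∫⁻ ω, Q.rejected U o acc α₀ t ω ∂Q.drawMeasure ≤
      ENNReal.ofReal (K * (1 - 1 / Q.rate) ^ (t - Q.window)) := by
  have hr := hQ.one_le_rate
  have hr1 : 1 / Q.rate ≤ 1 := by rw [div_le_one (by linarith)]; exact hr
  have hq : 0 ≤ (1 - 1 / Q.rate) ^ (t - Q.window) := pow_nonneg (by linarith) _
  have hE := hQ.lintegral_candidate_le hU h₀ hc o ht
  have hbad : ∀ ω, Q.rejected U o acc α₀ t ω ≠ 0 →
      acc < Q.gapR (Q.candidate U o α₀ ω t).1 (Q.candidate U o α₀ ω t).2 ∧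
        Q.rejected U o acc α₀ t ω = 1 := by
    intro ω hω
    have hf := hQ.feasible_candidate hU h₀ o ω ht
    have hg := hQ.gap_eq hf.1 hf.2
    unfold rejected at *
    split_ifs at hω ⊢ with h
    · exact absurd rfl hω
    · refine ⟨?_, rfl⟩
      rw [← Prod.mk.eta (p := Q.candidate U o α₀ ω t), hg, EReal.coe_le_coe_iff, not_le] at h
      exact h
  rcases hacc.eq_or_lt with h0 | h0
  -- For target accuracy 0 one cannot divide by `acc`, but then the expected gap is 0 and the gap
  -- vanishes almost surely.
  · have hz : (1 - 1 / Q.rate) ^ (t - Q.window) * (c - Q.dualR α₀) ≤ 0 :=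
      mul_nonpos_of_nonneg_of_nonpos hq (by rw [← h0, mul_zero] at hδ; exact hδ)
    rw [ENNReal.ofReal_of_nonpos hz, nonpos_iff_eq_zero, lintegral_eq_zero_iff
      (measurable_of_dependsOn_Iic (t := t) fun ω ω' h => by
        rw [candidate_congr ht fun i hi => h i hi])] at hE
    have hzero : Q.rejected U o acc α₀ t =ᵐ[Q.drawMeasure] 0 := by
      filter_upwards [hE] with ω hω
      by_contra hne
      have h1 := (hbad ω hne).1
      rw [Pi.zero_apply, ENNReal.ofReal_eq_zero] at hω
      linarith
    rw [lintegral_congr_ae hzero]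
    simp
  · have h1 : (∫⁻ ω, Q.rejected U o acc α₀ t ω ∂Q.drawMeasure) * ENNReal.ofReal acc ≤
        ENNReal.ofReal (K * (1 - 1 / Q.rate) ^ (t - Q.window)) * ENNReal.ofReal acc := by
      rw [← lintegral_mul_const _ (measurable_rejected ht), ← ENNReal.ofReal_mul (by positivity)]
      refine (lintegral_mono fun ω => ?_).trans (hE.trans (ENNReal.ofReal_le_ofReal ?_))
      · by_cases hω : Q.rejected U o acc α₀ t ω = 0
        · simp [hω]
        · rw [(hbad ω hω).2, one_mul]
          exact ENNReal.ofReal_le_ofReal (hbad ω hω).1.le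
      · calc _ ≤ (1 - 1 / Q.rate) ^ (t - Q.window) * (K * acc) := by gcongr
          _ = _ := by ring
    exact (ENNReal.mul_le_mul_iff_left (ENNReal.ofReal_pos.2 h0).ne' ENNReal.ofReal_ne_top).1 h1

/-- (1 - 1/r)^m (1 + 1/r)^m ≤ 1 and Bernoulli's inequality give (1 - 1/r)^m ≤ r/(r + m). This bounds
the geometric series of rejections. -/
theorem mul_inv_one_sub_pow_le {r : ℝ} (hr : 1 ≤ r) {m : ℕ} (hm : 0 < m) :
    (1 - 1 / r) ^ m < 1 ∧ m * (1 - (1 - 1 / r) ^ m)⁻¹ ≤ m + r := by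
  have hr0 : 0 < r := by linarith
  have hm' : (0 : ℝ) < m := by exact_mod_cast hm
  have h1 : 1 / r ≤ 1 := by rw [div_le_one hr0]; exact hr
  have h2 : 0 < 1 / r := by positivity
  have hB := one_add_mul_le_pow (a := 1 / r) (by linarith) m
  have hprod : (1 - 1 / r) ^ m * (1 + 1 / r) ^ m ≤ 1 := by
    rw [← mul_pow]
    exact pow_le_one₀ (mul_nonneg (by linarith) (by linarith)) (by nlinarith)
  have hq : 0 ≤ (1 - 1 / r) ^ m := pow_nonneg (by linarith) _
  have h3 : (1 - 1 / r) ^ m * (1 + m * (1 / r)) ≤ 1 :=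
    (mul_le_mul_of_nonneg_left hB hq).trans hprod
  set q := (1 - 1 / r) ^ m
  have h4 : q * (r + m) ≤ r := by
    have := mul_le_mul_of_nonneg_right h3 hr0.le
    have e : q * (1 + m * (1 / r)) * r = q * (r + m) := by field_simp
    linarith
  have h5 : q < 1 := by
    by_contra h
    nlinarith
  refine ⟨h5, ?_⟩
  rw [← div_eq_mul_inv, div_le_iff₀ (by linarith)]
  nlinarith

/-- The expected number of iterations of a call of Prox-SDCA. -/
theorem Regular.lintegral_numIter_le (hQ : Q.Regular)
    (hU : ∀ t α i, Q.IsUpdate α i (U t α i)) (h₀ : Q.Feasible α₀)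
    (hc : IsLeast (Q.primalR '' {w | Q.g w ≠ ⊤}) c) (o : OutputOption) {m : ℕ} (hm : 0 < m)
    {acc K : ℝ} (hacc : 0 ≤ acc) (hK : 1 ≤ K) (hδ : c - Q.dualR α₀ ≤ K * acc) :
    ∫⁻ ω, Q.numIter U o m acc α₀ ω ∂Q.drawMeasure ≤
      ENNReal.ofReal (2 * Q.rate + 2 + 2 * m + Q.rate * Real.log K) := by
  have hr := hQ.one_le_rate
  have hr1 : 1 / Q.rate ≤ 1 := by rw [div_le_one (by linarith)]; exact hr
  have hlog : 0 ≤ Q.rate * Real.log K := mul_nonneg (by linarith) (Real.log_nonneg hK)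
  set N := Q.window + ⌈Q.rate * Real.log K⌉₊ with hN
  -- The first multiple of m above `N`. The r log K iterations beyond the window bring the bound K(1
  -- - 1/r)^(t₀ - W) on the probability of rejection down to 1, and it decays geometrically from
  -- there.
  set t₀ := N / m * m + m with ht₀
  have ht₀N : N ≤ t₀ := (Nat.lt_div_mul_add hm).le
  have ht₀le : t₀ ≤ N + m := by have := Nat.div_mul_le_self N m; omega
  have hWt₀ : Q.window ≤ t₀ := (Nat.le_add_right _ _).trans ht₀N
  have hdvd : m ∣ t₀ := (Dvd.intro_left _ rfl).add dvd_rfl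
  obtain ⟨hq1, hgeo⟩ := mul_inv_one_sub_pow_le hr hm
  set q := 1 - 1 / Q.rate with hq
  have hq0 : 0 ≤ q := by linarith
  have hdecay : K * q ^ (t₀ - Q.window) ≤ 1 := by
    have h1 : q ^ (t₀ - Q.window) ≤ Real.exp (-(Real.log K)) := by
      have h2 : q ≤ Real.exp (-(1 / Q.rate)) := by
        rw [hq]; exact Real.one_sub_le_exp_neg _
      calc q ^ (t₀ - Q.window) ≤ Real.exp (-(1 / Q.rate)) ^ (t₀ - Q.window) := by gcongr
        _ = Real.exp (-((t₀ - Q.window : ℕ) / Q.rate)) := by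
          rw [← Real.exp_nat_mul]; congr 1; ring
        _ ≤ _ := by
          refine Real.exp_le_exp.2 (neg_le_neg ?_)
          rw [le_div_iff₀ (by linarith), mul_comm]
          refine (Nat.le_ceil _).trans ?_
          exact_mod_cast (by omega : ⌈Q.rate * Real.log K⌉₊ ≤ t₀ - Q.window)
    rw [Real.exp_neg, Real.exp_log (by linarith)] at h1
    calc K * q ^ (t₀ - Q.window) ≤ K * K⁻¹ := by gcongr
      _ = 1 := mul_inv_cancel₀ (by linarith)
  have hW : ∀ j : ℕ, Q.window ≤ t₀ + j * m := fun j => hWt₀.trans (Nat.le_add_right _ _)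
  have hrej : ∀ j : ℕ, ∫⁻ ω, Q.rejected U o acc α₀ (t₀ + j * m) ω ∂Q.drawMeasure ≤
      ENNReal.ofReal ((q ^ m) ^ j) := by
    intro j
    refine (hQ.lintegral_rejected_le hU h₀ hc o hacc (by linarith) hδ (hW j)).trans
      (ENNReal.ofReal_le_ofReal ?_)
    have e : t₀ + j * m - Q.window = (t₀ - Q.window) + m * j := by
      rw [mul_comm j]; omega
    rw [← hq, e, pow_add, ← mul_assoc, pow_mul]
    exact mul_le_of_le_one_left (by positivity) hdecay
  calc ∫⁻ ω, Q.numIter U o m acc α₀ ω ∂Q.drawMeasure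
      ≤ ∫⁻ ω, (t₀ + m * ∑' j : ℕ, Q.rejected U o acc α₀ (t₀ + j * m) ω) ∂Q.drawMeasure :=
        lintegral_mono fun ω => numIter_le_add_tsum ω hm hdvd hWt₀
    _ = t₀ + m * ∑' j : ℕ, ∫⁻ ω, Q.rejected U o acc α₀ (t₀ + j * m) ω ∂Q.drawMeasure := by
        rw [lintegral_add_left measurable_const, lintegral_const, measure_univ, mul_one,
          lintegral_const_mul' _ _ (ENNReal.natCast_ne_top m),
          lintegral_tsum fun j => (measurable_rejected (hW j)).aemeasurable]
    _ ≤ t₀ + m * ∑' j : ℕ, ENNReal.ofReal ((q ^ m) ^ j) := by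
        gcongr with j
        exact hrej j
    _ = ENNReal.ofReal (t₀ + m * (1 - q ^ m)⁻¹) := by
        have hqm : 0 ≤ q ^ m := by positivity
        have : 0 ≤ (1 - q ^ m)⁻¹ := inv_nonneg.2 (by linarith)
        rw [← ENNReal.ofReal_tsum_of_nonneg (fun j => by positivity)
          (summable_geometric_of_lt_one hqm hq1), tsum_geometric_of_lt_one hqm hq1,
          ENNReal.ofReal_add (by positivity) (by positivity), ENNReal.ofReal_mul (by positivity),
          ENNReal.ofReal_natCast, ENNReal.ofReal_natCast]
    _ ≤ _ := by
        refine ENNReal.ofReal_le_ofReal ?_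
        have h1 : (t₀ : ℝ) ≤ Q.window + ⌈Q.rate * Real.log K⌉₊ + m := by
          exact_mod_cast ht₀le
        have h2 := (Nat.ceil_lt_add_one hlog).le
        have h3 := hQ.window_le
        linarith

end Stopping

end Problem

/-! ### Estimate sequences -/

section EstimateSequence

variable {E : Type*} [NormedAddCommGroup E] [InnerProductSpace ℝ E]

/-- One step of the estimate sequence of an inexact accelerated proximal point method. -/
theorem estimate_step {P : E → ℝ} {S : Set E} {μ ρ κ η ξ e H : ℝ} {w v y w' : E}
    (hμ : 0 ≤ μ) (hκ : 0 ≤ κ) (hη : 0 < η) (hη1 : η ≤ 1) (hηρ : η ^ 2 * ρ = μ)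
    (hw : w ∈ S) (hy : (1 + η) • y = η • v + w)
    (hPw : P w ≤ H + ξ) (hH : ∀ z ∈ S, H + μ / 2 * ‖z - v‖ ^ 2 ≤ P z)
    (hQ : ∀ z ∈ S, P w' + (μ / 2 * ‖z - y‖ ^ 2 + ρ * ⟪y - w', z - y⟫_ℝ +
      (ρ + κ) / 2 * ‖y - w'‖ ^ 2 - e) ≤ P z) :
    ∃ H', P w' ≤ H' + ((1 - η) * ξ + e) ∧
      ∀ z ∈ S, H' + μ / 2 * ‖z - (w + η⁻¹ • (w' - w))‖ ^ 2 ≤ P z := by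
  set i := η⁻¹ with hi
  have hηi : η * i = 1 := mul_inv_cancel₀ hη.ne'
  have hρ : ρ = μ * i ^ 2 := by
    rw [← hηρ]; linear_combination (-ρ * (η * i + 1)) * hηi
  set u := v - y with hu
  set p := y - w' with hp
  have hwy : w - y = -(η • u) := by
    have : w = (1 + η) • y - η • v := by rw [hy]; abel
    rw [this, hu]; module
  have hv' : ∀ z, z - (w + i • (w' - w)) = (z - y) - ((1 - η) • u - i • p) := by
    intro z
    have hw2 : w = y - η • u := by rw [sub_eq_iff_eq_add.1 hwy]; abel
    have hw3 : w' = y - p := by rw [hp]; abel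
    have : i • (w' - w) = u - i • p := by
      rw [hw2, hw3]
      have : (y - p - (y - η • u)) = η • u - p := by abel
      rw [this, smul_sub, smul_smul, mul_comm i, hηi, one_smul]
    rw [this, hw2]; module
  -- The new minorant is (1 - η) times the old one plus η times that of the call. It has curvature μ
  -- and, in the variable z - y, its minimizer is (1 - η)u - η⁻¹p; the witness is its minimal value.
  refine ⟨(1 - η) * H + η * P w' + (η * (1 - η) * (μ / 2) * ‖u‖ ^ 2 +
    (1 - η) * η * ρ * ⟪u, p⟫_ℝ - ρ / 2 * ‖p‖ ^ 2) + η * ((ρ + κ) / 2) * ‖p‖ ^ 2 - η * e,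
    ?_, fun z hz => ?_⟩
  -- Testing at the old iterate, where w - y = -ηu by the choice of y, cancels the terms in ⟪u, p⟫;
  -- the remaining terms have the right sign.
  · have h := hQ w hw
    rw [hwy, norm_neg, norm_smul, mul_pow, Real.norm_eq_abs, sq_abs, inner_neg_right,
      inner_smul_right, real_inner_comm] at h
    have h1 := mul_le_mul_of_nonneg_left (h.trans hPw) (show 0 ≤ 1 - η by linarith)
    have h2 : 0 ≤ η * (1 - η) * (μ / 2) * ‖u‖ ^ 2 := by
      have : 0 ≤ 1 - η := by linarith
      positivity
    have h3 : 0 ≤ (1 - η) * (μ / 2) * (η ^ 2 * ‖u‖ ^ 2) := by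
      have : 0 ≤ 1 - η := by linarith
      positivity
    have h4 : 0 ≤ κ / 2 * ‖p‖ ^ 2 := by positivity
    linarith
  · have h1 := mul_le_mul_of_nonneg_left (hH z hz) (show 0 ≤ 1 - η by linarith)
    have h2 := mul_le_mul_of_nonneg_left (hQ z hz) hη.le
    have hzv : z - v = (z - y) - u := by rw [hu]; abel
    rw [hzv] at h1
    rw [hv' z]
    clear_value u p
    generalize z - y = x at *
    rw [norm_sub_sq_real] at h1 ⊢
    rw [norm_sub_sq_real ((1 - η) • u)]
    simp only [norm_smul, mul_pow, Real.norm_eq_abs, sq_abs, inner_sub_right, inner_smul_right,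
      inner_smul_left, conj_trivial] at *
    rw [real_inner_comm p x] at *
    refine le_of_eq_of_le ?_ (add_le_add h1 h2 |>.trans_eq (by ring : _ = P z))
    rw [hρ]
    linear_combination (-(μ * i * ⟪p, x⟫_ℝ) + (1 - η) * μ * i * ⟪u, p⟫_ℝ) * hηi

/-- Completing the square around x = -(ρ/μ)p. This turns the minorant of a single call into the
second stopping condition. -/
theorem neg_le_quadratic {μ ρ κ : ℝ} (hμ : 0 < μ) (hκ : 0 ≤ κ) (hρ : ρ = μ + κ) (x p : E) :
    -(ρ * κ / (2 * μ) * ‖p‖ ^ 2) ≤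
      μ / 2 * ‖x‖ ^ 2 + ρ * ⟪p, x⟫_ℝ + (ρ + κ) / 2 * ‖p‖ ^ 2 := by
  have h := sq_nonneg ‖μ • x + ρ • p‖
  rw [norm_add_sq_real] at h
  simp only [norm_smul, mul_pow, Real.norm_eq_abs, sq_abs, inner_smul_right, inner_smul_left,
    conj_trivial] at h
  rw [real_inner_comm p x] at h
  have h2 : 0 ≤ μ * κ * ‖p‖ ^ 2 := by positivity
  have e : ρ * κ / (2 * μ) * ‖p‖ ^ 2 = ρ * κ * ‖p‖ ^ 2 / (2 * μ) := by ring
  rw [e]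
  have h3 : 0 ≤ (ρ * κ * ‖p‖ ^ 2 + 2 * μ * (μ / 2 * ‖x‖ ^ 2 + ρ * ⟪p, x⟫_ℝ +
      (ρ + κ) / 2 * ‖p‖ ^ 2)) / (2 * μ) := by
    refine div_nonneg ?_ (by positivity)
    subst hρ
    nlinarith
  have e2 : (ρ * κ * ‖p‖ ^ 2 + 2 * μ * (μ / 2 * ‖x‖ ^ 2 + ρ * ⟪p, x⟫_ℝ +
      (ρ + κ) / 2 * ‖p‖ ^ 2)) / (2 * μ) = ρ * κ * ‖p‖ ^ 2 / (2 * μ) +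
      (μ / 2 * ‖x‖ ^ 2 + ρ * ⟪p, x⟫_ℝ + (ρ + κ) / 2 * ‖p‖ ^ 2) := by field_simp
  rw [e2] at h3
  linarith

/-- Strong convexity around an exact minimizer `x₀` is inherited by an approximate minimizer. -/
theorem quadratic_growth_of_approx {μ ρ e : ℝ} (hμ : 0 < μ) (hρ : 0 ≤ ρ) {z w x₀ : E}
    (h : (ρ + μ) / 2 * ‖w - x₀‖ ^ 2 ≤ e) :
    ρ / 2 * ‖z - w‖ ^ 2 ≤ (ρ + μ) / 2 * ‖z - x₀‖ ^ 2 + ρ / μ * e := by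
  have hz : z - w = (z - x₀) - (w - x₀) := by abel
  rw [hz]
  set a := z - x₀
  set b := w - x₀
  have h1 := sq_nonneg ‖μ • a + ρ • b‖
  rw [norm_add_sq_real] at h1
  rw [norm_sub_sq_real]
  simp only [norm_smul, mul_pow, Real.norm_eq_abs, sq_abs, inner_smul_right, inner_smul_left,
    conj_trivial] at h1
  have h2 : ρ / μ * ((ρ + μ) / 2 * ‖b‖ ^ 2) ≤ ρ / μ * e := by gcongr
  refine le_trans ?_ (add_le_add_right h2 _)
  rw [← sub_nonneg]
  -- The difference of the two sides is ‖μ a + ρ b‖²/(2μ).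
  have e2 : (ρ + μ) / 2 * ‖a‖ ^ 2 + ρ / μ * ((ρ + μ) / 2 * ‖b‖ ^ 2) -
      ρ / 2 * (‖a‖ ^ 2 - 2 * ⟪a, b⟫_ℝ + ‖b‖ ^ 2) =
      (μ ^ 2 * ‖a‖ ^ 2 + 2 * (ρ * (μ * ⟪a, b⟫_ℝ)) + ρ ^ 2 * ‖b‖ ^ 2) / (2 * μ) := by
    field_simp; ring
  rw [e2]
  exact div_nonneg (by linarith) (by positivity)

end EstimateSequence

namespace Problem

/-! ### Inexact proximal steps and moving centers -/

section Proximal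

variable {d k n : ℕ} [NeZero n] {Q : Problem d k n}

/-- Lower bound on the objective that follows from an approximate solution of the regularized
problem. -/
theorem primalR_add_le (hQ : Q.Regular) (hκ : 0 ≤ Q.kappa) {y w : Vec d} (hw : Q.g w ≠ ⊤)
    {α : Fin n → Vec k} (hα : Q.Feasible α) {z : Vec d} (hz : Q.g z ≠ ⊤) :
    Q.primalR w + (Q.mu / 2 * ‖z - y‖ ^ 2 + Q.rho * ⟪y - w, z - y⟫_ℝ +
      (Q.rho + Q.kappa) / 2 * ‖y - w‖ ^ 2 -
        (1 + Q.rho / Q.mu) * (Q.regularized y).gapR w α) ≤ Q.primalR z := by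
  have hQr := hQ.regularized hκ y
  have hl := hQ.lam_pos
  have hμ : 0 < Q.mu := half_pos hl
  have hρ : Q.rho = Q.mu + Q.kappa := rfl
  have hiff := regularized_g_ne_top_iff hQ hκ y
  obtain ⟨x₀, hx₀, hmin⟩ := hQr.exists_primal_min
  have hlam : (Q.regularized y).lam = Q.rho + Q.mu := by
    change Q.lam + Q.kappa = Q.mu + Q.kappa + Q.mu
    rw [mu]; ring
  have hw1 := hmin w ((hiff w).2 hw)
  have hz1 := hmin z ((hiff z).2 hz)
  have hd : (Q.regularized y).primalR w ≤
      (Q.regularized y).primalR x₀ + (Q.regularized y).gapR w α := by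
    have := hQr.gapR_nonneg hx₀ (α := α) hα
    rw [gapR] at *
    linarith
  rw [hlam] at hw1 hz1
  -- Of the curvature λ + κ = ρ + μ of the regularized objective, μ is given up in order to replace
  -- the unknown minimizer `x₀` by `w`, at the price of ρ/μ times the gap.
  have hgr := quadratic_growth_of_approx hμ (show 0 ≤ Q.rho by rw [hρ]; positivity) (z := z)
    (w := w) (x₀ := x₀) (e := (Q.regularized y).gapR w α) (by linarith)
  rw [regularized_primalR hQ hκ y hz] at hz1
  rw [regularized_primalR hQ hκ y hw] at hd
  have e1 : z - w = (z - y) + (y - w) := by abel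
  have hzn : ‖z‖ ^ 2 / 2 - ⟪z, y⟫_ℝ = ‖z - y‖ ^ 2 / 2 - ‖y‖ ^ 2 / 2 := by
    rw [norm_sub_sq_real]; ring
  have hwn : ‖w‖ ^ 2 / 2 - ⟪w, y⟫_ℝ = ‖y - w‖ ^ 2 / 2 - ‖y‖ ^ 2 / 2 := by
    rw [norm_sub_rev, norm_sub_sq_real]; ring
  rw [e1, norm_add_sq_real, real_inner_comm] at hgr
  have hzn' := congrArg (Q.kappa * ·) hzn
  have hwn' := congrArg (Q.kappa * ·) hwn
  rw [hρ] at hgr hz1 ⊢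
  linarith

/-- The duality gap of the regularized problem depends continuously on its center. -/
theorem regularized_gapR_le (hQ : Q.Regular) (hκ : 0 ≤ Q.kappa) (y y' : Vec d) {w : Vec d}
    (hw : Q.g w ≠ ⊤) {α : Fin n → Vec k} (hα : Q.Feasible α) :
    (Q.regularized y).gapR w α ≤
      2 * (Q.regularized y').gapR w α + Q.kappa * ‖y - y'‖ ^ 2 := by
  have hl := hQ.lam_pos
  have hL : 0 < Q.lam + Q.kappa := by positivity
  have hQ1 := hQ.regularized hκ y'
  have hQ2 := hQ.regularized hκ y
  obtain ⟨hw2, -, hc2, -⟩ := hQ2.g_strong.conj_gradient ((Q.regularized y).v α)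
  obtain ⟨hw1, hmin1, hc1, -⟩ := hQ1.g_strong.conj_gradient ((Q.regularized y').v α)
  have hle := hQ1.le_gapR ((regularized_g_ne_top_iff hQ hκ y' w).2 hw) (α := α) hα
  have hgap1 := hQ1.gapR_eq w α
  have hgap2 := hQ2.gapR_eq w α
  rw [← wOf] at hw2 hc2 hw1 hmin1 hc1
  set w₂ := (Q.regularized y).wOf α
  set w₁ := (Q.regularized y').wOf α
  rw [regularized_g_ne_top_iff hQ hκ] at hw1 hw2
  have hmin := hmin1 w₂ ((regularized_g_ne_top_iff hQ hκ y' w₂).2 hw2)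
  have hloss : ∀ i, (Q.regularized y).lossGap w α i = (Q.regularized y').lossGap w α i :=
    fun i => rfl
  have hv : (Q.regularized y).v α = (Q.regularized y').v α := rfl
  have hlam : (Q.regularized y).lam = Q.lam + Q.kappa := rfl
  have hlam' : (Q.regularized y').lam = Q.lam + Q.kappa := rfl
  set s := Q.kappa / (Q.lam + Q.kappa) with hs
  -- Moving the center only tilts the regularizer by a linear function; v(α) and the loss gaps stay
  -- the same.
  have hdiff : ∀ x, Q.g x ≠ ⊤ → ((Q.regularized y).g x).toReal =
      ((Q.regularized y').g x).toReal - s * ⟪x, y - y'⟫_ℝ := by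
    intro x hx
    rw [regularized_g_toReal hQ y hx, regularized_g_toReal hQ y' hx, inner_sub_right]
    ring
  rw [hc2, hdiff w hw, hdiff w₂ hw2, hv, hlam] at hgap2
  rw [hc1, hlam'] at hgap1
  rw [Finset.sum_congr rfl fun i _ => hloss i] at hgap2
  rw [hlam'] at hle
  have hLs : (Q.lam + Q.kappa) * s = Q.kappa := by rw [hs]; field_simp
  have hs0 : 0 ≤ s := by positivity
  have hs1 : s ≤ 1 := by rw [hs, div_le_one hL]; linarith
  rw [inner_sub_right] at hmin
  -- Young's inequality twice: ‖w₂ - w₁‖² is absorbed by strong convexity at `w₁`, and ‖w - w₁‖² by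
  -- `Regular.le_gapR`, which costs the second copy of the gap.
  have y1 := sq_nonneg ‖(w₂ - w₁) - s • (y - y')‖
  have y2 := sq_nonneg ‖(w - w₁) + s • (y - y')‖
  rw [norm_sub_sq_real, inner_smul_right, norm_smul, mul_pow, Real.norm_eq_abs, sq_abs,
    inner_sub_left] at y1
  rw [norm_add_sq_real, inner_smul_right, norm_smul, mul_pow, Real.norm_eq_abs, sq_abs,
    inner_sub_left] at y2
  have hkey : s * ⟪w₂, y - y'⟫_ℝ - s * ⟪w, y - y'⟫_ℝ ≤ 1 / 2 * ‖w₂ - w₁‖ ^ 2 +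
      1 / 2 * ‖w - w₁‖ ^ 2 + s * (s * ‖y - y'‖ ^ 2) := by linarith
  have hkey2 : s * (s * ‖y - y'‖ ^ 2) ≤ s * ‖y - y'‖ ^ 2 :=
    mul_le_mul_of_nonneg_left (mul_le_of_le_one_left (sq_nonneg _) hs1) hs0
  have h1 := mul_le_mul_of_nonneg_left (add_le_add (hkey.trans (add_le_add_right hkey2 _)) hmin)
    hL.le
  have e : (Q.lam + Q.kappa) * (s * ‖y - y'‖ ^ 2) = Q.kappa * ‖y - y'‖ ^ 2 := by
    rw [← mul_assoc, hLs]
  linarith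

/-- With center 0 the added term (κ/2)‖·‖² vanishes at w = 0 and can only lower the conjugate term.
Hence P(0) - D(0) can start the estimate sequence. -/
theorem regularized_gapR_zero_le (hQ : Q.Regular) (hκ : 0 ≤ Q.kappa) (h0 : Q.g 0 ≠ ⊤) :
    (Q.regularized 0).gapR 0 0 ≤ Q.gapR 0 0 := by
  have hl := hQ.lam_pos
  have hL : 0 < Q.lam + Q.kappa := by positivity
  have hQr := hQ.regularized hκ 0
  obtain ⟨hw2, -, hc2, -⟩ := hQr.g_strong.conj_gradient ((Q.regularized 0).v 0)
  obtain ⟨hw1, hmin, hc1, -⟩ := hQ.g_strong.conj_gradient (Q.v 0)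
  rw [← wOf] at hw2 hc2 hw1 hmin hc1
  set w₂ := (Q.regularized 0).wOf 0
  rw [regularized_g_ne_top_iff hQ hκ] at hw2
  have hv : Q.v 0 = 0 := by simp [v]
  have hv' : (Q.regularized 0).v 0 = 0 := by simp [v]
  have hm := hmin w₂ hw2
  have hlam : (Q.regularized 0).lam = Q.lam + Q.kappa := rfl
  have hloss : ∀ i, (Q.regularized 0).lossGap 0 0 i = Q.lossGap 0 0 i := fun i => rfl
  rw [hQr.gapR_eq, hQ.gapR_eq, hc2, hc1, hv, hv', hlam, Finset.sum_congr rfl fun i _ => hloss i,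
    regularized_g_toReal hQ 0 h0, regularized_g_toReal hQ 0 hw2]
  rw [hv] at hm
  simp only [inner_zero_left, inner_zero_right, norm_zero] at hm ⊢
  have hm' := mul_le_mul_of_nonneg_left hm hl.le
  have h2 : 0 ≤ Q.lam * (1 / 2 * ‖w₂ - Q.wOf 0‖ ^ 2) := by positivity
  have h3 : 0 ≤ Q.kappa * ‖w₂‖ ^ 2 := by positivity
  have e : (Q.lam + Q.kappa) * (Q.lam / (Q.lam + Q.kappa) * (Q.g 0).toReal +
      Q.kappa / (Q.lam + Q.kappa) * (0 ^ 2 / 2 - 0) +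
      (0 - (Q.lam / (Q.lam + Q.kappa) * (Q.g w₂).toReal +
        Q.kappa / (Q.lam + Q.kappa) * (‖w₂‖ ^ 2 / 2 - 0))) - 0) =
      Q.lam * (Q.g 0).toReal - Q.lam * (Q.g w₂).toReal - Q.kappa * ‖w₂‖ ^ 2 / 2 := by
    field_simp
    ring
  rw [e]
  linarith

end Proximal

/-! ### The parameters of the accelerated method -/

section Parameters

variable {d k n : ℕ} {Q : Problem d k n}

/-- The condition number `R² / (λ γ n)`. -/
noncomputable def condNum (Q : Problem d k n) : ℝ := Q.R ^ 2 / (Q.lam * Q.gam * n)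

theorem Assumptions.regular (hA : Q.Assumptions) : Q.Regular :=
  ⟨hA.lam_pos, hA.gam_pos, hA.norm_def, hA.φ_convex, hA.φ_smooth, hA.g_strong, hA.X_bound⟩

theorem Assumptions.ten_lt_condNum (hA : Q.Assumptions) : 10 < Q.condNum := by
  have hn : (0 : ℝ) < n := by exact_mod_cast hA.n_pos
  rw [condNum, ← div_div, lt_div_iff₀ hn]
  exact hA.cond

theorem lam_add_kappa (Q : Problem d k n) :
    Q.lam + Q.kappa = Q.R ^ 2 / (Q.gam * n) := by
  rw [kappa]; ring

theorem Assumptions.kappa_eq (hA : Q.Assumptions) : Q.kappa = Q.lam * (Q.condNum - 1) := by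
  have hn : (0 : ℝ) < n := by exact_mod_cast hA.n_pos
  have h1 := hA.lam_pos
  have h2 := hA.gam_pos
  rw [kappa, condNum]
  field_simp

theorem Assumptions.kappa_pos (hA : Q.Assumptions) : 0 < Q.kappa := by
  rw [hA.kappa_eq]
  exact mul_pos hA.lam_pos (by linarith [hA.ten_lt_condNum])

theorem Assumptions.mu_pos (hA : Q.Assumptions) : 0 < Q.mu := half_pos hA.lam_pos

theorem Assumptions.rho_div_mu (hA : Q.Assumptions) : Q.rho / Q.mu = 2 * Q.condNum - 1 := by
  have h1 := hA.lam_pos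
  rw [rho, hA.kappa_eq, mu]
  field_simp
  ring

theorem Assumptions.eta_sq (hA : Q.Assumptions) : Q.eta ^ 2 = Q.mu / Q.rho := by
  have := hA.mu_pos
  have := hA.kappa_pos
  rw [eta, Real.sq_sqrt (by rw [rho]; positivity)]

theorem Assumptions.inv_eta_sq (hA : Q.Assumptions) : (Q.eta ^ 2)⁻¹ = 2 * Q.condNum - 1 := by
  rw [hA.eta_sq, inv_div, hA.rho_div_mu]

theorem Assumptions.eta_pos (hA : Q.Assumptions) : 0 < Q.eta := by
  have := hA.mu_pos
  have := hA.kappa_pos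
  exact Real.sqrt_pos.2 (by rw [rho]; positivity)

theorem Assumptions.eta_le_one (hA : Q.Assumptions) : Q.eta ≤ 1 := by
  have h1 := hA.mu_pos
  have h2 := hA.kappa_pos
  rw [eta, Real.sqrt_le_one, rho, div_le_one (by positivity)]
  linarith

theorem Assumptions.eta_sq_mul_rho (hA : Q.Assumptions) : Q.eta ^ 2 * Q.rho = Q.mu := by
  have h1 := hA.mu_pos
  have h2 := hA.kappa_pos
  rw [hA.eta_sq, div_mul_cancel₀]
  rw [rho]; positivity

theorem xi_succ {t : ℕ} (ht : 1 ≤ t) : Q.xi (t + 1) = (1 - Q.eta / 2) * Q.xi t := by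
  obtain ⟨s, rfl⟩ := Nat.exists_eq_add_of_le' ht
  simp only [xi, Nat.add_sub_cancel]
  rw [pow_succ]; ring

theorem Assumptions.innerAcc_eq (hA : Q.Assumptions) (t : ℕ) :
    (1 + Q.rho / Q.mu) * Q.innerAcc t = Q.eta / 2 * Q.xi t := by
  have h : 1 + Q.rho / Q.mu ≠ 0 := by rw [hA.rho_div_mu]; linarith [hA.ten_lt_condNum]
  have h2 : (Q.eta ^ 2)⁻¹ = Q.rho / Q.mu := by rw [hA.eta_sq, inv_div]
  rw [innerAcc, h2]
  field_simp

theorem Assumptions.g_zero_ne_top (hA : Q.Assumptions) : Q.g 0 ≠ ⊤ :=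
  hA.regular.primal_ne_top_iff.1 hA.primal_zero

theorem Assumptions.xiOne_eq (hA : Q.Assumptions) : Q.xiOne = 2 * Q.condNum * Q.gapZero := by
  rw [xiOne, hA.inv_eta_sq]; ring

theorem Assumptions.two_div_eta_le (hA : Q.Assumptions) :
    2 / Q.eta ≤ √(8 * Q.R ^ 2 / (Q.lam * Q.gam * n)) := by
  have he : 8 * Q.R ^ 2 / (Q.lam * Q.gam * n) = 8 * Q.condNum := by rw [condNum]; ring
  rw [he]
  refine Real.le_sqrt_of_sq_le ?_
  rw [div_pow, div_eq_mul_inv, hA.inv_eta_sq]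
  linarith

/-- This is the purpose of κ: λ + κ = R²/(γn) makes both terms of the rate equal to n. -/
theorem Assumptions.rate_regularized (hA : Q.Assumptions) (y : Vec d) :
    (Q.regularized y).rate = 2 * n := by
  have hn : (0 : ℝ) < n := by exact_mod_cast hA.n_pos
  have h2 := hA.gam_pos
  have hR : 0 < Q.R ^ 2 := by
    have h1 := hA.ten_lt_condNum
    by_contra h
    have : Q.R ^ 2 = 0 := le_antisymm (not_lt.1 h) (sq_nonneg _)
    rw [condNum, this, zero_div] at h1
    linarith
  have hR' : Q.R ≠ 0 := fun h => by simp [h] at hR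
  change n + Q.R ^ 2 / ((Q.lam + Q.kappa) * Q.gam) = 2 * n
  rw [lam_add_kappa]
  field_simp
  ring

theorem Assumptions.one_le_log_condNum (hA : Q.Assumptions) : 1 ≤ Real.log Q.condNum := by
  have h := hA.ten_lt_condNum
  rw [Real.le_log_iff_exp_le (by linarith)]
  linarith [Real.exp_one_lt_d9]

/-- With c = `condNum` > 10, η⁻² = 2c - 1 ≤ c² makes the fifth power cost 5 log c, and 68 ≤ c² costs
2 log c. -/
theorem Assumptions.log_warm_start_le (hA : Q.Assumptions) :
    Real.log (68 * Q.eta⁻¹ ^ 5) ≤ 7 * Real.log Q.condNum := by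
  have h := hA.ten_lt_condNum
  have hη := hA.eta_pos
  have h1 : 2 * Real.log Q.eta⁻¹ ≤ 2 * Real.log Q.condNum := by
    have e1 : 2 * Real.log Q.eta⁻¹ = Real.log (2 * Q.condNum - 1) := by
      rw [← hA.inv_eta_sq, ← inv_pow, Real.log_pow]; norm_num
    have e2 : 2 * Real.log Q.condNum = Real.log (Q.condNum ^ 2) := by
      rw [Real.log_pow]; norm_num
    rw [e1, e2]
    exact Real.log_le_log (by linarith) (by nlinarith)
  have h2 : Real.log 68 ≤ 2 * Real.log Q.condNum := by
    have e2 : 2 * Real.log Q.condNum = Real.log (Q.condNum ^ 2) := by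
      rw [Real.log_pow]; norm_num
    rw [e2]
    exact Real.log_le_log (by norm_num) (by nlinarith)
  rw [Real.log_mul (by norm_num) (by positivity), Real.log_pow]
  push_cast
  linarith

variable [NeZero n]

theorem Assumptions.feasible_zero (hA : Q.Assumptions) : Q.Feasible 0 :=
  hA.regular.dual_ne_bot_iff.1 hA.dual_zero

theorem Assumptions.gapZero_eq (hA : Q.Assumptions) : Q.gapZero = Q.gapR 0 0 := by
  have := hA.regular.gap_eq hA.g_zero_ne_top hA.feasible_zero
  rw [gap] at this
  rw [gapZero, this, EReal.toReal_coe]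

theorem Assumptions.gapZero_nonneg (hA : Q.Assumptions) : 0 ≤ Q.gapZero := by
  rw [hA.gapZero_eq]
  exact hA.regular.gapR_nonneg hA.g_zero_ne_top hA.feasible_zero

theorem Assumptions.xiOne_nonneg (hA : Q.Assumptions) : 0 ≤ Q.xiOne := by
  rw [hA.xiOne_eq]
  have := hA.gapZero_nonneg
  have := hA.ten_lt_condNum
  positivity

theorem Assumptions.xi_nonneg (hA : Q.Assumptions) (t : ℕ) : 0 ≤ Q.xi t :=
  mul_nonneg (pow_nonneg (by linarith [hA.eta_le_one]) _) hA.xiOne_nonneg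

end Parameters

/-! ### Runs of the accelerated method -/

section Run

variable {d k n : ℕ} {Q : Problem d k n}
  {U : Problem d k n → ℕ → (Fin n → Vec k) → Fin n → Vec k} {o : OutputOption} {m : ℕ} {ε : ℝ}
  {T : ℕ} {w : ℕ → Vec d} {α : ℕ → Fin n → Vec k} {e : ℕ → ℝ}

/-- The minimizers of the quadratic lower bounds of the estimate sequence. -/
noncomputable def vOf (Q : Problem d k n) (w : ℕ → Vec d) (t : ℕ) : Vec d :=
  if t ≤ 1 then 0 else w (t - 1) + Q.eta⁻¹ • (w t - w (t - 1))

/-- Extrapolation with β is the same as taking the weighted mean of v and w that `estimate_step`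
asks for. -/
theorem Assumptions.yOf_eq (hA : Q.Assumptions) (hw : w 1 = 0) {t : ℕ} (ht : 1 ≤ t) :
    (1 + Q.eta) • Q.yOf w t = Q.eta • Q.vOf w t + w t := by
  have hη := hA.eta_pos
  rcases ht.eq_or_lt with rfl | h
  · simp [yOf, vOf, hw]
  · rw [yOf, vOf, if_neg (by omega), if_neg (by omega), smul_add, smul_add, smul_smul, smul_smul,
      beta, mul_div_cancel₀ _ (by positivity), mul_inv_cancel₀ hη.ne']
    module

variable [NeZero n]

/-- A gap below a real number forces both returned points to be feasible. The outer analysis uses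
nothing else about a call. -/
theorem Assumptions.call_spec (hA : Q.Assumptions) (h : Q.IsRun U o m ε T w α e) {t : ℕ}
    (ht : 1 ≤ t) (htT : t < T) : Q.g (w (t + 1)) ≠ ⊤ ∧ Q.Feasible (α (t + 1)) ∧
      e (t + 1) = (Q.regularized (Q.yOf w t)).gapR (w (t + 1)) (α (t + 1)) ∧
      e (t + 1) ≤ Q.innerAcc t := by
  obtain ⟨ω, s, ⟨⟨-, -, hgap⟩, -⟩, hcand, he⟩ := h.call t ht htT
  have hr := hA.regular.regularized hA.kappa_pos.le (Q.yOf w t)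
  rw [← hcand] at hgap he
  obtain ⟨h1, h2⟩ := hr.of_gap_ne_top (ne_top_of_le_ne_top (EReal.coe_ne_top _) hgap)
  rw [hr.gap_eq h1 h2] at hgap he
  rw [EReal.toReal_coe] at he
  exact ⟨(regularized_g_ne_top_iff hA.regular hA.kappa_pos.le _ _).1 h1, h2, he,
    he ▸ EReal.coe_le_coe_iff.1 hgap⟩

theorem Assumptions.run_feasible (hA : Q.Assumptions) (h : Q.IsRun U o m ε T w α e) {t : ℕ}
    (ht : 1 ≤ t) (htT : t ≤ T) : Q.g (w t) ≠ ⊤ ∧ Q.Feasible (α t) := by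
  rcases ht.eq_or_lt with rfl | h1
  · rw [h.w_init, h.α_init]
    exact ⟨hA.g_zero_ne_top, hA.feasible_zero⟩
  · obtain ⟨s, rfl⟩ := Nat.exists_eq_add_of_le' ht
    have := hA.call_spec h (t := s) (by omega) (by omega)
    exact ⟨this.1, this.2.1⟩

theorem Assumptions.estimate_sequence (hA : Q.Assumptions) (h : Q.IsRun U o m ε T w α e) {t : ℕ}
    (ht : 1 ≤ t) (htT : t ≤ T) : ∃ H, Q.primalR (w t) ≤ H + Q.xi t ∧
      ∀ z ∈ {z | Q.g z ≠ ⊤}, H + Q.mu / 2 * ‖z - Q.vOf w t‖ ^ 2 ≤ Q.primalR z := by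
  have hκ := hA.kappa_pos.le
  induction t, ht using Nat.le_induction with
  | base =>
    -- The first minorant is that of `primalR_add_le` for y = w = 0 and α = 0, whose error is at
    -- most ξ₁.
    refine ⟨Q.primalR 0 - Q.xiOne, ?_, fun z hz => ?_⟩
    · rw [h.w_init]; simp [xi]
    · have h1 := primalR_add_le hA.regular hκ (y := 0) hA.g_zero_ne_top hA.feasible_zero hz
      have h2 := regularized_gapR_zero_le hA.regular hκ hA.g_zero_ne_top
      rw [← hA.gapZero_eq] at h2
      have h3 : 0 ≤ 1 + Q.rho / Q.mu := by rw [hA.rho_div_mu]; linarith [hA.ten_lt_condNum]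
      have h4 := mul_le_mul_of_nonneg_left h2 h3
      have h5 : Q.xiOne = (1 + Q.rho / Q.mu) * Q.gapZero := by
        rw [hA.xiOne_eq, hA.rho_div_mu]; ring
      simp only [vOf, le_refl, if_true, sub_zero, inner_zero_left, norm_zero] at h1 ⊢
      rw [h5]
      linarith
  | succ t ht ih =>
    obtain ⟨H, hPw, hH⟩ := ih (by omega)
    obtain ⟨hg, hf, he, hacc⟩ := hA.call_spec h ht (by omega)
    have hvt : Q.vOf w (t + 1) = w t + Q.eta⁻¹ • (w (t + 1) - w t) := by
      rw [vOf, if_neg (by omega), Nat.add_sub_cancel]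
    obtain ⟨H', h1, h2⟩ := estimate_step (P := Q.primalR) (S := {z | Q.g z ≠ ⊤}) (w' := w (t + 1))
      (e := (1 + Q.rho / Q.mu) * (Q.regularized (Q.yOf w t)).gapR (w (t + 1)) (α (t + 1)))
      hA.mu_pos.le hκ hA.eta_pos hA.eta_le_one hA.eta_sq_mul_rho
      (hA.run_feasible h ht (by omega)).1 (hA.yOf_eq h.w_init ht) hPw hH
      fun z hz => primalR_add_le hA.regular hκ hg hf hz
    refine ⟨H', h1.trans ?_, by rwa [hvt]⟩
    -- The accuracy of the call is calibrated so that its error is at most (η/2)ξ_t, and (1 - η)ξ_t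
    -- + (η/2)ξ_t = ξ_{t+1}.
    rw [← he, xi_succ ht]
    have h3 : 0 ≤ 1 + Q.rho / Q.mu := by rw [hA.rho_div_mu]; linarith [hA.ten_lt_condNum]
    have h4 := mul_le_mul_of_nonneg_left hacc h3
    rw [hA.innerAcc_eq] at h4
    linarith

theorem Assumptions.run_error_le (hA : Q.Assumptions) (h : Q.IsRun U o m ε T w α e) {t : ℕ}
    (ht : 1 ≤ t) (htT : t ≤ T) {z : Vec d} (hz : Q.g z ≠ ⊤) :
    Q.primalR (w t) + Q.mu / 2 * ‖z - Q.vOf w t‖ ^ 2 ≤ Q.primalR z + Q.xi t := by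
  obtain ⟨H, h1, h2⟩ := hA.estimate_sequence h ht htT
  linarith [h2 z hz]

/-- The estimate sequence and strong convexity of P bound (μ/2)‖v - z‖² + (λ/2)‖w - z‖² by ξ_t, and
y is a convex combination of v and w. -/
theorem Assumptions.norm_yOf_sub_le (hA : Q.Assumptions) (h : Q.IsRun U o m ε T w α e) {t : ℕ}
    (ht : 1 ≤ t) (htT : t ≤ T) {z : Vec d} (hz : Q.g z ≠ ⊤)
    (hmin : ∀ x, Q.g x ≠ ⊤ → Q.primalR z + Q.lam / 2 * ‖x - z‖ ^ 2 ≤ Q.primalR x) :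
    Q.mu / 2 * ‖Q.yOf w t - z‖ ^ 2 ≤ Q.xi t := by
  have h1 := hA.run_error_le h ht htT hz
  have h2 := hmin _ (hA.run_feasible h ht htT).1
  have hη := hA.eta_pos
  have hη1 := hA.eta_le_one
  have hy := hA.yOf_eq h.w_init ht
  rw [norm_sub_rev] at h1
  set a := Q.vOf w t - z with ha
  set b := w t - z with hb
  have hab : (1 + Q.eta) • (Q.yOf w t - z) = Q.eta • a + b := by
    rw [smul_sub, hy, ha, hb]; module
  have h3 : (1 + Q.eta) * ‖Q.yOf w t - z‖ ≤ Q.eta * ‖a‖ + ‖b‖ := by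
    have := norm_add_le (Q.eta • a) b
    rwa [← hab, norm_smul, norm_smul, Real.norm_eq_abs, Real.norm_eq_abs, abs_of_pos hη,
      abs_of_pos (by linarith)] at this
  have h4 : ‖Q.yOf w t - z‖ ^ 2 ≤ ‖a‖ ^ 2 + ‖b‖ ^ 2 := by
    set c := ‖Q.yOf w t - z‖
    have hc : 0 ≤ c := norm_nonneg _
    have h5 : ((1 + Q.eta) * c) ^ 2 ≤ (Q.eta * ‖a‖ + ‖b‖) ^ 2 := by gcongr
    have h6 : (Q.eta * ‖a‖ + ‖b‖) ^ 2 ≤ (1 + Q.eta) ^ 2 * (‖a‖ ^ 2 + ‖b‖ ^ 2) := by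
      nlinarith [sq_nonneg (‖a‖ - Q.eta * ‖b‖), sq_nonneg ‖a‖, sq_nonneg ‖b‖,
        mul_nonneg hη.le (sq_nonneg ‖a‖), mul_nonneg hη.le (sq_nonneg ‖b‖)]
    rw [mul_pow] at h5
    exact le_of_mul_le_mul_left (h5.trans h6) (by positivity)
  have h7 := mul_le_mul_of_nonneg_left h4 (half_pos hA.mu_pos).le
  have h8 : Q.mu / 2 * ‖b‖ ^ 2 ≤ Q.lam / 2 * ‖b‖ ^ 2 := by
    have := hA.lam_pos
    rw [mu]
    gcongr
    linarith
  linarith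

/-- The duality gap at which a call starts, compared with the accuracy that it has to reach. -/
theorem Assumptions.warm_start (hA : Q.Assumptions) (h : Q.IsRun U o m ε T w α e) :
    (Q.regularized (Q.yOf w T)).gapR (w T) (α T) ≤ 68 * Q.eta⁻¹ ^ 5 * Q.innerAcc T := by
  have hκ := hA.kappa_pos.le
  have hη := hA.eta_pos
  have hη1 := hA.eta_le_one
  have hr : 0 < 1 + Q.rho / Q.mu := by rw [hA.rho_div_mu]; linarith [hA.ten_lt_condNum]
  have hi1 : 1 ≤ Q.eta⁻¹ := (one_le_inv₀ hη).2 hη1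
  have hηi : Q.eta * Q.eta⁻¹ = 1 := mul_inv_cancel₀ hη.ne'
  have hρμ : Q.rho / Q.mu = Q.eta⁻¹ ^ 2 := by rw [inv_pow, hA.eta_sq, inv_div]
  have hacc := hA.innerAcc_eq T
  rw [hρμ] at hacc hr
  set i := Q.eta⁻¹ with hi
  have hxi : Q.xi T = 2 * i * ((1 + i ^ 2) * Q.innerAcc T) := by
    rw [hacc]; linear_combination (-Q.xi T) * hηi
  have hacc0 : 0 ≤ Q.innerAcc T := by
    have := mul_nonneg (half_pos hη).le (hA.xi_nonneg T)
    rw [← hacc] at this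
    exact nonneg_of_mul_nonneg_right this hr
  have hp2 : (1 : ℝ) ≤ i ^ 2 := one_le_pow₀ hi1
  have hp3 : i ^ 3 ≤ i ^ 5 := pow_le_pow_right₀ hi1 (by norm_num)
  have hp1 : i ≤ i ^ 5 := le_self_pow₀ hi1 (by norm_num)
  have hp0 : 1 ≤ i ^ 5 := one_le_pow₀ hi1
  rcases h.one_le.eq_or_lt with rfl | hT
  · have h1 := regularized_gapR_zero_le hA.regular hκ hA.g_zero_ne_top
    have hy : Q.yOf w 1 = 0 := by simp [yOf]
    rw [h.w_init, h.α_init, hy]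
    refine h1.trans ?_
    have hx1 : Q.xi 1 = (1 + i ^ 2) * Q.gapZero := by
      simp only [xi, Nat.sub_self, pow_zero, one_mul, xiOne]
      rw [hi, inv_pow]
    rw [← hA.gapZero_eq]
    have h2 : Q.gapZero = 2 * i * Q.innerAcc 1 := by
      rw [hx1] at hxi
      have : (1 + i ^ 2) * Q.gapZero = (1 + i ^ 2) * (2 * i * Q.innerAcc 1) := by
        rw [hxi]; ring
      exact mul_left_cancel₀ hr.ne' this
    rw [h2]
    exact mul_le_mul_of_nonneg_right (by linarith) hacc0
  · obtain ⟨t, rfl⟩ := Nat.exists_eq_add_of_le' hT.le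
    have ht : 1 ≤ t := by omega
    obtain ⟨hg, hf, he, hle⟩ := hA.call_spec h ht (Nat.lt_succ_self t)
    have h1 := regularized_gapR_le hA.regular hκ (Q.yOf w (t + 1)) (Q.yOf w t) hg hf
    rw [← he] at h1
    obtain ⟨z, hz, hmin⟩ := hA.regular.exists_primal_min
    have hy1 := hA.norm_yOf_sub_le h (t := t + 1) (by omega) le_rfl hz hmin
    have hy0 := hA.norm_yOf_sub_le h ht (Nat.le_succ t) hz hmin
    have hxt := xi_succ (Q := Q) ht
    have hxi0 := hA.xi_nonneg t
    have hxhalf : Q.xi t ≤ 2 * Q.xi (t + 1) := by rw [hxt]; nlinarith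
    have hin : Q.innerAcc t ≤ 2 * Q.innerAcc (t + 1) := by
      rw [innerAcc, innerAcc]
      have : 0 ≤ Q.eta / (2 * (1 + (Q.eta ^ 2)⁻¹)) := by positivity
      nlinarith [mul_le_mul_of_nonneg_left hxhalf this]
    have hyy : ‖Q.yOf w (t + 1) - Q.yOf w t‖ ^ 2 ≤
        2 * ‖Q.yOf w (t + 1) - z‖ ^ 2 + 2 * ‖Q.yOf w t - z‖ ^ 2 := by
      have e1 : Q.yOf w (t + 1) - Q.yOf w t = (Q.yOf w (t + 1) - z) - (Q.yOf w t - z) := by abel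
      rw [e1, norm_sub_sq_real]
      have := sq_nonneg ‖(Q.yOf w (t + 1) - z) + (Q.yOf w t - z)‖
      rw [norm_add_sq_real] at this
      linarith
    have hκμ : Q.kappa ≤ i ^ 2 * Q.mu := by
      have := hA.mu_pos
      rw [← hρμ, div_mul_cancel₀ _ this.ne', rho]
      linarith
    -- Going through the minimizer `z` gives 4ξ_{t+1} + 4ξ_t, and ξ_t ≤ 2ξ_{t+1}.
    have hδ : Q.kappa * ‖Q.yOf w (t + 1) - Q.yOf w t‖ ^ 2 ≤ 12 * (i ^ 2 * Q.xi (t + 1)) := by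
      have hm := hA.mu_pos
      calc _ ≤ (i ^ 2 * Q.mu) * (2 * ‖Q.yOf w (t + 1) - z‖ ^ 2 + 2 * ‖Q.yOf w t - z‖ ^ 2) := by
            gcongr
        _ = i ^ 2 * (4 * (Q.mu / 2 * ‖Q.yOf w (t + 1) - z‖ ^ 2) +
            4 * (Q.mu / 2 * ‖Q.yOf w t - z‖ ^ 2)) := by ring
        _ ≤ i ^ 2 * (4 * Q.xi (t + 1) + 4 * (2 * Q.xi (t + 1))) :=
            mul_le_mul_of_nonneg_left (by linarith) (by positivity)
        _ = _ := by ring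
    have hfin : i ^ 2 * Q.xi (t + 1) ≤ 4 * (i ^ 5 * Q.innerAcc (t + 1)) := by
      rw [hxi]
      have : i ^ 3 * (1 + i ^ 2) ≤ 2 * i ^ 5 := by nlinarith
      nlinarith [mul_le_mul_of_nonneg_right this hacc0]
    -- In total 2 · 2 from the previous accuracy and 12 · 4 from the motion of the center, which is
    -- within 68.
    have hlast := mul_le_mul_of_nonneg_right hp0 hacc0
    have hnn : 0 ≤ i ^ 5 * Q.innerAcc (t + 1) := by positivity
    nlinarith

end Run

/-! ### Correctness and runtime -/

section Main

variable {d k n : ℕ} [NeZero n] {Q : Problem d k n}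
  {U : Problem d k n → ℕ → (Fin n → Vec k) → Fin n → Vec k} {o : OutputOption} {m : ℕ} {ε : ℝ}
  {T : ℕ} {w : ℕ → Vec d} {α : ℕ → Fin n → Vec k} {e : ℕ → ℝ}

theorem Assumptions.xi_le (hA : Q.Assumptions) (hε : 0 < ε) {t : ℕ} (ht : 1 ≤ t)
    (h : 1 + 2 / Q.eta * Real.log (Q.xiOne / ε) ≤ t) : Q.xi t ≤ ε := by
  have hη := hA.eta_pos
  have hη1 := hA.eta_le_one
  rcases hA.xiOne_nonneg.eq_or_lt with h0 | h0
  · rw [xi, ← h0, mul_zero]; exact hε.le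
  have h1 : (1 - Q.eta / 2) ^ (t - 1) ≤ Real.exp (-Real.log (Q.xiOne / ε)) := by
    have h2 : 1 - Q.eta / 2 ≤ Real.exp (-(Q.eta / 2)) := Real.one_sub_le_exp_neg _
    have h3 : 0 ≤ 1 - Q.eta / 2 := by linarith
    calc (1 - Q.eta / 2) ^ (t - 1) ≤ Real.exp (-(Q.eta / 2)) ^ (t - 1) := by gcongr
      _ = Real.exp ((t - 1 : ℕ) * -(Q.eta / 2)) := (Real.exp_nat_mul _ _).symm
      _ ≤ _ := by
        refine Real.exp_le_exp.2 ?_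
        rw [mul_neg, neg_le_neg_iff, Nat.cast_sub ht, Nat.cast_one]
        have h4 : 2 / Q.eta * Real.log (Q.xiOne / ε) ≤ (t : ℝ) - 1 := by linarith
        have h5 := mul_le_mul_of_nonneg_right h4 (half_pos hη).le
        have e1 : 2 / Q.eta * Real.log (Q.xiOne / ε) * (Q.eta / 2) = Real.log (Q.xiOne / ε) := by
          field_simp
        linarith
  rw [Real.exp_neg, Real.exp_log (by positivity), inv_div] at h1
  calc Q.xi t ≤ ε / Q.xiOne * Q.xiOne := mul_le_mul_of_nonneg_right h1 h0.le
    _ = ε := div_mul_cancel₀ _ h0.ne'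

theorem Assumptions.primalR_le_of_terminates (hA : Q.Assumptions) (hε : 0 < ε)
    (h : Q.TerminatesAt U o m ε T w α e) {z : Vec d} (hz : Q.g z ≠ ⊤) :
    Q.primalR (w T) ≤ Q.primalR z + ε := by
  obtain ⟨hrun, hT, hterm | hterm⟩ := h
  · have h1 := hA.run_error_le hrun hrun.one_le le_rfl hz
    have h2 := hA.xi_le hε hrun.one_le hterm
    have h3 : 0 ≤ Q.mu / 2 * ‖z - Q.vOf w T‖ ^ 2 := by have := hA.mu_pos; positivity
    linarith
  -- Second stopping condition: only the minorant of the last call is used, minimized over all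
  -- points.
  · obtain ⟨t, rfl⟩ := Nat.exists_eq_add_of_le' hrun.one_le
    obtain ⟨hg, hf, he, -⟩ := hA.call_spec hrun (t := t) (by omega) (Nat.lt_succ_self t)
    have h1 := primalR_add_le hA.regular hA.kappa_pos.le (y := Q.yOf w t) hg hf hz
    have h2 := neg_le_quadratic hA.mu_pos hA.kappa_pos.le (show Q.rho = Q.mu + Q.kappa from rfl)
      (z - Q.yOf w t) (Q.yOf w t - w (t + 1))
    rw [← he] at h1
    rw [Nat.add_sub_cancel, norm_sub_rev] at hterm
    linarith

/-- The expected number of inner iterations of one outer iteration. -/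
theorem Assumptions.lintegral_numIter_le (hA : Q.Assumptions) (hm : 0 < m) (hmn : m ≤ n)
    (hU : ∀ (y : Vec d) (t : ℕ) (α : Fin n → Vec k) (i : Fin n),
      (Q.regularized y).IsUpdate α i (U (Q.regularized y) t α i))
    (h : Q.IsRun U o m ε T w α e) :
    ∫⁻ ω, (Q.regularized (Q.yOf w T)).numIter (U (Q.regularized (Q.yOf w T))) o m
        (Q.innerAcc T) (α T) ω ∂(Q.regularized (Q.yOf w T)).drawMeasure ≤
      ENNReal.ofReal (22 * n * Real.log Q.condNum) := by
  have hη := hA.eta_pos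
  have hκ := hA.kappa_pos.le
  have hQr := hA.regular.regularized hκ (Q.yOf w T)
  obtain ⟨hg, hf⟩ := hA.run_feasible h h.one_le le_rfl
  obtain ⟨z, hz, hmin⟩ := hQr.exists_primal_min
  have hc : IsLeast ((Q.regularized (Q.yOf w T)).primalR ''
      {x | (Q.regularized (Q.yOf w T)).g x ≠ ⊤}) ((Q.regularized (Q.yOf w T)).primalR z) := by
    refine ⟨⟨z, hz, rfl⟩, ?_⟩
    rintro _ ⟨x, hx, rfl⟩
    have h1 := hmin x hx
    have h2 : 0 ≤ (Q.regularized (Q.yOf w T)).lam / 2 * ‖x - z‖ ^ 2 := by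
      have := hQr.lam_pos
      positivity
    linarith
  have hacc : 0 ≤ Q.innerAcc T := mul_nonneg (by positivity) (hA.xi_nonneg T)
  have hi1 : 1 ≤ Q.eta⁻¹ := (one_le_inv₀ hη).2 hA.eta_le_one
  have hK : 1 ≤ 68 * Q.eta⁻¹ ^ 5 := by linarith [one_le_pow₀ hi1 (n := 5)]
  have hδ : (Q.regularized (Q.yOf w T)).primalR z - (Q.regularized (Q.yOf w T)).dualR (α T) ≤
      68 * Q.eta⁻¹ ^ 5 * Q.innerAcc T := by
    refine le_trans ?_ (hA.warm_start h)
    rw [gapR]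
    exact sub_le_sub_right (hc.2 ⟨w T, (regularized_g_ne_top_iff hA.regular hκ _ _).2 hg, rfl⟩) _
  refine (hQr.lintegral_numIter_le (hU _) hf hc o hm hacc hK hδ).trans
    (ENNReal.ofReal_le_ofReal ?_)
  rw [hA.rate_regularized]
  have hn : (1 : ℝ) ≤ n := by exact_mod_cast NeZero.one_le
  have hmn' : (m : ℝ) ≤ n := by exact_mod_cast hmn
  have hL := hA.one_le_log_condNum
  -- With c = `condNum`, the bound 4n + 2 + 2m + 2n · 7 log c is at most 22 n log c, because 1 ≤ n,
  -- m ≤ n and 1 ≤ log c.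
  have h1 := mul_le_mul_of_nonneg_left hA.log_warm_start_le (show (0 : ℝ) ≤ 2 * n by linarith)
  have h2 := mul_le_mul_of_nonneg_left hL (show (0 : ℝ) ≤ n by linarith)
  linarith

/-- The expected running time of one outer iteration. -/
theorem Assumptions.lintegral_runtime_le (hA : Q.Assumptions) (hm : m = n)
    (hU : ∀ (y : Vec d) (t : ℕ) (α : Fin n → Vec k) (i : Fin n),
      (Q.regularized y).IsUpdate α i (U (Q.regularized y) t α i))
    (h : Q.IsRun U o m ε T w α e) :
    ∫⁻ ω, (Q.regularized (Q.yOf w T)).runtime (U (Q.regularized (Q.yOf w T))) o m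
        (Q.innerAcc T) (α T) ω ∂(Q.regularized (Q.yOf w T)).drawMeasure ≤
      ENNReal.ofReal (45 * d * n * Real.log Q.condNum) := by
  have hm0 : 0 < m := hm ▸ NeZero.pos n
  have hN := hA.lintegral_numIter_le hm0 hm.le hU h
  have hL := hA.one_le_log_condNum
  -- With one test per n iterations the tests cost as much as the iterations. Together with the
  -- initialization this gives 2 · 22 + 1 = 45.
  have hrt : ∀ ω, (Q.regularized (Q.yOf w T)).runtime (U (Q.regularized (Q.yOf w T))) o m
      (Q.innerAcc T) (α T) ω = (d * n : ℝ≥0∞) + (2 * d : ℝ≥0∞) *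
        (Q.regularized (Q.yOf w T)).numIter (U (Q.regularized (Q.yOf w T))) o m
          (Q.innerAcc T) (α T) ω := by
    intro ω
    rw [runtime, hm, mul_assoc (d : ℝ≥0∞) n, ENNReal.mul_div_cancel
      (by exact_mod_cast NeZero.ne n) (ENNReal.natCast_ne_top n)]
    ring
  simp only [hrt]
  rw [lintegral_add_left measurable_const, lintegral_const, measure_univ, mul_one,
    lintegral_const_mul' _ _ (ENNReal.mul_ne_top (by norm_num) (ENNReal.natCast_ne_top d))]
  calc (d * n : ℝ≥0∞) + 2 * d * _
      ≤ d * n + 2 * d * ENNReal.ofReal (22 * n * Real.log Q.condNum) := by gcongr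
    _ = ENNReal.ofReal (d * n + 2 * d * (22 * n * Real.log Q.condNum)) := by
        rw [ENNReal.ofReal_add (by positivity) (by positivity), ENNReal.ofReal_mul (by positivity),
          ENNReal.ofReal_mul (by positivity), ENNReal.ofReal_mul (by positivity),
          ENNReal.ofReal_natCast, ENNReal.ofReal_natCast]
        norm_num
    _ ≤ _ := by
        refine ENNReal.ofReal_le_ofReal ?_
        have := mul_le_mul_of_nonneg_left hL (show (0 : ℝ) ≤ d * n by positivity)
        linarith

theorem Assumptions.outer_bound (hA : Q.Assumptions) (hε : 0 < ε) (h : ε ≤ Q.xiOne) :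
    1 + 2 / Q.eta * Real.log (Q.xiOne / ε) ≤
      1 + √(8 * Q.R ^ 2 / (Q.lam * Q.gam * n)) *
        (Real.log (2 * Q.R ^ 2 / (Q.lam * Q.gam * n)) + Real.log (Q.gapZero / ε)) := by
  have hr := hA.ten_lt_condNum
  have he : 2 * Q.R ^ 2 / (Q.lam * Q.gam * n) = 2 * Q.condNum := by rw [condNum]; ring
  have hx := hA.xiOne_eq
  -- ξ₁ ≥ ε > 0 forces a positive initial gap, so the two logarithms merge into log(ξ₁/ε).
  have hg : 0 < Q.gapZero := by
    refine hA.gapZero_nonneg.lt_of_ne fun h0 => ?_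
    rw [← h0, mul_zero] at hx
    linarith
  rw [he, ← Real.log_mul (by positivity) (by positivity), ← mul_div_assoc, ← hx]
  gcongr
  · exact Real.log_nonneg ((one_le_div hε).2 h)
  · exact hA.two_div_eta_le

end Main

end Problem

end ProxSDCA

/-! ### The theorem, with absolute constant 45 -/

theorem mainTheorem1 :
    ∃ C : ℝ, 0 < C ∧
      ∀ (d k n : ℕ) [NeZero n] (Q : ProxSDCA.Problem d k n), Q.Assumptions →
      ∀ (ε : ℝ), 0 < ε →
      ∀ (o : ProxSDCA.OutputOption) (m : ℕ), 0 < m →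
      ∀ U : ProxSDCA.Problem d k n → ℕ → (Fin n → ProxSDCA.Vec k) → Fin n → ProxSDCA.Vec k,
      (∀ (y : ProxSDCA.Vec d) (t : ℕ) (α : Fin n → ProxSDCA.Vec k) (i : Fin n),
        (Q.regularized y).IsUpdate α i (U (Q.regularized y) t α i)) →
      -- correctness
      (∃ wstar : ProxSDCA.Vec d, (∀ w, w ≠ wstar → Q.primal wstar < Q.primal w) ∧
        ∀ T w α e, Q.TerminatesAt U o m ε T w α e →
          Q.primal (w T) ≤ Q.primal wstar + (ε : EReal)) ∧
      -- number of outer iterations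
      (ε ≤ Q.xiOne →
        (∀ T w α e, Q.GoesOn U o m ε T w α e →
          (T : ℝ) ≤ 1 + 2 / Q.eta * Real.log (Q.xiOne / ε)) ∧
        1 + 2 / Q.eta * Real.log (Q.xiOne / ε) ≤
          1 + √(8 * Q.R ^ 2 / (Q.lam * Q.gam * n)) *
            (Real.log (2 * Q.R ^ 2 / (Q.lam * Q.gam * n)) + Real.log (Q.gapZero / ε))) ∧
      (Q.xiOne < ε → ∀ T w α e, Q.GoesOn U o m ε T w α e → T = 1) ∧
      -- expected cost of the call of Prox-SDCA in iteration `T + 1`, given the past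
      (∀ T w α e, Q.GoesOn U o m ε T w α e →
        (m ≤ n →
          ∫⁻ ω, (Q.regularized (Q.yOf w T)).numIter (U (Q.regularized (Q.yOf w T))) o m
              (Q.innerAcc T) (α T) ω ∂(Q.regularized (Q.yOf w T)).drawMeasure ≤
            ENNReal.ofReal (C * n * Real.log (Q.R ^ 2 / (Q.lam * Q.gam * n)))) ∧
        (m = n →
          ∫⁻ ω, (Q.regularized (Q.yOf w T)).runtime (U (Q.regularized (Q.yOf w T))) o m
              (Q.innerAcc T) (α T) ω ∂(Q.regularized (Q.yOf w T)).drawMeasure ≤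
            ENNReal.ofReal (C * d * n * Real.log (Q.R ^ 2 / (Q.lam * Q.gam * n))))) := by
  refine ⟨45, by norm_num, ?_⟩
  intro d k n _ Q hA ε hε o m hm U hU
  have hη := hA.eta_pos
  refine ⟨?_, fun hεξ => ⟨fun T w α e hgo => ?_, hA.outer_bound hε hεξ⟩,
    fun hξε T w α e hgo => ?_, fun T w α e hgo => ⟨fun hmn => ?_, fun hmn => ?_⟩⟩
  · obtain ⟨z, hz, hmin⟩ := hA.regular.exists_primal_min
    refine ⟨z, fun w hw => ?_, fun T w α e hT => ?_⟩
    · rw [hA.regular.primal_eq hz]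
      by_cases hwt : Q.g w = ⊤
      · rw [hA.regular.primal_eq_top hwt]
        exact EReal.coe_lt_top _
      · rw [hA.regular.primal_eq hwt, EReal.coe_lt_coe_iff]
        have h1 : 0 < Q.lam / 2 * ‖w - z‖ ^ 2 := by
          have h2 := hA.lam_pos
          have h3 := norm_pos_iff.2 (sub_ne_zero.2 hw)
          positivity
        linarith [hmin w hwt]
    · have h1 := hA.run_feasible hT.1 hT.1.one_le le_rfl
      rw [hA.regular.primal_eq hz, hA.regular.primal_eq h1.1, ← EReal.coe_add,
        EReal.coe_le_coe_iff]
      exact hA.primalR_le_of_terminates hε hT hz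
  -- No test precedes the first outer iteration, where the bound holds because log(ξ₁/ε) ≥ 0. Later
  -- the failure of the first stopping condition at `T` is the bound.
  · rcases hgo.1.one_le.eq_or_lt with rfl | hT
    · have h1 := Real.log_nonneg ((one_le_div hε).2 hεξ)
      have h2 : 0 ≤ 2 / Q.eta * Real.log (Q.xiOne / ε) := by positivity
      push_cast
      linarith
    · exact (not_le.1 fun h => hgo.2 hT (Or.inl h)).le
  · by_contra hT
    have hT2 : 2 ≤ T := by
      have := hgo.1.one_le
      omega
    -- For ξ₁ < ε the logarithm is nonpositive, so the first stopping condition holds as soon as it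
    -- is tested.
    refine hgo.2 hT2 (Or.inl ?_)
    have h1 : Real.log (Q.xiOne / ε) ≤ 0 :=
      Real.log_nonpos (div_nonneg hA.xiOne_nonneg hε.le) ((div_le_one hε).2 hξε.le)
    have h2 : 2 / Q.eta * Real.log (Q.xiOne / ε) ≤ 0 :=
      mul_nonpos_of_nonneg_of_nonpos (by positivity) h1
    have h3 : (2 : ℝ) ≤ T := by exact_mod_cast hT2
    linarith
  · refine (hA.lintegral_numIter_le hm hmn hU hgo.1).trans (ENNReal.ofReal_le_ofReal ?_)
    have h1 := hA.one_le_log_condNum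
    have h2 : (0 : ℝ) ≤ n * Real.log Q.condNum := by positivity
    rw [ProxSDCA.Problem.condNum] at *
    linarith
  · exact hA.lintegral_runtime_le hmn hU hgo.1
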